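/- **Setting.** "Efficient" means probabilistic polynomial time (PPT) in the security parameter $\ell$, and negligible means smaller than every inverse polynomial in $\ell$. The wallet system is built from - a perfectly correct digital signature scheme $\mathsf{DS}=(\mathsf{KGen},\mathsf{Sign},\mathsf{Verif})$ with efficient algorithms; - the Pedersen commitment scheme: an efficient $\mathsf{Gen}(1^\ell)$ outputs $\mathsf{params}=(\mathbb G,q,g,h)$ with $\mathbb G$ a group of prime order $q$ and $g,h$ generators, and $\mathsf{Commit}(m,r)=g^m h^r$ is efficiently computable; - an efficiently computable keyed function $\mathsf{PRF}_K$ with values in $\{0,1\}^{n(\ell)}$, $n$ a polynomial; - a perfectly correct ORAM scheme with $N(\ell)$ blocks ($1^{\ell}\mapsto 1^{N(\ell)}$ efficiently computable), which stores a record $(\mathsf{balance},\mathsf{ctr})$ for each household. *Setup.* Generate $\mathsf{params}$, the ORAM key and database $\mathsf{DB}$, a PRF key $K$, and a signature key pair $(\mathsf{sk},\mathsf{pk})$ of the registration station. *Registration* of a household with budget $\mathsf{bud}$: it gets the next free identifier $\mathsf{id}<N(\ell)$ (registration fails if none is left); the card checks $\mathsf{sk}$ against $\mathsf{pk}$ by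 signing and verifying a random $r\in\mathbb Z_q$, and writes $(\mathsf{bud},0)$ into block $\mathsf{id}$. *Spending* $\mathsf{price}$ in reclaim period $\varepsilon$: the card reads $(\mathsf{balance},\mathsf{ctr})$ from block $\mathsf{id}$ and aborts if $\mathsf{price}>\mathsf{balance}$. Otherwise it picks a uniform $r\in\mathbb Z_q$, computes $\mathsf{Com}=g^{\mathsf{price}}h^r$, $\tau=\mathsf{PRF}_K(\mathsf{id}\,\|\,(\mathsf{ctr}+1))$ and $\sigma=\mathsf{Sign}(\mathsf{sk},\tau\|\varepsilon\|\mathsf{Com})$, and writes back $(\mathsf{balance}-\mathsf{price},\mathsf{ctr}+1)$. The vendor verifies $\sigma$ and $\mathsf{Com}$ and keeps $(\mathsf{price},(\sigma,\tau,\mathsf{Com},r))$. *Reclaim proof* of a list $(\mathsf{price}_i,(\sigma_i,\tau_i,\mathsf{Com}_i,r_i))_i$ of transactions: the total is $\sum_i\mathsf{price}_i$ and the proof is $\pi=\bigl(r_{\mathrm{sum}},(\sigma_i,\tau_i,\mathsf{Com}_i)_i\bigr)$ with $r_{\mathrm{sum}}=\sum_i r_i \bmod q$; its length $|\pi|$ is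 the number of transactions. **Audit privacy experiment** $\mathrm{Exp}_{\mathcal A,b}(1^\ell)$, $b\in\{0,1\}$. After the setup, two worlds $0$ and $1$ are started with the same keys and the same initial database; from then on each has its own database and bookkeeping. The PPT adversary $\mathcal A$ gets $\mathsf{params}$ and $\mathsf{pk}$ and makes adaptive queries to two oracles: one registers, in a world of its choice, a household with a chosen budget and a chosen number of cards, and returns the identifiers of the cards; the other lets a chosen card of a chosen world spend a chosen price in a chosen period, records the transaction in that world if it succeeds, and returns nothing. Then $\mathcal A$ outputs a period $\varepsilon^*$. The reclaim proofs $\pi^0,\pi^1$ of the transactions recorded for $\varepsilon^*$ in the two worlds are formed. If the totals differ or $|\pi^0|\ne|\pi^1|$, the experiment returns $\bot$; otherwise $\mathcal A$ receives $\pi^b$, and the experiment returns its guess $b'\in\{0,1\}$. **Theorem (privacy at auditing).** Suppose that the commitment scheme is hiding (no PPT adversary that chooses two messages can tell, with non-negligible advantage, a commitment to one from a commitment to the other) and that the PRF is secure (no PPT oracle algorithm can tell $\mathsf{PRF}_K$, for a random key $K$, from a uniformly random function with non-negligible advantage). Then the system provides audit privacy: for every PPT adversary $\mathcal A$, $$\mathrm{Adv}_{\mathcal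 A}(\ell)=\bigl|\Pr[\mathrm{Exp}_{\mathcal A,0}(1^\ell)=1]-\Pr[\mathrm{Exp}_{\mathcal A,1}(1^\ell)=1]\bigr|$$ is negligible in $\ell$. -/

import Mathlib

/-! ## A step-counting model of computation

Data are binary trees whose leaves are natural numbers; numbers are measured by their binary length.
Programs are built from elementary operations by composition, pairing, case distinction and
loops over lists. -/

inductive Data : Type
  | num (n : ℕ)
  | pair (a b : Data)
  deriving DecidableEq

namespace Data

/-- Length of an encoding of the datum as a string, up to a constant factor. -/
def size : Data → ℕ
  | num n => 1 + n.size
  | pair a b => 1 + a.size + b.size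

def fst : Data → Data
  | num _ => num 0
  | pair a _ => a

def snd : Data → Data
  | num _ => num 0
  | pair _ b => b

def toNat : Data → ℕ
  | num n => n
  | pair _ _ => 0

/-- A datum read as a truth value: everything but `0` (and pairs) is true. -/
def toBool (x : Data) : Bool := decide (x.toNat ≠ 0)

def ofBool (b : Bool) : Data := num (if b then 1 else 0)

/-- The list `[a₁, …, aₙ]` is the datum `(a₁, (a₂, … (aₙ, 0)))`. -/
def ofList : List Data → Data
  | [] => num 0
  | a :: l => pair a (ofList l)

/-- The number of entries of a datum read as a list. -/
def length : Data → ℕ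
  | num _ => 0
  | pair _ b => b.length + 1

/-- The unary representation `1ⁿ`. -/
def unary (n : ℕ) : Data := ofList (List.replicate n (num 0))

end Data

/-- Elementary operations. -/
inductive Op : Type
  | id | const (d : Data) | fst | snd | isPair | eq | le | add | sub | mul | div | mod | clock

/-- Binary operations act on the two components of the input.  `clock` writes a list whose length
is the size of the input, so that loops can run for polynomially many rounds in the input size. -/
def Op.eval : Op → Data → Data
  | .id, x => x
  | .const d, _ => d
  | .fst, x => x.fst
  | .snd, x => x.snd
  | .isPair, .pair _ _ => .num 1
  | .isPair, .num _ => .num 0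
  | .eq, x => .ofBool (decide (x.fst = x.snd))
  | .le, x => .ofBool (decide (x.fst.toNat ≤ x.snd.toNat))
  | .add, x => .num (x.fst.toNat + x.snd.toNat)
  | .sub, x => .num (x.fst.toNat - x.snd.toNat)
  | .mul, x => .num (x.fst.toNat * x.snd.toNat)
  | .div, x => .num (x.fst.toNat / x.snd.toNat)
  | .mod, x => .num (x.fst.toNat % x.snd.toNat)
  | .clock, x => .unary x.size

inductive Code : Type
  | op (o : Op)
  | pair (f g : Code)
  | comp (g f : Code)
  | cond (c f g : Code)
  /-- On input `([a₁, …, aₙ], s)`: for `i = 1, …, n` do `s := f (aᵢ, s)`; return `s`. -/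
  | loop (f : Code)

/-- Runs the loop body `f` over a list, starting from state `p.1` with `p.2` steps already used. -/
def Code.runLoop (f : Data → Data × ℕ) : Data → Data × ℕ → Data × ℕ
  | .num _, p => p
  | .pair a l, p => Code.runLoop f l ((f (.pair a p.1)).1, p.2 + (f (.pair a p.1)).2 + 1)

/-- Output and running time of a program.  An elementary operation costs one plus the sizes of its
input and output (logarithmic cost). -/
def Code.run : Code → Data → Data × ℕ
  | .op o, x => (o.eval x, 1 + x.size + (o.eval x).size)
  | .pair f g, x => (.pair (f.run x).1 (g.run x).1, (f.run x).2 + (g.run x).2 + 1)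
  | .comp g f, x => ((g.run (f.run x).1).1, (f.run x).2 + (g.run (f.run x).1).2 + 1)
  | .cond c f g, x =>
      if (c.run x).1.toBool then ((f.run x).1, (c.run x).2 + (f.run x).2 + 1)
      else ((g.run x).1, (c.run x).2 + (g.run x).2 + 1)
  | .loop f, x => Code.runLoop f.run x.fst (x.snd, 1 + x.size + x.snd.size)

/-- `f` is computed by a program whose running time is polynomial in the size of the input. -/
def PolyTime (f : Data → Data) : Prop :=
  ∃ (c : Code) (p : Polynomial ℕ), ∀ x, (c.run x).1 = f x ∧ (c.run x).2 ≤ p.eval x.size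

/-! ## Randomized and interactive polynomial-time algorithms -/

noncomputable section

/-- A uniformly random string of `k` bits, as a number below `2 ^ k`. -/
def uniformBits (k : ℕ) : PMF ℕ := (PMF.uniformOfFintype (Fin (2 ^ k))).map (fun i => (i : ℕ))

/-- A uniformly random element of `{0, …, q - 1}`, for `q ≥ 1`. -/
def uniformBelow (q : ℕ) : PMF ℕ := (PMF.uniformOfFintype (Fin (q - 1 + 1))).map (fun i => (i : ℕ))

/-- The probability that an experiment outputs `a`. -/
def prob {α : Type} (p : PMF α) (a : α) : ℝ := (p a).toReal

/-- Negligible functions of the security parameter. -/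
def Negligible (f : ℕ → ℝ) : Prop :=
  Asymptotics.SuperpolynomialDecay Filter.atTop (fun l : ℕ => (l : ℝ)) f

/-- A probabilistic polynomial-time algorithm: a polynomial-time function of the security parameter
(in unary), the random coins and the input. -/
structure RandAlg where
  coins : Polynomial ℕ
  fn : Data → Data
  poly : PolyTime fn

def RandAlg.run (A : RandAlg) (l : ℕ) (x : Data) : PMF Data :=
  (uniformBits (A.coins.eval l)).map fun ρ => A.fn (.pair (.unary l) (.pair (.num ρ) x))

/-- What an interactive algorithm knows: the security parameter in unary, its coins, its input, and
the answers received so far (most recent first). -/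
def view (l ρ : ℕ) (input answers : Data) : Data :=
  .pair (.unary l) (.pair (.num ρ) (.pair input answers))

/-- A probabilistic polynomial-time algorithm with access to an oracle, given by its next-message
function.  In a run it asks `rounds l` queries; the query size is bounded in terms of the security
parameter alone, so that the total running time is polynomial in the security parameter. -/
structure OracleAlg where
  coins : Polynomial ℕ
  rounds : Polynomial ℕ
  bound : Polynomial ℕ
  query : Data → Data
  query_poly : PolyTime query
  query_size : ∀ l ρ input answers, (query (view l ρ input answers)).size ≤ bound.eval l

/-- `n` rounds of interaction with a stateful oracle. -/
def OracleAlg.interact (A : OracleAlg) {S : Type} (oracle : S → Data → PMF (Data × S))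
    (l ρ : ℕ) (input : Data) : ℕ → Data → S → PMF (Data × S)
  | 0, answers, s => pure (answers, s)
  | n + 1, answers, s => do
      let a ← oracle s (A.query (view l ρ input answers))
      A.interact oracle l ρ input n (.pair a.1 answers) a.2

/-- A complete run; returns the final view of the algorithm and the final state of the oracle. -/
def OracleAlg.run (A : OracleAlg) {S : Type} (oracle : S → Data → PMF (Data × S))
    (l : ℕ) (input : Data) (s : S) : PMF (Data × S) := do
  let ρ ← uniformBits (A.coins.eval l)
  let e ← A.interact oracle l ρ input (A.rounds.eval l) (.num 0) s
  pure (view l ρ input e.1, e.2)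

/-! ## Pseudorandom functions -/

/-- A keyed function with values in `{0,1}^(outLen l)` (numbers below `2 ^ outLen l`). -/
structure PRF where
  kgen : RandAlg
  outLen : Polynomial ℕ
  fn : Data → Data
  poly : PolyTime fn
  range : ∀ l, ∀ k ∈ (kgen.run l (.num 0)).support, ∀ x,
    (fn (.pair (.unary l) (.pair k x))).toNat < 2 ^ outLen.eval l

/-- `PRF_k(x)` at security parameter `l`. -/
def PRF.eval (F : PRF) (l : ℕ) (k x : Data) : ℕ := (F.fn (.pair (.unary l) (.pair k x))).toNat

structure Distinguisher extends OracleAlg where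
  output : Data → Data
  output_poly : PolyTime output

/-- A uniformly random function with values in `{0,1}^n`, sampled lazily. -/
def randomFunction (n : ℕ) (t : Data → Option ℕ) (x : Data) :
    PMF (Data × (Data → Option ℕ)) :=
  match t x with
  | some y => pure (.num y, t)
  | none => do
      let y ← uniformBits n
      pure (.num y, Function.update t x (some y))

def PRF.expReal (F : PRF) (B : Distinguisher) (l : ℕ) : PMF Bool := do
  let k ← F.kgen.run l (.num 0)
  let e ← B.run (fun (_ : Unit) x => pure (.num (F.eval l k x), ())) l (.num 0) ()
  pure (B.output e.1).toBool

def PRF.expIdeal (F : PRF) (B : Distinguisher) (l : ℕ) : PMF Bool := do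
  let e ← B.run (randomFunction (F.outLen.eval l)) l (.num 0) (fun _ => none)
  pure (B.output e.1).toBool

def PRF.Secure (F : PRF) : Prop :=
  ∀ B : Distinguisher,
    Negligible fun l => |prob (F.expReal B l) true - prob (F.expIdeal B l) true|

/-! ## Pedersen commitments -/

/-- The Pedersen commitment scheme over a family of groups.  The generation algorithm outputs public
parameters `P = (description, q, g, h)`, which determine a group `Grp P` of prime order `q` with
generators `g P` and `h P`.  Group elements are represented by data through `enc`. -/
structure Pedersen where
  gen : RandAlg
  Grp : Data → Type
  grp : ∀ P, CommGroup (Grp P)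
  g : ∀ P, Grp P
  h : ∀ P, Grp P
  enc : ∀ P, Grp P → Data
  commitFn : Data → Data
  commit_poly : PolyTime commitFn
  params : ∀ l, ∀ P ∈ (gen.run l (.num 0)).support, ∃ (descr : Data) (q : ℕ),
    P = .ofList [descr, .num q, enc P (g P), enc P (h P)] ∧
    q.Prime ∧ Nat.card (Grp P) = q ∧
    (∀ x : Grp P, x ∈ Subgroup.zpowers (g P)) ∧ (∀ x : Grp P, x ∈ Subgroup.zpowers (h P)) ∧
    Function.Injective (enc P) ∧
    ∀ m r : ℕ, commitFn (.pair (.unary l) (.ofList [P, .num m, .num r])) =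
      enc P (g P ^ m * h P ^ r)

attribute [instance] Pedersen.grp

/-- The group order `q`, read off the public parameters. -/
def Pedersen.order (_C : Pedersen) (P : Data) : ℕ := P.snd.fst.toNat

/-- The (encoded) commitment `g ^ m * h ^ r`. -/
def Pedersen.commit (C : Pedersen) (P : Data) (m r : ℕ) : Data := C.enc P (C.g P ^ m * C.h P ^ r)

structure HidingAdversary where
  coins : Polynomial ℕ
  choose : Data → Data
  choose_poly : PolyTime choose
  guess : Data → Data
  guess_poly : PolyTime guess

/-- The adversary picks two messages, sees a commitment to message number `b`, and guesses `b`. -/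
def Pedersen.expHiding (C : Pedersen) (A : HidingAdversary) (b : Bool) (l : ℕ) : PMF Bool := do
  let P ← C.gen.run l (.num 0)
  let ρ ← uniformBits (A.coins.eval l)
  let v := view l ρ P (.num 0)
  let m := if b then (A.choose v).snd.toNat else (A.choose v).fst.toNat
  let r ← uniformBelow (C.order P)
  pure (A.guess (.pair v (C.commit P m r))).toBool

def Pedersen.Hiding (C : Pedersen) : Prop :=
  ∀ A : HidingAdversary,
    Negligible fun l => |prob (C.expHiding A false l) true - prob (C.expHiding A true l) true|

/-! ## Digital signatures -/

/-- A (perfectly correct) digital signature scheme.  Key generation outputs the pair `(sk, pk)`. -/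
structure SignatureScheme where
  kgen : RandAlg
  signAlg : RandAlg
  verifFn : Data → Data
  verif_poly : PolyTime verifFn
  correct : ∀ l, ∀ k ∈ (kgen.run l (.num 0)).support, ∀ m,
    ∀ σ ∈ (signAlg.run l (.pair k.fst m)).support,
      (verifFn (.pair (.unary l) (.ofList [k.snd, m, σ]))).toBool = true

def SignatureScheme.sign (D : SignatureScheme) (l : ℕ) (sk m : Data) : PMF Data :=
  D.signAlg.run l (.pair sk m)

def SignatureScheme.verif (D : SignatureScheme) (l : ℕ) (pk m σ : Data) : Bool :=
  (D.verifFn (.pair (.unary l) (.ofList [pk, m, σ]))).toBool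

/-! ## Oblivious RAM

Only honest executions of the interactive protocols occur below, so `read` and `write` stand for the
joint executions `⟨Read, Serve⟩` and `⟨Write, Serve⟩`; they return the output of the client
(`none` and `false` are failures) and the updated database of the server. -/

structure ORAMAlgs (Block : Type) where
  Key : Type
  DB : Type
  init : ℕ → ℕ → PMF (Key × DB)
  read : Key → ℕ → DB → PMF (Option Block × DB)
  write : Key → ℕ → Block → DB → PMF (Bool × DB)

/-- The database `db` can arise, under the key `k`, from honest executions on `n` blocks, and `m` is
the array of the contents written last. -/
inductive ORAMAlgs.Reachable {Block : Type} (O : ORAMAlgs Block) (l n : ℕ) (k : O.Key) :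
    O.DB → (ℕ → Option Block) → Prop
  | init {db} : (k, db) ∈ (O.init l n).support → Reachable O l n k db (fun _ => none)
  | read {db m b e} : Reachable O l n k db m → b < n → e ∈ (O.read k b db).support →
      Reachable O l n k e.2 m
  | write {db m b v e} : Reachable O l n k db m → b < n → e ∈ (O.write k b v db).support →
      Reachable O l n k e.2 (Function.update m b (some v))

/-- A (perfectly correct) ORAM scheme: reading a block returns what was last written there. -/
structure ORAM (Block : Type) extends ORAMAlgs Block where
  read_correct : ∀ l n k db m b v, toORAMAlgs.Reachable l n k db m → b < n → m b = some v →
    ∀ e ∈ (read k b db).support, e.1 = some v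
  write_correct : ∀ l n k db m b v, toORAMAlgs.Reachable l n k db m → b < n →
    ∀ e ∈ (write k b v db).support, e.1 = true

/-! ## The wallet system -/

/-- The building blocks.  The ORAM holds one block `(balance, ctr)` for each of at most
`maxHouseholds l` households; this number is efficiently computable in unary. -/
structure WalletSystem where
  ds : SignatureScheme
  com : Pedersen
  prf : PRF
  oram : ORAM (ℕ × ℕ)
  maxHouseholds : ℕ → ℕ
  maxHouseholds_poly : ∃ f, PolyTime f ∧ ∀ l, f (.unary l) = .unary (maxHouseholds l)

namespace WalletSystem

/-- Output of the setup algorithms: public parameters, ORAM key, PRF key, initial database, and the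
key pair of the registration station. -/
structure Setup (W : WalletSystem) where
  params : Data
  oramKey : W.oram.Key
  prfKey : Data
  db : W.oram.DB
  skRS : Data
  pkRS : Data

/-- `TrustedSetup(1^l, N)` followed by `SetupRSKeys(1^l)`. -/
def setup (W : WalletSystem) (l : ℕ) : PMF W.Setup := do
  let P ← W.com.gen.run l (.num 0)
  let o ← W.oram.init l (W.maxHouseholds l)
  let k ← W.prf.kgen.run l (.num 0)
  let s ← W.ds.kgen.run l (.num 0)
  pure ⟨P, o.1, k, o.2, s.fst, s.snd⟩

/-- State of a card as set up by the trusted party. -/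
structure BlankCard (W : WalletSystem) where
  pkRS : Data
  oramKey : W.oram.Key
  prfKey : Data

/-- State of a registered card. -/
structure Card (W : WalletSystem) extends BlankCard W where
  skRS : Data
  idH : ℕ

def setupCard (W : WalletSystem) (S : W.Setup) : W.BlankCard := ⟨S.pkRS, S.oramKey, S.prfKey⟩

/-- The honest execution `⟨Request(st), Allocate(skRS, bud, DB)⟩`, where `next` is the next available
household identifier (none is left if all `maxHouseholds l` of them are taken). -/
def register (W : WalletSystem) (l : ℕ) (P : Data) (st : W.BlankCard) (skRS : Data) (bud next : ℕ)
    (db : W.oram.DB) : PMF (Option W.Card × W.oram.DB) :=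
  if next < W.maxHouseholds l then do
    let r ← uniformBelow (W.com.order P)
    let σ ← W.ds.sign l skRS (.num r)
    if W.ds.verif l st.pkRS (.num r) σ = true then do
      let w ← W.oram.write st.oramKey next (bud, 0) db
      pure (some ⟨st, skRS, next⟩, w.2)
    else pure (none, db)
  else pure (none, db)

/-- A proof of transaction `π = (σ, τ, Com, r)`. -/
structure TransProof where
  sig : Data
  tag : ℕ
  com : Data
  r : ℕ

/-- The signed message `τ ∥ ε ∥ Com`. -/
def signedMessage (τ ε : ℕ) (com : Data) : Data := .ofList [.num τ, .num ε, com]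

/-- The honest execution `⟨Spend(st, price), Receive(ε, price, DB)⟩`; returns the proof accepted by
the vendor (`none` if the transaction fails) and the database. -/
def spend (W : WalletSystem) (l : ℕ) (P : Data) (st : W.Card) (ε price : ℕ) (db : W.oram.DB) :
    PMF (Option TransProof × W.oram.DB) := do
  let e ← W.oram.read st.oramKey st.idH db
  match e.1 with
  | none => pure (none, e.2)
  | some (balance, ctr) =>
    if price ≤ balance then do
      let r ← uniformBelow (W.com.order P)
      let com := W.com.commit P price r
      let τ := W.prf.eval l st.prfKey (.pair (.num st.idH) (.num (ctr + 1)))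
      let σ ← W.ds.sign l st.skRS (signedMessage τ ε com)
      let w ← W.oram.write st.oramKey st.idH (balance - price, ctr + 1) e.2
      if W.ds.verif l st.pkRS (signedMessage τ ε com) σ = true ∧ com = W.com.commit P price r then
        pure (some ⟨σ, τ, com, r⟩, w.2)
      else pure (none, w.2)
    else pure (none, e.2)

/-- A reclaim proof `(r_sum, (σ, τ, Com)_i)`. -/
structure ReclaimProof where
  rSum : ℕ
  entries : List (Data × ℕ × Data)

/-- The total amount and the reclaim proof for a list of pairs (amount, proof of transaction). -/
def createReclaimProof (W : WalletSystem) (P : Data) (T : List (ℕ × TransProof)) :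
    ℕ × ReclaimProof :=
  ((T.map fun t => t.1).sum,
    ⟨(T.map fun t => t.2.r).sum % W.com.order P,
      T.map fun t => (t.2.sig, t.2.tag, t.2.com)⟩)

def ReclaimProof.toData (π : ReclaimProof) : Data :=
  .pair (.num π.rSum) (.ofList (π.entries.map fun e => .ofList [e.1, .num e.2.1, e.2.2]))

/-! ## The audit privacy experiment -/

/-- The variables of one world. -/
structure World (W : WalletSystem) where
  db : W.oram.DB
  /-- next available household identifier -/
  nextId : ℕ
  /-- number of cards issued -/
  counter : ℕ
  cards : ℕ → Option W.Card
  /-- received transactions of each reclaim period, in order of arrival -/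
  received : ℕ → List (ℕ × TransProof)

inductive AuditQuery : Type
  /-- Register a household with `tnb` cards and budget `bud`. -/
  | reg (world : Bool) (bud tnb : ℕ)
  /-- Spend `price` in period `ε` with card `tid`. -/
  | spend (world : Bool) (ε tid price : ℕ)
  | skip

/-- Amounts, periods and card identifiers are written in binary, the number of cards to issue in
unary. -/
def AuditQuery.decode (x : Data) : AuditQuery :=
  match x.fst.toNat with
  | 0 => .reg x.snd.fst.toBool x.snd.snd.fst.toNat x.snd.snd.snd.length
  | 1 => .spend x.snd.fst.toBool x.snd.snd.fst.toNat x.snd.snd.snd.fst.toNat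
      x.snd.snd.snd.snd.toNat
  | _ => .skip

/-- The registration oracle in one world; returns the identifiers of the new cards. -/
def regOracle (W : WalletSystem) (l : ℕ) (S : W.Setup) (w : W.World) (bud tnb : ℕ) :
    PMF (Data × W.World) := do
  let e ← W.register l S.params (W.setupCard S) S.skRS bud w.nextId w.db
  match e.1 with
  | none => pure (.num 0, { w with db := e.2 })
  | some st =>
      pure (.ofList ((List.range tnb).map fun i => .num (w.counter + i + 1)),
        { w with
          db := e.2
          nextId := w.nextId + 1
          counter := w.counter + tnb
          cards := fun t => if w.counter < t ∧ t ≤ w.counter + tnb then some st else w.cards t })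

/-- The spending oracle in one world; it records successful transactions and returns nothing. -/
def spendOracle (W : WalletSystem) (l : ℕ) (S : W.Setup) (w : W.World) (ε tid price : ℕ) :
    PMF (Data × W.World) :=
  match w.cards tid with
  | none => pure (.num 0, w)
  | some st => do
      let e ← W.spend l S.params st ε price w.db
      match e.1 with
      | none => pure (.num 0, { w with db := e.2 })
      | some π =>
          pure (.num 0, { w with
            db := e.2
            received := Function.update w.received ε (w.received ε ++ [(price, π)]) })

/-- The two split-world oracles together; the state consists of the two worlds. -/
def auditOracle (W : WalletSystem) (l : ℕ) (S : W.Setup) (ws : Bool → W.World) (x : Data) :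
    PMF (Data × (Bool → W.World)) :=
  match AuditQuery.decode x with
  | .reg b bud tnb => do
      let e ← W.regOracle l S (ws b) bud tnb
      pure (e.1, Function.update ws b e.2)
  | .spend b ε tid price => do
      let e ← W.spendOracle l S (ws b) ε tid price
      pure (e.1, Function.update ws b e.2)
  | .skip => pure (.num 0, ws)

/-- A malicious auditor: an oracle algorithm that then chooses the challenge period, and finally, given
its view and the reclaim proof, outputs a guess. -/
structure AuditAdversary extends OracleAlg where
  period : Data → Data
  period_poly : PolyTime period
  guess : Data → Data
  guess_poly : PolyTime guess

/-- The audit privacy experiment in which the adversary receives the reclaim proof of world `b`.  It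
returns the guess of the adversary, or `none` if the totals or the lengths of the two proofs differ. -/
def expAudit (W : WalletSystem) (A : AuditAdversary) (b : Bool) (l : ℕ) : PMF (Option Bool) := do
  let S ← W.setup l
  let w₀ : W.World := ⟨S.db, 0, 0, fun _ => none, fun _ => []⟩
  let e ← A.run (W.auditOracle l S) l (.pair S.params S.pkRS) (fun _ => w₀)
  let ε := (A.period e.1).toNat
  let c := fun b' : Bool => W.createReclaimProof S.params ((e.2 b').received ε)
  if (c false).1 ≠ (c true).1 ∨ (c false).2.entries.length ≠ (c true).2.entries.length then
    pure none
  else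
    pure (some (A.guess (.pair e.1 (c b).2.toData)).toBool)

def auditAdvantage (W : WalletSystem) (A : AuditAdversary) (l : ℕ) : ℝ :=
  |prob (W.expAudit A false l) (some true) - prob (W.expAudit A true l) (some true)|

def AuditPrivacy (W : WalletSystem) : Prop :=
  ∀ A : AuditAdversary, Negligible (W.auditAdvantage A)

end WalletSystem

end

/-! ## Feasible functions

A typed layer over programs: `Feasible f` says that a program computes `f` on representations of its
arguments in polynomial time.  Nothing is required of the program on other data. -/

/-! The theorem follows from one exchange of the pseudorandom function for a random function in each
world, followed by an exact equality of distributions.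

The equality: suppose the tags of the challenge transactions are independent uniform strings. As `h`
generates the group, `g = h ^ t` for some `t`, so `g ^ p * h ^ r` does not change when the price `p`
becomes `p'` and `r` becomes `r + t * (p - p')` modulo `q`. This shift preserves the uniform
distribution of `r`, and over the whole list the shifts add up to `t` times the difference of the
totals, which is zero when the experiment does not abort. Hence commitments and `rSum` have the same
joint law in both worlds, and so do the signatures, which depend only on keys, coins, tags, period
and commitments (`mkTransList_corrections`, `game_uniformTags`).

The exchange: tags are values of the function at pairs (household, counter). A spending raises the
counter, so the pairs within one world are distinct (`nodup_challenge`), and a random function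
answers them with independent uniform strings (`interact_randomFunction`).

What makes the reduction possible is that the answers to the adversary carry no randomness: by
perfect correctness of signatures and ORAM, every success or failure is determined by the queries.
The interaction is therefore a deterministic function of the parameters, the public key and the
adversary's coins (`simRun`), computable without the ORAM and without the PRF key, and the recorded
transactions may be sampled after it has ended (`interact_spec`, `expAudit_eq_game`). The
distinguisher `reduction` replays this simulation, asks its oracle for the tags of one world in the
challenge period, and assembles the reclaim proof itself.

Two things have to be paid for. The distinguisher must be a polynomial-time program, which is the
purpose of `Feasible` and of the size bounds on the simulated worlds. And its coins are bits, so
exponents modulo `q` are only nearly uniform; taking them as digits of a long random number costs a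
factor `1 + 2 ^ (-l)` (`leMul_uniformBits_map_lowDigits`). Altogether the advantage is at most two
PRF advantages plus `4 * 2 ^ (-l)` (`auditAdvantage_le`). -/

lemma Polynomial.eval_mono_nat (p : Polynomial ℕ) {a b : ℕ} (h : a ≤ b) : p.eval a ≤ p.eval b := by
  rw [Polynomial.eval_eq_sum_range, Polynomial.eval_eq_sum_range]
  gcongr

/-! ### Sizes of data, and output size against running time -/

namespace Data

def toList : Data → List Data
  | num _ => []
  | pair a b => a :: b.toList

@[simp] lemma toList_ofList (l : List Data) : (ofList l).toList = l := by
  induction l with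
  | nil => rfl
  | cons a l ih => simp [ofList, toList, ih]

lemma length_eq (x : Data) : x.length = x.toList.length := by
  induction x with
  | num n => rfl
  | pair a b _ ih => simp [length, toList, ih]

lemma size_ofList_le {l : List Data} {M : ℕ} (h : ∀ x ∈ l, x.size ≤ M) :
    (ofList l).size ≤ l.length * (M + 1) + 1 := by
  induction l with
  | nil => simp [ofList, size]
  | cons a l ih =>
    have h1 := h a (by simp)
    have h2 := ih fun x hx => h x (by simp [hx])
    simp only [ofList, size, List.length_cons]
    linarith

lemma length_le_size_ofList (l : List Data) : l.length + 1 ≤ (ofList l).size := by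
  induction l with
  | nil => simp [ofList, size]
  | cons a l ih => simp only [ofList, size, List.length_cons]; omega

lemma size_le_of_mem {l : List Data} {x : Data} (h : x ∈ l) : x.size ≤ (ofList l).size := by
  induction l with
  | nil => simp at h
  | cons a l ih =>
    simp only [ofList, size]
    rcases List.mem_cons.1 h with rfl | h
    · omega
    · have := ih h; omega

lemma size_unary (n : ℕ) : (unary n).size = 2 * n + 1 := by
  induction n with
  | zero => rfl
  | succ n ih =>
    have : unary (n + 1) = pair (num 0) (unary n) := rfl
    rw [this]; simp only [size, ih, Nat.size_zero]; omega

lemma length_unary (n : ℕ) : (unary n).length = n := by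
  simp [unary, length_eq]

lemma length_lt_size (x : Data) : x.length < x.size := by
  induction x with
  | num n => simp [length, size]
  | pair a b _ ih => simp only [length, size]; omega

lemma size_fst_le (x : Data) : x.fst.size ≤ x.size := by
  cases x <;> simp only [fst, size, Nat.size_zero] <;> omega

lemma size_snd_le (x : Data) : x.snd.size ≤ x.size := by
  cases x <;> simp only [snd, size, Nat.size_zero] <;> omega

lemma size_toNat_le (x : Data) : x.toNat.size ≤ x.size := by
  cases x <;> simp [toNat, size]

end Data

lemma Nat.size_le_self (n : ℕ) : n.size ≤ n := Nat.size_le.2 Nat.lt_two_pow_self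

lemma Code.size_runLoop_le (f : Data → Data × ℕ) (hf : ∀ x, (f x).1.size ≤ (f x).2) (l : Data) :
    ∀ p : Data × ℕ, p.1.size ≤ p.2 → (Code.runLoop f l p).1.size ≤ (Code.runLoop f l p).2 := by
  induction l with
  | num n => intro p hp; exact hp
  | pair a l _ ih =>
    intro p hp
    simp only [Code.runLoop]
    apply ih
    have := hf (.pair a p.1)
    dsimp only; omega

/-- Writing the output is charged in every elementary operation. Thus a time bound is also a size
bound, which is what makes polynomial time closed under composition. -/
lemma Code.size_run_le (c : Code) : ∀ x, (c.run x).1.size ≤ (c.run x).2 := by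
  induction c with
  | op o => intro x; simp only [Code.run]; omega
  | pair f g hf hg =>
    intro x; have := hf x; have := hg x
    simp only [Code.run, Data.size]; omega
  | comp g f hg hf =>
    intro x; have := hg (f.run x).1
    simp only [Code.run]; omega
  | cond c f g _ hf hg =>
    intro x; have := hf x; have := hg x
    simp only [Code.run]; split <;> dsimp only <;> omega
  | loop f hf =>
    intro x; simp only [Code.run]
    exact Code.size_runLoop_le _ hf _ _ (by dsimp only; omega)

/-- A representation of the elements of a type by data. -/
class DataRep (α : Type) where
  rep : α → Data

open DataRep

/-- The size of the representation. -/
def repSize {α : Type} [DataRep α] (a : α) : ℕ := (rep a).size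

instance : DataRep Data := ⟨fun x => x⟩
instance : DataRep ℕ := ⟨Data.num⟩
instance : DataRep Bool := ⟨Data.ofBool⟩
instance {α β : Type} [DataRep α] [DataRep β] : DataRep (α × β) :=
  ⟨fun p => .pair (rep p.1) (rep p.2)⟩
instance {α : Type} [DataRep α] : DataRep (List α) := ⟨fun l => .ofList (l.map rep)⟩
instance {α : Type} [DataRep α] : DataRep (Option α) := ⟨fun o => .ofList (o.toList.map rep)⟩

/-- Natural numbers, represented in unary. -/
structure Unary where
  val : ℕ

instance : DataRep Unary := ⟨fun n => .unary n.val⟩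

/-- `f` is computed on representations by a polynomial-time program. -/
def Feasible {α β : Type} [DataRep α] [DataRep β] (f : α → β) : Prop :=
  ∃ (c : Code) (p : Polynomial ℕ), ∀ a,
    (c.run (rep a)).1 = rep (f a) ∧ (c.run (rep a)).2 ≤ p.eval (repSize a)

/-- A quantity bounded by a polynomial in the size of the argument. -/
def PolyBounded {α : Type} [DataRep α] (f : α → ℕ) : Prop :=
  ∃ p : Polynomial ℕ, ∀ a, f a ≤ p.eval (repSize a)

section

variable {α β γ σ τ : Type} [DataRep α] [DataRep β] [DataRep γ] [DataRep σ] [DataRep τ]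

lemma repSize_pair (p : α × β) : repSize p = 1 + repSize p.1 + repSize p.2 := rfl

lemma repSize_list_le {l : List α} {M : ℕ} (h : ∀ x ∈ l, repSize x ≤ M) :
    repSize l ≤ l.length * (M + 1) + 1 := by
  have := Data.size_ofList_le (l := l.map rep) (M := M) (by simpa [repSize] using h)
  rwa [List.length_map] at this

lemma length_lt_repSize (l : List α) : l.length < repSize l := by
  have := Data.length_le_size_ofList (l.map rep)
  simpa [repSize, rep] using this

lemma repSize_le_of_mem {l : List α} {x : α} (h : x ∈ l) : repSize x ≤ repSize l :=
  Data.size_le_of_mem (List.mem_map_of_mem h)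

lemma repSize_sublist_le {l l' : List α} (h : l'.Sublist l) : repSize l' ≤ repSize l := by
  induction h with
  | slnil => rfl
  | cons a _ ih =>
    refine ih.trans ?_
    simp only [repSize, rep, List.map_cons, Data.ofList, Data.size]; omega
  | cons_cons a _ ih =>
    simp only [repSize, rep, List.map_cons, Data.ofList, Data.size] at ih ⊢; omega

namespace PolyBounded

lemma mono {f g : α → ℕ} (hg : PolyBounded g) (h : ∀ a, f a ≤ g a) : PolyBounded f :=
  let ⟨p, hp⟩ := hg
  ⟨p, fun a => (h a).trans (hp a)⟩

lemma const (n : ℕ) : PolyBounded fun _ : α => n := ⟨.C n, fun a => by simp⟩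

lemma repSize : PolyBounded fun a : α => _root_.repSize a := ⟨.X, fun a => by simp⟩

lemma add {f g : α → ℕ} (hf : PolyBounded f) (hg : PolyBounded g) :
    PolyBounded fun a => f a + g a :=
  let ⟨p, hp⟩ := hf
  let ⟨q, hq⟩ := hg
  ⟨p + q, fun a => by simpa using add_le_add (hp a) (hq a)⟩

lemma mul {f g : α → ℕ} (hf : PolyBounded f) (hg : PolyBounded g) :
    PolyBounded fun a => f a * g a :=
  let ⟨p, hp⟩ := hf
  let ⟨q, hq⟩ := hg
  ⟨p * q, fun a => by simpa using Nat.mul_le_mul (hp a) (hq a)⟩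

lemma eval (P : Polynomial ℕ) {f : α → ℕ} (hf : PolyBounded f) :
    PolyBounded fun a => P.eval (f a) :=
  let ⟨p, hp⟩ := hf
  ⟨P.comp p, fun a => by simpa using P.eval_mono_nat (hp a)⟩

end PolyBounded

lemma Feasible.polyBounded {f : α → β} (hf : Feasible f) : PolyBounded fun a => repSize (f a) :=
  let ⟨c, p, h⟩ := hf
  ⟨p, fun a => by
    have := c.size_run_le (rep a)
    rw [(h a).1] at this
    exact this.trans (h a).2⟩

lemma feasible_iff_polyTime {f : Data → Data} : Feasible f ↔ PolyTime f := Iff.rfl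

namespace Feasible

/-- Only the representations of argument and value matter. -/
lemma of_rep_eq {f : α → β} (hf : Feasible f) {g : γ → σ} (e : γ → α)
    (he : ∀ c, rep (e c) = rep c) (hg : ∀ c, rep (g c) = rep (f (e c))) : Feasible g := by
  obtain ⟨c, p, h⟩ := hf
  refine ⟨c, p, fun a => ?_⟩
  have := h (e a)
  simp only [repSize, he, ← hg] at this
  exact this

lemma of_eq {f g : α → β} (hf : Feasible f) (h : ∀ a, g a = f a) : Feasible g := by
  rwa [show g = f from funext h]

lemma of_op (o : Op) {f : α → β} (h : ∀ a, o.eval (rep a) = rep (f a))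
    (hb : PolyBounded fun a => repSize (f a)) : Feasible f := by
  obtain ⟨p, hp⟩ := hb
  refine ⟨.op o, 1 + .X + p, fun a => ⟨h a, ?_⟩⟩
  simp only [Code.run, h, Polynomial.eval_add, Polynomial.eval_one, Polynomial.eval_X]
  have := hp a
  simp only [repSize] at *
  omega

lemma id : Feasible fun a : α => a := of_op .id (fun _ => rfl) .repSize

lemma const (b : β) : Feasible fun _ : α => b := of_op (.const (rep b)) (fun _ => rfl) (.const _)

/-- The second program runs on a value whose size is bounded by the running time of the first, hence
the composed polynomial `q.comp s`. -/
lemma comp {g : β → γ} {f : α → β} (hg : Feasible g) (hf : Feasible f) :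
    Feasible fun a => g (f a) := by
  obtain ⟨s, hs⟩ := hf.polyBounded
  obtain ⟨c, p, h⟩ := hf
  obtain ⟨d, q, k⟩ := hg
  refine ⟨.comp d c, p + q.comp s + 1, fun a => ?_⟩
  simp only [Code.run, (h a).1]
  refine ⟨(k _).1, ?_⟩
  have h1 := (h a).2
  have h2 := (k (f a)).2.trans (q.eval_mono_nat (hs a))
  simp only [Polynomial.eval_add, Polynomial.eval_comp, Polynomial.eval_one]
  omega

lemma prodMk {f : α → β} {g : α → γ} (hf : Feasible f) (hg : Feasible g) :
    Feasible fun a => (f a, g a) := by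
  obtain ⟨c, p, h⟩ := hf
  obtain ⟨d, q, k⟩ := hg
  refine ⟨.pair c d, p + q + 1, fun a => ?_⟩
  have h1 := (h a).2
  have h2 := (k a).2
  simp only [Code.run, (h a).1, (k a).1, Polynomial.eval_add, Polynomial.eval_one]
  exact ⟨rfl, by omega⟩

lemma fst {f : α → β × γ} (hf : Feasible f) : Feasible fun a => (f a).1 :=
  comp (g := Prod.fst) (of_op .fst (fun _ => rfl)
    (.mono .repSize fun p => by rw [repSize_pair]; omega)) hf

lemma snd {f : α → β × γ} (hf : Feasible f) : Feasible fun a => (f a).2 :=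
  comp (g := Prod.snd) (of_op .snd (fun _ => rfl)
    (.mono .repSize fun p => by rw [repSize_pair]; omega)) hf

lemma ite_bool {c : α → Bool} {f g : α → β} (hc : Feasible c) (hf : Feasible f) (hg : Feasible g) :
    Feasible fun a => if c a = true then f a else g a := by
  obtain ⟨c₀, r, hr⟩ := hc
  obtain ⟨c₁, p, h⟩ := hf
  obtain ⟨c₂, q, k⟩ := hg
  refine ⟨.cond c₀ c₁ c₂, r + p + q + 1, fun a => ?_⟩
  have h0 := (hr a).2
  have h1 := (h a).2
  have h2 := (k a).2
  have : (rep (c a)).toBool = c a := by cases c a <;> rfl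
  simp only [Code.run, (hr a).1, this, Polynomial.eval_add, Polynomial.eval_one]
  split
  · exact ⟨(h a).1, by dsimp only; omega⟩
  · exact ⟨(k a).1, by dsimp only; omega⟩

lemma ite {c : α → Prop} [DecidablePred c] {f g : α → β} (hc : Feasible fun a => decide (c a))
    (hf : Feasible f) (hg : Feasible g) : Feasible fun a => if c a then f a else g a :=
  (hc.ite_bool hf hg).of_eq fun a => by simp

section arithmetic

variable {f g : α → ℕ}

lemma repSize_nat (n : ℕ) : repSize n = 1 + n.size := rfl

lemma nat_of_op (o : Op) (h : ℕ → ℕ → ℕ)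
    (ho : ∀ a b : ℕ, o.eval (.pair (.num a) (.num b)) = .num (h a b))
    (hs : ∀ a b, (h a b).size ≤ a.size + b.size + 1) (hf : Feasible f) (hg : Feasible g) :
    Feasible fun a => h (f a) (g a) :=
  comp (g := fun p : ℕ × ℕ => h p.1 p.2) (of_op o (fun p => ho p.1 p.2)
    (.mono .repSize fun p => by
      have := hs p.1 p.2
      simp only [repSize_pair, repSize_nat]; omega)) (hf.prodMk hg)

lemma add (hf : Feasible f) (hg : Feasible g) : Feasible fun a => f a + g a :=
  nat_of_op .add (· + ·) (fun _ _ => rfl) (fun a b => by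
    rw [Nat.size_le]
    have h1 := Nat.lt_size_self a
    have h2 := Nat.lt_size_self b
    have h3 : 2 ^ a.size ≤ 2 ^ (a.size + b.size) := Nat.pow_le_pow_right (by norm_num) (by omega)
    have h4 : 2 ^ b.size ≤ 2 ^ (a.size + b.size) := Nat.pow_le_pow_right (by norm_num) (by omega)
    rw [pow_succ]; omega) hf hg

lemma sub (hf : Feasible f) (hg : Feasible g) : Feasible fun a => f a - g a :=
  nat_of_op .sub (· - ·) (fun _ _ => rfl) (fun a b => by
    have := Nat.size_le_size (Nat.sub_le a b); omega) hf hg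

lemma mul (hf : Feasible f) (hg : Feasible g) : Feasible fun a => f a * g a :=
  nat_of_op .mul (· * ·) (fun _ _ => rfl) (fun a b => by
    refine le_trans (Nat.size_le.2 ?_) (Nat.le_succ _)
    rw [pow_add]
    exact Nat.mul_lt_mul'' (Nat.lt_size_self a) (Nat.lt_size_self b)) hf hg

lemma div (hf : Feasible f) (hg : Feasible g) : Feasible fun a => f a / g a :=
  nat_of_op .div (· / ·) (fun _ _ => rfl) (fun a b => by
    have := Nat.size_le_size (Nat.div_le_self a b); omega) hf hg

lemma mod (hf : Feasible f) (hg : Feasible g) : Feasible fun a => f a % g a :=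
  nat_of_op .mod (· % ·) (fun _ _ => rfl) (fun a b => by
    have := Nat.size_le_size (Nat.mod_le a b); omega) hf hg

lemma repSize_bool_le (b : Bool) : repSize b ≤ 2 := by cases b <;> decide

lemma decide_le (hf : Feasible f) (hg : Feasible g) : Feasible fun a => decide (f a ≤ g a) :=
  comp (g := fun p : ℕ × ℕ => decide (p.1 ≤ p.2)) (of_op .le (fun _ => rfl)
    (.mono (.const 2) fun _ => repSize_bool_le _)) (hf.prodMk hg)

lemma decide_eq (hf : Feasible f) (hg : Feasible g) : Feasible fun a => decide (f a = g a) :=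
  comp (g := fun p : ℕ × ℕ => decide (p.1 = p.2)) (of_op .eq (fun p => by
      simp [Op.eval, rep, Data.fst, Data.snd])
    (.mono (.const 2) fun _ => repSize_bool_le _)) (hf.prodMk hg)

end arithmetic

section bool

variable {p q : α → Prop} [DecidablePred p] [DecidablePred q]

lemma decide_not (hp : Feasible fun a => decide (p a)) : Feasible fun a => decide (¬ p a) :=
  (hp.ite (const false) (const true)).of_eq fun a => by by_cases h : p a <;> simp [h]

lemma decide_and (hp : Feasible fun a => decide (p a)) (hq : Feasible fun a => decide (q a)) :
    Feasible fun a => decide (p a ∧ q a) :=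
  (hp.ite hq (const false)).of_eq fun a => by by_cases h : p a <;> simp [h]

lemma decide_or (hp : Feasible fun a => decide (p a)) (hq : Feasible fun a => decide (q a)) :
    Feasible fun a => decide (p a ∨ q a) :=
  (hp.ite (const true) hq).of_eq fun a => by by_cases h : p a <;> simp [h]

lemma decide_lt {f g : α → ℕ} (hf : Feasible f) (hg : Feasible g) :
    Feasible fun a => decide (f a < g a) :=
  (decide_not (hg.decide_le hf)).of_eq fun a => by simp

end bool

section data

variable {f g : α → Data}

lemma dataPair (hf : Feasible f) (hg : Feasible g) : Feasible fun a => Data.pair (f a) (g a) :=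
  (hf.prodMk hg).of_rep_eq (fun a => a) (fun _ => rfl) fun _ => rfl

lemma dataNum {f : α → ℕ} (hf : Feasible f) : Feasible fun a => Data.num (f a) :=
  hf.of_rep_eq (fun a => a) (fun _ => rfl) fun _ => rfl

lemma dataUnary {f : α → Unary} (hf : Feasible f) : Feasible fun a => Data.unary (f a).val :=
  hf.of_rep_eq (fun a => a) (fun _ => rfl) fun _ => rfl

lemma dataOfList {f : α → List Data} (hf : Feasible f) : Feasible fun a => Data.ofList (f a) :=
  hf.of_rep_eq (fun a => a) (fun _ => rfl) fun a => by
    simp [rep]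

lemma dataFst (hf : Feasible f) : Feasible fun a => (f a).fst :=
  comp (g := Data.fst) (of_op .fst (fun _ => rfl) (.mono .repSize Data.size_fst_le)) hf

lemma dataSnd (hf : Feasible f) : Feasible fun a => (f a).snd :=
  comp (g := Data.snd) (of_op .snd (fun _ => rfl) (.mono .repSize Data.size_snd_le)) hf

/-- Subtracting `0` is the elementary operation that keeps a number and sends a pair to `0`. -/
lemma dataToNat (hf : Feasible f) : Feasible fun a => (f a).toNat :=
  comp (g := fun p : Data × ℕ => p.1.toNat - p.2) (of_op .sub (fun _ => rfl)
    (.mono (.add (.const 1) .repSize) fun p => by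
      have h1 := Nat.size_le_size (Nat.sub_le p.1.toNat p.2)
      have h2 : p.1.toNat.size ≤ repSize p.1 := p.1.size_toNat_le
      rw [repSize_nat, repSize_pair]; omega)) (hf.prodMk (const 0))

lemma dataToBool (hf : Feasible f) : Feasible fun a => (f a).toBool :=
  decide_not (hf.dataToNat.decide_eq (const 0))

end data

end Feasible

end

/-! ### Loops, case distinctions, lists and unary numbers -/

section

variable {α β γ σ τ : Type} [DataRep α] [DataRep β] [DataRep γ] [DataRep σ] [DataRep τ]

lemma Code.runLoop_rep {body : Data → Data × ℕ} {g : σ → α → σ}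
    (hbody : ∀ a s, (body (.pair (rep a) (rep s))).1 = rep (g s a)) (l : List α) :
    ∀ s t, (Code.runLoop body (rep l) (rep s, t)).1 = rep (l.foldl g s) := by
  induction l with
  | nil => intro s t; rfl
  | cons a l ih =>
    intro s t
    change (Code.runLoop body (rep l) _).1 = _
    rw [hbody, ih]; rfl

/-- The bound `M` is asked only at states reached along prefixes of the list; no bound uniform in
all states would be available. -/
lemma Code.runLoop_time_le {body : Data → Data × ℕ} {g : σ → α → σ} {M : ℕ}
    (hbody : ∀ a s, (body (.pair (rep a) (rep s))).1 = rep (g s a)) (l : List α) :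
    ∀ s t, (∀ l' a, l' ++ [a] <+: l → (body (.pair (rep a) (rep (l'.foldl g s)))).2 ≤ M) →
      (Code.runLoop body (rep l) (rep s, t)).2 ≤ t + l.length * (M + 1) := by
  induction l with
  | nil => intro s t _; exact Nat.le_add_right _ _
  | cons a l ih =>
    intro s t h
    change (Code.runLoop body (rep l) _).2 ≤ _
    rw [hbody]
    have h0 := h [] a (by simp)
    have h1 := ih (g s a) (t + (body (.pair (rep a) (rep s))).2 + 1) fun l' b hl => by
      simpa using h (a :: l') b (by simpa using hl)
    simp only [List.foldl_nil, List.length_cons] at h0 ⊢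
    refine h1.trans ?_
    rw [Nat.succ_mul]; omega

namespace Feasible

/-- Polynomially many polynomial-time steps need not be polynomial, since the state may be squared
in every round. The hypothesis `hb` excludes this by a polynomial bound on all intermediate states.
-/
lemma foldl {f : γ → List α} {init : γ → σ} {step : γ → σ → α → σ}
    (hstep : Feasible fun p : α × γ × σ => step p.2.1 p.2.2 p.1) (hf : Feasible f)
    (hinit : Feasible init) {B : γ → ℕ} (hB : PolyBounded B)
    (hb : ∀ c l', l' <+: f c → repSize (l'.foldl (step c) (init c)) ≤ B c) :
    Feasible fun c => (f c).foldl (step c) (init c) := by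
  -- A loop body sees only the current entry and the state, so the context `c` is carried along as a
  -- first component of the state and projected away at the end.
  have hbody : Feasible fun p : α × γ × σ => (p.2.1, step p.2.1 p.2.2 p.1) :=
    id.snd.fst.prodMk hstep
  have hin : Feasible fun c => (f c, (c, init c)) := hf.prodMk (id.prodMk hinit)
  have hinS := hin.polyBounded
  have hfS := hf.polyBounded
  have hiS := hinit.polyBounded
  obtain ⟨cb, pb, hcb⟩ := hbody
  obtain ⟨ci, pi, hci⟩ := hin
  let g : γ × σ → α → γ × σ := fun s a => (s.1, step s.1 s.2 a)
  have hg : ∀ (l : List α) c s, l.foldl g (c, s) = (c, l.foldl (step c) s) := by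
    intro l
    induction l with
    | nil => intro c s; rfl
    | cons a l ih => intro c s; exact ih _ _
  have hrun : ∀ a s, (cb.run (.pair (rep a) (rep s))).1 = rep (g s a) := fun a s => (hcb (a, s)).1
  let M : γ → ℕ := fun c => pb.eval (1 + repSize (f c) + (1 + repSize c + B c))
  obtain ⟨P, hP⟩ : PolyBounded fun c => pi.eval (repSize c) +
      (1 + repSize (f c, (c, init c)) + (1 + repSize c + repSize (init c))
        + repSize (f c) * (M c + 1)) + 1 :=
    ((PolyBounded.repSize.eval pi).add ((((PolyBounded.const 1).add hinS).add
      (((PolyBounded.const 1).add .repSize).add hiS)).add (hfS.mul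
      ((((((PolyBounded.const 1).add hfS).add (((PolyBounded.const 1).add .repSize).add hB)).eval
        pb)).add (.const 1))))).add (.const 1)
  refine snd (f := fun c => (c, (f c).foldl (step c) (init c)))
    ⟨.comp (.loop cb) ci, P, fun c => ?_⟩
  have h1 := (hci c).2
  refine ⟨?_, le_trans ?_ (hP c)⟩
  · simp only [Code.run, (hci c).1]
    exact (Code.runLoop_rep hrun _ _ _).trans (by rw [hg])
  · simp only [Code.run, (hci c).1]
    have h2 := Code.runLoop_time_le hrun (f c) (c, init c)
      (1 + repSize (f c, (c, init c)) + repSize (c, init c)) (M := M c) fun l' a hl => by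
        rw [hg]
        refine (hcb (a, (c, l'.foldl (step c) (init c)))).2.trans (pb.eval_mono_nat ?_)
        have h3 : repSize a ≤ repSize (f c) := repSize_le_of_mem (hl.subset (by simp))
        have h4 := hb c l' ((List.prefix_append l' [a]).trans hl)
        simp only [repSize_pair]; omega
    have h5 : (f c).length * (M c + 1) ≤ repSize (f c) * (M c + 1) :=
      Nat.mul_le_mul_right _ (length_lt_repSize _).le
    have h6 : repSize (c, init c) = 1 + repSize c + repSize (init c) := rfl
    change _ + (Code.runLoop cb.run (rep (f c)) (rep (c, init c),
      1 + repSize (f c, (c, init c)) + repSize (c, init c))).2 + 1 ≤ _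
    omega

instance {p : γ → Prop} : DataRep {c // p c} := ⟨fun c => rep c.1⟩

/-- Case distinction, where each branch need only be feasible where it is used. -/
lemma cases_bool {b : γ → Bool} {r : γ → β} (hb : Feasible b)
    (ht : Feasible fun c : {c // b c = true} => r c.1)
    (hf : Feasible fun c : {c // b c = false} => r c.1) : Feasible r := by
  obtain ⟨c₀, q₀, h₀⟩ := hb
  obtain ⟨c₁, q₁, h₁⟩ := ht
  obtain ⟨c₂, q₂, h₂⟩ := hf
  refine ⟨.cond c₀ c₁ c₂, q₀ + q₁ + q₂ + 1, fun a => ?_⟩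
  have k0 := (h₀ a).2
  have : (rep (b a)).toBool = b a := by cases b a <;> rfl
  simp only [Code.run, (h₀ a).1, this, Polynomial.eval_add, Polynomial.eval_one]
  split
  next h =>
    have k := h₁ ⟨a, h⟩
    refine ⟨k.1, ?_⟩
    have k2 : (c₁.run (rep a)).2 ≤ q₁.eval (repSize a) := k.2
    dsimp only; omega
  next h =>
    have k := h₂ ⟨a, by simpa using h⟩
    refine ⟨k.1, ?_⟩
    have k2 : (c₂.run (rep a)).2 ≤ q₂.eval (repSize a) := k.2
    dsimp only; omega

lemma restrict {f : γ → β} (hf : Feasible f) (p : γ → Prop) :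
    Feasible fun c : {c // p c} => f c.1 :=
  hf.of_rep_eq (fun c => c.1) (fun _ => rfl) fun _ => rfl

section lists

variable {f : γ → List α}

lemma nil : Feasible fun _ : γ => ([] : List α) := const []

lemma cons {a : γ → α} (ha : Feasible a) (hf : Feasible f) : Feasible fun c => a c :: f c :=
  (ha.prodMk hf).of_rep_eq (fun c => c) (fun _ => rfl) fun _ => rfl

lemma tail (hf : Feasible f) : Feasible fun c => (f c).tail :=
  comp (g := fun l : List α => l.tail)
    (of_op .snd (fun l => by cases l <;> rfl)
      (.mono .repSize fun l => repSize_sublist_le (List.tail_sublist l))) hf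

/-- Pattern matching on a list. The head is a total function only on nonempty lists, so that branch
is a program on a subtype, as `cases_bool` permits. -/
lemma listCases {r : γ → β} {n : γ → β} {s : α × List α × γ → β} (hf : Feasible f)
    (hn : Feasible n) (hs : Feasible s) (h₁ : ∀ c, f c = [] → r c = n c)
    (h₂ : ∀ c a l, f c = a :: l → r c = s (a, l, c)) : Feasible r := by
  have hb : Feasible fun c => !(f c).isEmpty :=
    comp (g := fun l : List α => !l.isEmpty) (of_op .isPair (fun l => by cases l <;> rfl)
      (.mono (.const 2) fun _ => repSize_bool_le _)) hf
  refine cases_bool hb ?_ ?_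
  · have hne : ∀ c : {c // (!(f c).isEmpty) = true}, f c.1 ≠ [] := fun c h => by
      have := c.2; simp [h] at this
    have hh : Feasible fun c : {c // (!(f c).isEmpty) = true} => (f c.1).head (hne c) :=
      comp (g := fun l : {l : List α // l ≠ []} => l.1.head l.2)
        (f := fun c : {c // (!(f c).isEmpty) = true} => ⟨f c.1, hne c⟩)
        (of_op .fst (fun l => by obtain ⟨_ | ⟨a, l⟩, h⟩ := l; exacts [absurd rfl h, rfl])
          (.mono .repSize fun l => repSize_le_of_mem (List.head_mem l.2)))
        (hf.of_rep_eq (fun c => c.1) (fun _ => rfl) fun _ => rfl)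
    refine (hs.comp (hh.prodMk ((hf.tail.restrict _).prodMk (id.restrict _)))).of_eq fun c => ?_
    exact h₂ _ _ _ (List.cons_head_tail (hne c)).symm
  · exact (hn.restrict _).of_eq fun c => h₁ _ (by have := c.2; simpa using this)

lemma headD (hf : Feasible f) {a : γ → α} (ha : Feasible a) : Feasible fun c => (f c).headD (a c) :=
  listCases (s := fun p => p.1) hf ha id.fst (fun c h => by simp [h]) fun c a l h => by simp [h]

lemma optionSome {a : γ → α} (ha : Feasible a) : Feasible fun c => some (a c) :=
  (ha.cons nil).of_rep_eq (fun c => c) (fun _ => rfl) fun _ => rfl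

lemma optionToList {o : γ → Option α} (ho : Feasible o) : Feasible fun c => (o c).toList :=
  ho.of_rep_eq (fun c => c) (fun _ => rfl) fun _ => rfl

lemma head? (hf : Feasible f) : Feasible fun c => (f c).head? :=
  listCases (n := fun _ => none) (s := fun p => some p.1) hf (const none) id.fst.optionSome
    (fun c h => by simp [h]) fun c a l h => by simp [h]

lemma optionElim {o : γ → Option α} {n : γ → β} {s : γ → α → β} (ho : Feasible o)
    (hn : Feasible n) (hs : Feasible fun p : γ × α => s p.1 p.2) :
    Feasible fun c => (o c).elim (n c) (s c) :=
  listCases (s := fun p : α × List α × γ => s p.2.2 p.1) ho.optionToList hn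
    (hs.comp (id.snd.snd.prodMk id.fst))
    (fun c h => by simp at h; simp [h]) fun c a l h => by
      cases hc : o c <;> simp [hc] at h
      simp [h.1]

/-- A fold that pushes its results in front delivers them backwards. Reversal, itself such a fold,
puts the results of `map`, `filter`, `zip` and similar loops in order. -/
lemma reverse (hf : Feasible f) : Feasible fun c => (f c).reverse := by
  have h : ∀ l k : List α, l.foldl (fun s a => a :: s) k = l.reverse ++ k := by
    intro l
    induction l with
    | nil => simp
    | cons a l ih => intro k; simp [ih]
  have hr : ∀ l : List α, repSize l.reverse = repSize l := by
    have ha : ∀ l k : List α, repSize (l ++ k) + 1 = repSize l + repSize k := by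
      intro l k
      induction l with
      | nil => exact Nat.add_comm _ _
      | cons a l ih =>
        have e : ∀ (a : α) l, repSize (a :: l) = 1 + repSize a + repSize l := fun _ _ => rfl
        rw [List.cons_append, e, e]; omega
    intro l
    induction l with
    | nil => rfl
    | cons a l ih =>
      have e : ∀ (a : α) l, repSize (a :: l) = 1 + repSize a + repSize l := fun _ _ => rfl
      have e0 : repSize ([] : List α) = 1 := rfl
      have := ha l.reverse [a]
      rw [List.reverse_cons, e]; rw [e, e0] at this; omega
  refine (foldl (init := fun _ => ([] : List α)) (step := fun _ s a => a :: s) (id.fst.cons id.snd.snd)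
    hf nil hf.polyBounded fun c l' hl => ?_).of_eq fun c => by simp [h]
  rw [h, List.append_nil, hr]
  exact repSize_sublist_le hl.sublist

lemma map {g : γ → α → β} (hg : Feasible fun p : γ × α => g p.1 p.2) (hf : Feasible f) :
    Feasible fun c => (f c).map (g c) := by
  have h : ∀ c (l : List α) k, l.foldl (fun s a => g c a :: s) k = (l.map (g c)).reverse ++ k := by
    intro c l
    induction l with
    | nil => simp
    | cons a l ih => intro k; simp [ih]
  obtain ⟨p, hp⟩ := hg.polyBounded
  have hB : PolyBounded fun c => repSize (f c) * (p.eval (1 + repSize c + repSize (f c)) + 1) + 1 :=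
    (hf.polyBounded.mul (((((PolyBounded.const 1).add .repSize).add hf.polyBounded).eval p).add
      (.const 1))).add (.const 1)
  refine (foldl (init := fun _ => ([] : List β)) (step := fun c s a => g c a :: s)
    ((hg.comp (id.snd.fst.prodMk id.fst)).cons id.snd.snd) hf nil hB fun c l' hl => ?_).reverse.of_eq
      fun c => by simp [h]
  rw [h, List.append_nil]
  refine (repSize_list_le (M := p.eval (1 + repSize c + repSize (f c))) fun x hx => ?_).trans ?_
  · obtain ⟨a, ha, rfl⟩ : ∃ a ∈ l', g c a = x := by simpa using hx
    refine (hp (c, a)).trans (p.eval_mono_nat ?_)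
    rw [repSize_pair]
    have := repSize_le_of_mem (hl.subset ha)
    dsimp only; omega
  · have h1 : l'.length ≤ repSize (f c) := hl.length_le.trans (length_lt_repSize _).le
    simp only [List.length_reverse, List.length_map]
    gcongr

lemma filter {q : γ → α → Bool} (hq : Feasible fun p : γ × α => q p.1 p.2) (hf : Feasible f) :
    Feasible fun c => (f c).filter (q c) := by
  have h : ∀ c (l : List α) k, l.foldl (fun s a => if q c a = true then a :: s else s) k =
      (l.filter (q c)).reverse ++ k := by
    intro c l
    induction l with
    | nil => simp
    | cons a l ih => intro k; by_cases hc : q c a <;> simp [ih, hc]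
  refine (foldl (init := fun _ => ([] : List α))
    (step := fun c s a => if q c a = true then a :: s else s)
    (ite_bool (hq.comp (id.snd.fst.prodMk id.fst)) (id.fst.cons id.snd.snd) id.snd.snd) hf nil
    (B := fun c => repSize (f c) * (repSize (f c) + 1) + 1)
    ((hf.polyBounded.mul (hf.polyBounded.add (.const 1))).add (.const 1))
    fun c l' hl => ?_).reverse.of_eq fun c => by simp [h]
  rw [h, List.append_nil]
  refine (repSize_list_le (M := repSize (f c)) fun x hx => ?_).trans ?_
  · exact repSize_le_of_mem (hl.subset (List.mem_filter.1 (List.mem_reverse.1 hx)).1)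
  · have h1 : (l'.filter (q c)).length ≤ repSize (f c) :=
      (List.length_filter_le _ _).trans (hl.length_le.trans (length_lt_repSize _).le)
    simp only [List.length_reverse]
    gcongr

lemma find? {q : γ → α → Bool} (hq : Feasible fun p : γ × α => q p.1 p.2) (hf : Feasible f) :
    Feasible fun c => (f c).find? (q c) :=
  (filter hq hf).head?.of_eq fun c => by simp

lemma zip {g : γ → List β} (hf : Feasible f) (hg : Feasible g) :
    Feasible fun c => (f c).zip (g c) := by
  let step : List β × List (α × β) → α → List β × List (α × β) := fun s a =>
    (s.1.tail, s.1.head?.elim s.2 fun b => (a, b) :: s.2)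
  have h : ∀ (l : List α) m k, l.foldl step (m, k) = (m.drop l.length, (l.zip m).reverse ++ k) := by
    intro l
    induction l with
    | nil => simp
    | cons a l ih =>
      intro m k
      cases m with
      | nil => simp [step, ih]
      | cons b m => simp [step, ih]
  have hstep : Feasible fun p : α × γ × (List β × List (α × β)) => step p.2.2 p.1 :=
    id.snd.snd.fst.tail.prodMk (optionElim id.snd.snd.fst.head? id.snd.snd.snd
      ((id.fst.fst.prodMk id.snd).cons id.fst.snd.snd.snd))
  have hB : PolyBounded fun c => 1 + repSize (g c) +
      (repSize (f c) * ((1 + repSize (f c) + repSize (g c)) + 1) + 1) :=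
    ((PolyBounded.const 1).add hg.polyBounded).add ((hf.polyBounded.mul
      ((((PolyBounded.const 1).add hf.polyBounded).add hg.polyBounded).add (.const 1))).add
        (.const 1))
  refine (foldl (init := fun c => (g c, ([] : List (α × β)))) (step := fun _ => step) hstep hf
    (hg.prodMk nil) hB fun c l' hl => ?_).snd.reverse.of_eq fun c => by simp [h]
  rw [h, repSize_pair, List.append_nil]
  refine Nat.add_le_add (Nat.add_le_add le_rfl (repSize_sublist_le (List.drop_sublist _ _))) ?_
  refine (repSize_list_le (M := 1 + repSize (f c) + repSize (g c)) fun x hx => ?_).trans ?_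
  · have := List.of_mem_zip (List.mem_reverse.1 hx)
    have h1 := repSize_le_of_mem (hl.subset this.1)
    have h2 := repSize_le_of_mem this.2
    rw [repSize_pair]; omega
  · have h1 : (l'.zip (g c)).length ≤ repSize (f c) := by
      rw [List.length_zip]
      exact (min_le_left _ _).trans (hl.length_le.trans (length_lt_repSize _).le)
    simp only [List.length_reverse]
    gcongr

lemma length (hf : Feasible f) : Feasible fun c => (f c).length := by
  have h : ∀ (l : List α) k, l.foldl (fun s _ => s + 1) k = k + l.length := by
    intro l
    induction l with
    | nil => simp
    | cons a l ih => intro k; simp [ih]; omega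
  refine (foldl (init := fun _ => 0) (step := fun _ s _ => s + 1) (id.snd.snd.add (const 1)) hf
    (const 0) (hf.polyBounded.add (.const 1)) fun c l' hl => ?_).of_eq fun c => by simp [h]
  rw [h, repSize_nat]
  have := Nat.size_le_self (0 + l'.length)
  have := hl.length_le.trans (length_lt_repSize _).le
  omega

lemma sum {f : γ → List ℕ} (hf : Feasible f) : Feasible fun c => (f c).sum := by
  have h : ∀ (l : List ℕ) k, l.foldl (fun s a => s + a) k = k + l.sum := by
    intro l
    induction l with
    | nil => simp
    | cons a l ih => intro k; simp [ih]; omega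
  have hs : ∀ l : List ℕ, l.sum.size + 1 ≤ repSize l := by
    intro l
    induction l with
    | nil => simp [repSize, rep, Data.ofList, Data.size]
    | cons a l ih =>
      have e : repSize (a :: l) = 1 + (1 + a.size) + repSize l := rfl
      have h1 : (a + l.sum).size ≤ a.size + l.sum.size + 1 := by
        rw [Nat.size_le]
        have h1 := Nat.lt_size_self a
        have h2 := Nat.lt_size_self l.sum
        have h3 : 2 ^ a.size ≤ 2 ^ (a.size + l.sum.size) :=
          Nat.pow_le_pow_right (by norm_num) (by omega)
        have h4 : 2 ^ l.sum.size ≤ 2 ^ (a.size + l.sum.size) :=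
          Nat.pow_le_pow_right (by norm_num) (by omega)
        rw [pow_succ]; omega
      rw [List.sum_cons]; omega
  refine (foldl (init := fun _ => 0) (step := fun _ s a => s + a) (id.snd.snd.add id.fst) hf
    (const 0) (hf.polyBounded.add (.const 1)) fun c l' hl => ?_).of_eq fun c => by simp [h]
  rw [h, repSize_nat, zero_add]
  have := hs l'
  have := repSize_sublist_le hl.sublist
  omega

/-- One `tail` per entry of the second list. The distinguisher finds its next query this way, the
second list being the answers received so far. -/
lemma drop_length (hf : Feasible f) {g : γ → List β} (hg : Feasible g) :
    Feasible fun c => (f c).drop (g c).length := by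
  have h : ∀ (l : List β) (k : List α), l.foldl (fun s _ => s.tail) k = k.drop l.length := by
    intro l
    induction l with
    | nil => simp
    | cons a l ih => intro k; simp [ih, List.drop_tail]
  refine (foldl (init := f) (step := fun _ s _ => s.tail) id.snd.snd.tail hg hf hf.polyBounded
    fun c l' _ => ?_).of_eq fun c => by simp [h]
  rw [h]
  exact repSize_sublist_le (List.drop_sublist _ _)

end lists

section unary

lemma repSize_unary (n : Unary) : repSize n = 2 * n.val + 1 := Data.size_unary _

instance : DataRep Unit := ⟨fun _ => .num 0⟩

lemma unaryToList {f : γ → Unary} (hf : Feasible f) :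
    Feasible fun c => List.replicate (f c).val () :=
  hf.of_rep_eq (fun c => c) (fun _ => rfl) fun c => by simp [rep, Data.unary]

lemma unaryOfList {f : γ → List α} (hf : Feasible f) : Feasible fun c => (⟨(f c).length⟩ : Unary) :=
  (map (g := fun _ _ => ()) (const ()) hf).of_rep_eq (fun c => c) (fun _ => rfl) fun c => by
    simp [rep, Data.unary, List.map_const']

lemma unaryVal {f : γ → Unary} (hf : Feasible f) : Feasible fun c => (f c).val :=
  hf.unaryToList.length.of_eq fun c => by simp

/-- Bounded iteration. -/
lemma iterate {n : γ → Unary} {init : γ → σ} {step : γ → σ → σ}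
    (hstep : Feasible fun p : γ × σ => step p.1 p.2) (hn : Feasible n) (hinit : Feasible init)
    {B : γ → ℕ} (hB : PolyBounded B)
    (hb : ∀ c, ∀ k ≤ (n c).val, repSize ((step c)^[k] (init c)) ≤ B c) :
    Feasible fun c => (step c)^[(n c).val] (init c) := by
  have h : ∀ c (l : List Unit) s, l.foldl (fun s _ => step c s) s = (step c)^[l.length] s := by
    intro c l
    induction l with
    | nil => simp
    | cons a l ih => intro s; simp [ih]
  refine (foldl (init := init) (step := fun c s _ => step c s) (hstep.comp id.snd)
    hn.unaryToList hinit hB fun c l' hl => ?_).of_eq fun c => by simp [h]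
  rw [h]
  exact hb c _ (by simpa using hl.length_le)

lemma unary_add {f g : γ → Unary} (hf : Feasible f) (hg : Feasible g) :
    Feasible fun c => (⟨(f c).val + (g c).val⟩ : Unary) := by
  have h : ∀ (k : ℕ) (l : List Unit), (fun l => () :: l)^[k] l = List.replicate k () ++ l := by
    intro k
    induction k with
    | zero => simp
    | succ k ih => intro l; rw [Function.iterate_succ_apply', ih, List.replicate_succ]; rfl
  have hr : ∀ l : List Unit, repSize l = 2 * l.length + 1 := by
    intro l
    induction l with
    | nil => rfl
    | cons a l ih =>
      have e : repSize (a :: l) = 1 + 1 + repSize l := rfl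
      rw [e, ih, List.length_cons]; omega
  refine (iterate (n := f) (init := fun c => List.replicate (g c).val ())
    (step := fun _ l => () :: l) ((const ()).cons id.snd) hf hg.unaryToList
    (hf.polyBounded.add hg.polyBounded) fun c k hk => ?_).unaryOfList.of_eq fun c => by simp [h]
  rw [h, hr, repSize_unary, repSize_unary]
  simp; omega

lemma unary_mul {f g : γ → Unary} (hf : Feasible f) (hg : Feasible g) :
    Feasible fun c => (⟨(f c).val * (g c).val⟩ : Unary) := by
  have h : ∀ (m k j : ℕ), (fun u : Unary => (⟨m + u.val⟩ : Unary))^[k] ⟨j⟩ = ⟨k * m + j⟩ := by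
    intro m k
    induction k with
    | zero => simp
    | succ k ih => intro j; rw [Function.iterate_succ_apply', ih]; simp; ring
  refine (iterate (n := f) (init := fun _ => (⟨0⟩ : Unary))
    (step := fun c u => ⟨(g c).val + u.val⟩) (unary_add (hg.comp id.fst) id.snd) hf (const _)
    (((hf.polyBounded.mul hg.polyBounded).add (.const 1))) fun c k hk => ?_).of_eq fun c => by simp [h]
  rw [h, repSize_unary, repSize_unary, repSize_unary]
  have := Nat.mul_le_mul_right (g c).val hk
  nlinarith

/-- Numbers of rounds and of coins are polynomials in the security parameter; having them in unary
allows loops of that length. -/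
lemma unary_eval (p : Polynomial ℕ) {f : γ → Unary} (hf : Feasible f) :
    Feasible fun c => (⟨p.eval (f c).val⟩ : Unary) := by
  induction p using Polynomial.induction_on with
  | C a => simpa using const (⟨a⟩ : Unary)
  | add p q hp hq => simpa using hp.unary_add hq
  | monomial n a ih =>
    refine (ih.unary_mul hf).of_eq fun c => ?_
    simp [pow_succ, mul_assoc]

lemma two_pow {f : γ → Unary} (hf : Feasible f) : Feasible fun c => 2 ^ (f c).val := by
  have h : ∀ k j : ℕ, (fun m => m * 2)^[k] j = 2 ^ k * j := by
    intro k
    induction k with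
    | zero => simp
    | succ k ih => intro j; rw [Function.iterate_succ_apply', ih]; ring
  refine (iterate (n := f) (init := fun _ => 1) (step := fun _ m => m * 2) (id.snd.mul (const 2)) hf
    (const 1) (hf.polyBounded.add (.const 1)) fun c k hk => ?_).of_eq fun c => by simp [h]
  rw [h, mul_one, repSize_nat, Nat.size_pow, repSize_unary]
  omega

end unary

section data

variable {f : γ → Data}

/-- A datum read as a list may end in any number, while lists are represented with final `0`, so
`foldl` does not apply to it. Instead `clock` supplies at least as many rounds as there are entries,
and each round peels off one pair. -/
lemma dataToList (hf : Feasible f) : Feasible fun c => (f c).toList := by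
  let isPair : Data → Bool := fun x => !x.toList.isEmpty
  have hisPair : Feasible isPair := of_op .isPair (fun x => by cases x <;> rfl)
    (.mono (.const 2) fun _ => repSize_bool_le _)
  let step : Data × List Data → Data × List Data := fun s =>
    if isPair s.1 = true then (s.1.snd, s.1.fst :: s.2) else s
  have hstep : Feasible step :=
    ite_bool (hisPair.comp id.fst) (id.fst.dataSnd.prodMk (id.fst.dataFst.cons id.snd)) id
  have hclock : Feasible fun x : Data => (⟨x.size⟩ : Unary) := of_op .clock (fun _ => rfl)
    (.mono ((PolyBounded.const 2).mul (PolyBounded.repSize.add (.const 1))) fun x => by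
      rw [repSize_unary]; change _ ≤ 2 * (x.size + 1); dsimp only; omega)
  -- The terminating number is a fixed point of `step`, so surplus rounds do no harm.
  have hnum : ∀ k n m, step^[k] (.num n, m) = (.num n, m) := fun k n m =>
    Function.iterate_fixed rfl k
  have hend : ∀ (x : Data) k m, x.length ≤ k → (step^[k] (x, m)).2 = x.toList.reverse ++ m := by
    intro x
    induction x with
    | num n => intro k m _; rw [hnum]; rfl
    | pair a b _ ih =>
      intro k m hk
      obtain ⟨k, rfl⟩ : ∃ j, k = j + 1 := ⟨k - 1, by simp only [Data.length] at hk; omega⟩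
      rw [Function.iterate_succ_apply]
      change (step^[k] (b, a :: m)).2 = _
      rw [ih _ _ (by simpa [Data.length] using hk)]
      simp [Data.toList]
  have hsize : ∀ k s, repSize (step^[k] s) ≤ repSize s := by
    intro k
    induction k with
    | zero => intro s; rfl
    | succ k ih =>
      intro s
      rw [Function.iterate_succ_apply]
      refine (ih _).trans ?_
      obtain ⟨x, m⟩ := s
      cases x with
      | num n => rfl
      | pair a b =>
        change 1 + b.size + (1 + a.size + repSize m) ≤ 1 + (1 + a.size + b.size) + repSize m
        omega
  refine comp (g := Data.toList) ((iterate (n := fun x : Data => ⟨x.size⟩)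
    (init := fun x => (x, ([] : List Data))) (step := fun _ => step) (hstep.comp id.snd) hclock
    (id.prodMk nil) (PolyBounded.add (.add (.const 1) .repSize) (.const 1)) fun x k _ =>
      hsize k _).snd.reverse.of_eq fun x => ?_) hf
  rw [hend x _ _ x.length_lt_size.le]; simp

lemma dataLength (hf : Feasible f) : Feasible fun c => (⟨(f c).length⟩ : Unary) :=
  hf.dataToList.unaryOfList.of_eq fun c => by rw [Data.length_eq]

end data

end Feasible
end

/-! ## A deterministic simulation of the two worlds

Since the answers of the oracles do not depend on any randomness, the interaction can be simulated
without keys; the contents of the databases are kept as association lists. -/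

/-- The cards `lo + 1, …, hi` belong to household `id`. -/
structure SimCards where
  lo : ℕ
  hi : ℕ
  id : ℕ

structure SimCell where
  id : ℕ
  bal : ℕ
  ctr : ℕ

/-- A successful transaction. -/
structure SimTrans where
  period : ℕ
  price : ℕ
  id : ℕ
  ctr : ℕ

/-- All lists have the most recent entry first. -/
structure SimWorld where
  nextId : ℕ
  counter : ℕ
  cards : List SimCards
  cells : List SimCell
  log : List SimTrans

def SimCards.toProd (c : SimCards) : ℕ × ℕ × ℕ := (c.lo, c.hi, c.id)
def SimCell.toProd (m : SimCell) : ℕ × ℕ × ℕ := (m.id, m.bal, m.ctr)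
def SimTrans.toProd (t : SimTrans) : ℕ × ℕ × ℕ × ℕ := (t.period, t.price, t.id, t.ctr)

instance : DataRep SimCards := ⟨fun c => rep c.toProd⟩
instance : DataRep SimCell := ⟨fun m => rep m.toProd⟩
instance : DataRep SimTrans := ⟨fun t => rep t.toProd⟩

def SimWorld.toProd (w : SimWorld) : ℕ × ℕ × List SimCards × List SimCell × List SimTrans :=
  (w.nextId, w.counter, w.cards, w.cells, w.log)

instance : DataRep SimWorld := ⟨fun w => rep w.toProd⟩

namespace SimWorld

def empty : SimWorld := ⟨0, 0, [], [], []⟩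

def lookupCard (w : SimWorld) (tid : ℕ) : Option SimCards :=
  w.cards.find? fun c => decide (c.lo < tid ∧ tid ≤ c.hi)

def lookupCell (w : SimWorld) (id : ℕ) : Option SimCell :=
  w.cells.find? fun m => decide (m.id = id)

def register (N : ℕ) (w : SimWorld) (bud tnb : ℕ) : Data × SimWorld :=
  if w.nextId < N then
    (.ofList ((List.range tnb).map fun i => .num (w.counter + i + 1)),
      ⟨w.nextId + 1, w.counter + tnb, ⟨w.counter, w.counter + tnb, w.nextId⟩ :: w.cards,
        ⟨w.nextId, bud, 0⟩ :: w.cells, w.log⟩)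
  else (.num 0, w)

def charge (w : SimWorld) (ε price id : ℕ) (m : SimCell) : SimWorld :=
  if price ≤ m.bal then
    ⟨w.nextId, w.counter, w.cards, ⟨id, m.bal - price, m.ctr + 1⟩ :: w.cells,
      ⟨ε, price, id, m.ctr + 1⟩ :: w.log⟩
  else w

def spend (w : SimWorld) (ε tid price : ℕ) : SimWorld :=
  (w.lookupCard tid).elim w fun c => (w.lookupCell c.id).elim w fun m => w.charge ε price c.id m

/-- The transactions of one period, in order of arrival. -/
def transactions (w : SimWorld) (ε : ℕ) : List SimTrans :=
  (w.log.filter fun t => decide (t.period = ε)).reverse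

end SimWorld

/-- Selects a component by a truth value, `false` being the first. -/
def Prod.sel {α : Type} (p : α × α) (b : Bool) : α := if b = true then p.2 else p.1

def Prod.setSel {α : Type} (p : α × α) (b : Bool) (a : α) : α × α :=
  if b = true then (p.1, a) else (a, p.2)

lemma Prod.sel_setSel {α : Type} (p : α × α) (b b' : Bool) (a : α) :
    (p.setSel b a).sel b' = if b' = b then a else p.sel b' := by
  cases b <;> cases b' <;> rfl

/-- One oracle query in the simulation. -/
def simStep (N : ℕ) (ws : SimWorld × SimWorld) (x : Data) : Data × SimWorld × SimWorld :=
  if x.fst.toNat = 0 then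
    (((ws.sel x.snd.fst.toBool).register N x.snd.snd.fst.toNat x.snd.snd.snd.length).1,
      ws.setSel x.snd.fst.toBool
        ((ws.sel x.snd.fst.toBool).register N x.snd.snd.fst.toNat x.snd.snd.snd.length).2)
  else if x.fst.toNat = 1 then
    (.num 0, ws.setSel x.snd.fst.toBool ((ws.sel x.snd.fst.toBool).spend x.snd.snd.fst.toNat
      x.snd.snd.snd.fst.toNat x.snd.snd.snd.snd.toNat))
  else (.num 0, ws)

/-- One round of the simulated interaction; the state consists of the answers and the worlds. -/
def simRound (A : OracleAlg) (N l ρ : ℕ) (input : Data) (s : Data × SimWorld × SimWorld) :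
    Data × SimWorld × SimWorld :=
  (.pair (simStep N s.2 (A.query (view l ρ input s.1))).1 s.1,
    (simStep N s.2 (A.query (view l ρ input s.1))).2)

def simRun (A : OracleAlg) (N l ρ : ℕ) (input : Data) : Data × SimWorld × SimWorld :=
  (simRound A N l ρ input)^[A.rounds.eval l] (.num 0, (.empty, .empty))

/-! ### Sizes -/

/-- Here `R` is the total number of rounds, `B` bounds the size of a query, and `k` counts the
rounds so far. Quantities that the simulation increments are bounded by value, those chosen by the
adversary in binary only by bit length. A registration adds at most `B` cards because their number
is written in unary. -/
structure SimWorld.Bounded (R B k : ℕ) (w : SimWorld) : Prop where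
  nextId : w.nextId ≤ k
  counter : w.counter ≤ k * B
  cards_length : w.cards.length ≤ k
  cards : ∀ c ∈ w.cards, c.lo ≤ R * B ∧ c.hi ≤ R * B ∧ c.id ≤ R
  cells_length : w.cells.length ≤ k
  cells : ∀ m ∈ w.cells, m.id ≤ R ∧ m.bal.size ≤ B ∧ m.ctr ≤ k
  log_length : w.log.length ≤ k
  log : ∀ t ∈ w.log, t.period.size ≤ B ∧ t.price.size ≤ B ∧ t.id ≤ R ∧ t.ctr ≤ R

namespace SimWorld

lemma bounded_empty (R B : ℕ) : empty.Bounded R B 0 := by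
  constructor <;> simp [empty]

variable {R B k : ℕ} {w : SimWorld}

lemma Bounded.succ (h : w.Bounded R B k) : w.Bounded R B (k + 1) where
  nextId := h.nextId.trans k.le_succ
  counter := h.counter.trans (Nat.mul_le_mul_right _ k.le_succ)
  cards_length := h.cards_length.trans k.le_succ
  cards := h.cards
  cells_length := h.cells_length.trans k.le_succ
  cells m hm := ⟨(h.cells m hm).1, (h.cells m hm).2.1, (h.cells m hm).2.2.trans k.le_succ⟩
  log_length := h.log_length.trans k.le_succ
  log := h.log

lemma Bounded.register (h : w.Bounded R B k) (hk : k + 1 ≤ R) (N : ℕ) {bud tnb : ℕ}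
    (hbud : bud.size ≤ B) (htnb : tnb ≤ B) : (w.register N bud tnb).2.Bounded R B (k + 1) := by
  unfold SimWorld.register
  split
  · have h0 := h.nextId
    have h1 := h.counter
    have h2 : (k + 1) * B ≤ R * B := Nat.mul_le_mul_right _ hk
    rw [Nat.succ_mul] at h2
    refine ⟨by simpa using h0, by dsimp only; rw [Nat.succ_mul]; omega,
      by simpa using h.cards_length, ?_, by simpa using h.cells_length, ?_,
      h.log_length.trans k.le_succ, h.log⟩
    · intro c hc
      rcases List.mem_cons.1 hc with rfl | hc
      · dsimp only; omega
      · exact h.cards c hc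
    · intro m hm
      rcases List.mem_cons.1 hm with rfl | hm
      · exact ⟨by dsimp only; omega, hbud, Nat.zero_le _⟩
      · exact h.succ.cells m hm
  · exact h.succ

lemma size_register_le (h : w.Bounded R B k) (hk : k + 1 ≤ R) (N : ℕ) {bud tnb : ℕ}
    (htnb : tnb ≤ B) : (w.register N bud tnb).1.size ≤ B * (R * B + 2) + 1 := by
  unfold SimWorld.register
  split
  · refine (Data.size_ofList_le (M := R * B + 1) fun x hx => ?_).trans ?_
    · obtain ⟨i, hi, rfl⟩ := List.mem_map.1 hx
      have h1 := h.counter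
      have h2 : (k + 1) * B ≤ R * B := Nat.mul_le_mul_right _ hk
      rw [Nat.succ_mul] at h2
      have h3 := List.mem_range.1 hi
      have h4 := Nat.size_le_self (w.counter + i + 1)
      simp only [Data.size]; omega
    · simp only [List.length_map, List.length_range]
      gcongr
  · simp [Data.size]

lemma Bounded.spend (h : w.Bounded R B k) (hk : k + 1 ≤ R) {ε tid price : ℕ}
    (hε : ε.size ≤ B) (hprice : price.size ≤ B) : (w.spend ε tid price).Bounded R B (k + 1) := by
  unfold SimWorld.spend
  cases hc : w.lookupCard tid with
  | none => exact h.succ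
  | some c =>
    cases hm : w.lookupCell c.id with
    | none => simpa [hm] using h.succ
    | some m =>
      have h1 := h.cards c (List.mem_of_find?_eq_some hc)
      have h2 := h.cells m (List.mem_of_find?_eq_some hm)
      have h3 := Nat.size_le_size (Nat.sub_le m.bal price)
      simp only [Option.elim_some, hm, charge]
      split
      · refine ⟨h.succ.nextId, h.succ.counter, h.succ.cards_length, h.cards,
          by simpa using h.cells_length, ?_, by simpa using h.log_length, ?_⟩
        · intro m' hm'
          rcases List.mem_cons.1 hm' with rfl | hm'
          · exact ⟨h1.2.2, by dsimp only; omega, by dsimp only; omega⟩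
          · exact h.succ.cells m' hm'
        · intro t ht
          rcases List.mem_cons.1 ht with rfl | ht
          · exact ⟨hε, hprice, h1.2.2, by dsimp only; omega⟩
          · exact h.log t ht
      · exact h.succ

/-- A bound for the size of a world. -/
def sizeBound (R B : ℕ) : ℕ := 10 * (R + 1) * (R * B + R + B + 10)

lemma Bounded.repSize_le (h : w.Bounded R B k) (hk : k ≤ R) : repSize w ≤ sizeBound R B := by
  have e : repSize w = 1 + repSize w.nextId + (1 + repSize w.counter + (1 + repSize w.cards +
    (1 + repSize w.cells + repSize w.log))) := rfl
  have hkB : k * B ≤ R * B := Nat.mul_le_mul_right _ hk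
  have h1 : repSize w.nextId ≤ 1 + R := by
    have := Nat.size_le_self w.nextId
    have := h.nextId
    rw [Feasible.repSize_nat]; omega
  have h2 : repSize w.counter ≤ 1 + R * B := by
    have := Nat.size_le_self w.counter
    have := h.counter
    rw [Feasible.repSize_nat]; omega
  have h3 : repSize w.cards ≤ R * (2 * (R * B) + R + 5 + 1) + 1 := by
    refine (repSize_list_le (M := 2 * (R * B) + R + 5) fun c hc => ?_).trans ?_
    · obtain ⟨h1, h2, h3⟩ := h.cards c hc
      have e : repSize c = 1 + (1 + c.lo.size) + (1 + (1 + c.hi.size) + (1 + c.id.size)) := rfl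
      have := Nat.size_le_self c.lo
      have := Nat.size_le_self c.hi
      have := Nat.size_le_self c.id
      omega
    · have := h.cards_length.trans hk
      gcongr
  have h4 : repSize w.cells ≤ R * (2 * R + B + 5 + 1) + 1 := by
    refine (repSize_list_le (M := 2 * R + B + 5) fun c hc => ?_).trans ?_
    · obtain ⟨h1, h2, h3⟩ := h.cells c hc
      have e : repSize c = 1 + (1 + c.id.size) + (1 + (1 + c.bal.size) + (1 + c.ctr.size)) := rfl
      have := Nat.size_le_self c.id
      have := Nat.size_le_self c.ctr
      omega
    · have := h.cells_length.trans hk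
      gcongr
  have h5 : repSize w.log ≤ R * (2 * R + 2 * B + 7 + 1) + 1 := by
    refine (repSize_list_le (M := 2 * R + 2 * B + 7) fun c hc => ?_).trans ?_
    · obtain ⟨h1, h2, h3, h4⟩ := h.log c hc
      have e : repSize c = 1 + (1 + c.period.size) + (1 + (1 + c.price.size) +
        (1 + (1 + c.id.size) + (1 + c.ctr.size))) := rfl
      have := Nat.size_le_self c.id
      have := Nat.size_le_self c.ctr
      omega
    · have := h.log_length.trans hk
      gcongr
  unfold sizeBound
  set X := R * B
  have h6 : 0 ≤ R * X := Nat.zero_le _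
  have h7 : 0 ≤ R * R := Nat.zero_le _
  have h8 : 0 ≤ R * B := Nat.zero_le _
  nlinarith

end SimWorld

section

variable {R B k N : ℕ} {ws : SimWorld × SimWorld} {x : Data}

lemma simStep_bounded (h : ∀ b, (ws.sel b).Bounded R B k) (hk : k + 1 ≤ R) (hx : x.size ≤ B) (b) :
    ((simStep N ws x).2.sel b).Bounded R B (k + 1) := by
  have s0 := x.size_snd_le
  have s1 := x.snd.size_snd_le
  have s2 := x.snd.snd.size_fst_le
  have s3 := x.snd.snd.size_snd_le
  have s4 := x.snd.snd.snd.size_snd_le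
  have s5 := x.snd.snd.snd.length_lt_size
  have s6 := x.snd.snd.fst.size_toNat_le
  have s7 := x.snd.snd.snd.snd.size_toNat_le
  unfold simStep
  split
  · rw [Prod.sel_setSel]
    split
    · exact (h _).register hk _ (by omega) (by omega)
    · exact (h _).succ
  · split
    · rw [Prod.sel_setSel]
      split
      · exact (h _).spend hk (by omega) (by omega)
      · exact (h _).succ
    · exact (h _).succ

lemma size_simStep_le (h : ∀ b, (ws.sel b).Bounded R B k) (hk : k + 1 ≤ R) (hx : x.size ≤ B) :
    (simStep N ws x).1.size ≤ B * (R * B + 2) + 1 := by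
  have s0 := x.size_snd_le
  have s1 := x.snd.size_snd_le
  have s3 := x.snd.snd.size_snd_le
  have s5 := x.snd.snd.snd.length_lt_size
  unfold simStep
  split
  · exact SimWorld.size_register_le (h _) hk _ (by omega)
  · split <;> simp [Data.size]

/-- The query bound depends on the security parameter alone, however long the list of answers is.
Therefore the growth of the answers does not feed back into the worlds, and both grow at most
linearly in `k` with coefficients fixed by `l`. -/
lemma simRound_iterate_bounded (A : OracleAlg) (N l ρ : ℕ) (input : Data) :
    ∀ k ≤ A.rounds.eval l,
      (∀ b, (((simRound A N l ρ input)^[k] (.num 0, (.empty, .empty))).2.sel b).Bounded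
        (A.rounds.eval l) (A.bound.eval l) k) ∧
      ((simRound A N l ρ input)^[k] (.num 0, (.empty, .empty))).1.size ≤
        1 + k * (A.bound.eval l * (A.rounds.eval l * A.bound.eval l + 2) + 2) := by
  intro k
  induction k with
  | zero =>
    intro _
    refine ⟨fun b => ?_, by simp [Data.size]⟩
    cases b <;> exact SimWorld.bounded_empty _ _
  | succ k ih =>
    intro hk
    obtain ⟨h1, h2⟩ := ih (by omega)
    rw [Function.iterate_succ_apply']
    set s := (simRound A N l ρ input)^[k] (.num 0, (.empty, .empty))
    have hq := A.query_size l ρ input s.1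
    refine ⟨fun b => simStep_bounded h1 hk hq b, ?_⟩
    have h3 := size_simStep_le (N := N) h1 hk hq
    simp only [simRound, Data.size]
    rw [Nat.succ_mul]; omega

lemma simRun_bounded (A : OracleAlg) (N l ρ : ℕ) (input : Data) (b : Bool) :
    ((simRun A N l ρ input).2.sel b).Bounded (A.rounds.eval l) (A.bound.eval l)
      (A.rounds.eval l) :=
  (simRound_iterate_bounded A N l ρ input _ le_rfl).1 b

end

/-! ### Feasibility -/

namespace Feasible

variable {γ : Type} [DataRep γ]

lemma range {f : γ → Unary} (hf : Feasible f) : Feasible fun c => List.range (f c).val := by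
  have h : ∀ k : ℕ, (fun s : ℕ × List ℕ => (s.1 + 1, s.1 :: s.2))^[k] (0, []) =
      (k, (List.range k).reverse) := by
    intro k
    induction k with
    | zero => rfl
    | succ k ih => rw [Function.iterate_succ_apply', ih]; simp [List.range_succ]
  have hv : PolyBounded fun c => (f c).val :=
    hf.polyBounded.mono fun c => by rw [repSize_unary]; omega
  refine (iterate (n := f) (init := fun _ => (0, ([] : List ℕ)))
    (step := fun _ s => (s.1 + 1, s.1 :: s.2))
    ((id.snd.fst.add (const 1)).prodMk (id.snd.fst.cons id.snd.snd)) hf (const _)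
    (B := fun c => 1 + (1 + (f c).val) + ((f c).val * (1 + (f c).val + 1) + 1))
    (((PolyBounded.const 1).add ((PolyBounded.const 1).add hv)).add ((hv.mul
      (((PolyBounded.const 1).add hv).add (.const 1))).add (.const 1)))
    fun c k hk => ?_).snd.reverse.of_eq fun c => by simp [h]
  rw [h, repSize_pair]
  refine Nat.add_le_add (Nat.add_le_add le_rfl ?_) ?_
  · have := k.size_le_self
    rw [repSize_nat]; dsimp only; omega
  · refine (repSize_list_le (M := 1 + (f c).val) fun i hi => ?_).trans ?_
    · have h1 : i < k := by simpa using hi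
      have := i.size_le_self
      rw [repSize_nat]; omega
    · simp only [List.length_reverse, List.length_range]
      gcongr

lemma simCardsProd {f : γ → SimCards} (hf : Feasible f) : Feasible fun c => (f c).toProd :=
  hf.of_rep_eq (fun c => c) (fun _ => rfl) fun _ => rfl

lemma simCellProd {f : γ → SimCell} (hf : Feasible f) : Feasible fun c => (f c).toProd :=
  hf.of_rep_eq (fun c => c) (fun _ => rfl) fun _ => rfl

lemma simTransProd {f : γ → SimTrans} (hf : Feasible f) : Feasible fun c => (f c).toProd :=
  hf.of_rep_eq (fun c => c) (fun _ => rfl) fun _ => rfl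

lemma simWorldProd {f : γ → SimWorld} (hf : Feasible f) : Feasible fun c => (f c).toProd :=
  hf.of_rep_eq (fun c => c) (fun _ => rfl) fun _ => rfl

lemma simCardsMk {lo hi id : γ → ℕ} (h₁ : Feasible lo) (h₂ : Feasible hi) (h₃ : Feasible id) :
    Feasible fun c => SimCards.mk (lo c) (hi c) (id c) :=
  (h₁.prodMk (h₂.prodMk h₃)).of_rep_eq (fun c => c) (fun _ => rfl) fun _ => rfl

lemma simCellMk {id bal ctr : γ → ℕ} (h₁ : Feasible id) (h₂ : Feasible bal) (h₃ : Feasible ctr) :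
    Feasible fun c => SimCell.mk (id c) (bal c) (ctr c) :=
  (h₁.prodMk (h₂.prodMk h₃)).of_rep_eq (fun c => c) (fun _ => rfl) fun _ => rfl

lemma simTransMk {ε price id ctr : γ → ℕ} (h₁ : Feasible ε) (h₂ : Feasible price)
    (h₃ : Feasible id) (h₄ : Feasible ctr) :
    Feasible fun c => SimTrans.mk (ε c) (price c) (id c) (ctr c) :=
  (h₁.prodMk (h₂.prodMk (h₃.prodMk h₄))).of_rep_eq (fun c => c) (fun _ => rfl) fun _ => rfl

lemma simWorldMk {nextId counter : γ → ℕ} {cards : γ → List SimCards} {cells : γ → List SimCell}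
    {log : γ → List SimTrans} (h₁ : Feasible nextId) (h₂ : Feasible counter) (h₃ : Feasible cards)
    (h₄ : Feasible cells) (h₅ : Feasible log) :
    Feasible fun c => SimWorld.mk (nextId c) (counter c) (cards c) (cells c) (log c) :=
  (h₁.prodMk (h₂.prodMk (h₃.prodMk (h₄.prodMk h₅)))).of_rep_eq (fun c => c) (fun _ => rfl)
    fun _ => rfl

section fields

variable {f : γ → SimCards} {g : γ → SimCell} {h : γ → SimTrans} {w : γ → SimWorld}

lemma cards_lo (hf : Feasible f) : Feasible fun c => (f c).lo := hf.simCardsProd.fst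
lemma cards_hi (hf : Feasible f) : Feasible fun c => (f c).hi := hf.simCardsProd.snd.fst
lemma cards_id (hf : Feasible f) : Feasible fun c => (f c).id := hf.simCardsProd.snd.snd
lemma cell_id (hg : Feasible g) : Feasible fun c => (g c).id := hg.simCellProd.fst
lemma cell_bal (hg : Feasible g) : Feasible fun c => (g c).bal := hg.simCellProd.snd.fst
lemma cell_ctr (hg : Feasible g) : Feasible fun c => (g c).ctr := hg.simCellProd.snd.snd
lemma trans_period (hh : Feasible h) : Feasible fun c => (h c).period := hh.simTransProd.fst
lemma trans_price (hh : Feasible h) : Feasible fun c => (h c).price := hh.simTransProd.snd.fst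
lemma trans_id (hh : Feasible h) : Feasible fun c => (h c).id := hh.simTransProd.snd.snd.fst
lemma trans_ctr (hh : Feasible h) : Feasible fun c => (h c).ctr := hh.simTransProd.snd.snd.snd
lemma world_nextId (hw : Feasible w) : Feasible fun c => (w c).nextId := hw.simWorldProd.fst
lemma world_counter (hw : Feasible w) : Feasible fun c => (w c).counter := hw.simWorldProd.snd.fst
lemma world_cards (hw : Feasible w) : Feasible fun c => (w c).cards := hw.simWorldProd.snd.snd.fst
lemma world_cells (hw : Feasible w) : Feasible fun c => (w c).cells :=
  hw.simWorldProd.snd.snd.snd.fst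
lemma world_log (hw : Feasible w) : Feasible fun c => (w c).log := hw.simWorldProd.snd.snd.snd.snd

end fields

section worlds

variable {w : γ → SimWorld}

lemma lookupCard (hw : Feasible w) {t : γ → ℕ} (ht : Feasible t) :
    Feasible fun c => (w c).lookupCard (t c) :=
  find? (decide_and (id.snd.cards_lo.decide_lt (ht.comp id.fst))
    ((ht.comp id.fst).decide_le id.snd.cards_hi)) hw.world_cards

lemma lookupCell (hw : Feasible w) {t : γ → ℕ} (ht : Feasible t) :
    Feasible fun c => (w c).lookupCell (t c) :=
  find? (id.snd.cell_id.decide_eq (ht.comp id.fst)) hw.world_cells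

lemma register {N bud : γ → ℕ} {tnb : γ → Unary} (hN : Feasible N) (hw : Feasible w)
    (hbud : Feasible bud) (htnb : Feasible tnb) :
    Feasible fun c => (w c).register (N c) (bud c) (tnb c).val := by
  have h1 : Feasible fun c => (w c).counter + (tnb c).val := hw.world_counter.add htnb.unaryVal
  refine ite (hw.world_nextId.decide_lt hN) (prodMk (dataOfList (map ?_ htnb.range))
    (simWorldMk (hw.world_nextId.add (const 1)) h1
      ((simCardsMk hw.world_counter h1 hw.world_nextId).cons hw.world_cards)
      ((simCellMk hw.world_nextId hbud (const 0)).cons hw.world_cells) hw.world_log))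
      ((const (Data.num 0)).prodMk hw)
  exact (((hw.world_counter.comp id.fst).add id.snd).add (const 1)).dataNum

lemma charge {ε price i : γ → ℕ} {m : γ → SimCell} (hw : Feasible w) (hε : Feasible ε)
    (hp : Feasible price) (hi : Feasible i) (hm : Feasible m) :
    Feasible fun c => (w c).charge (ε c) (price c) (i c) (m c) :=
  ite (hp.decide_le hm.cell_bal) (simWorldMk hw.world_nextId hw.world_counter hw.world_cards
    ((simCellMk hi (hm.cell_bal.sub hp) (hm.cell_ctr.add (const 1))).cons hw.world_cells)
    ((simTransMk hε hp hi (hm.cell_ctr.add (const 1))).cons hw.world_log)) hw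

lemma spend {ε tid price : γ → ℕ} (hw : Feasible w) (hε : Feasible ε)
    (ht : Feasible tid) (hp : Feasible price) :
    Feasible fun c => (w c).spend (ε c) (tid c) (price c) :=
  optionElim (hw.lookupCard ht) hw (optionElim
    (lookupCell (hw.comp id.fst) id.snd.cards_id) (hw.comp id.fst)
    (charge (hw.comp id.fst.fst) (hε.comp id.fst.fst) (hp.comp id.fst.fst) id.fst.snd.cards_id
      id.snd))

lemma transactions {ε : γ → ℕ} (hw : Feasible w) (hε : Feasible ε) :
    Feasible fun c => (w c).transactions (ε c) :=
  (filter (id.snd.trans_period.decide_eq (hε.comp id.fst)) hw.world_log).reverse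

lemma sel {α : Type} [DataRep α] {p : γ → α × α} {b : γ → Bool} (hp : Feasible p)
    (hb : Feasible b) : Feasible fun c => (p c).sel (b c) :=
  ite_bool hb hp.snd hp.fst

lemma setSel {α : Type} [DataRep α] {p : γ → α × α} {b : γ → Bool} {a : γ → α} (hp : Feasible p)
    (hb : Feasible b) (ha : Feasible a) : Feasible fun c => (p c).setSel (b c) (a c) :=
  ite_bool hb (hp.fst.prodMk ha) (ha.prodMk hp.snd)

lemma simStep {N : γ → ℕ} {ws : γ → SimWorld × SimWorld} {x : γ → Data} (hN : Feasible N)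
    (hws : Feasible ws) (hx : Feasible x) : Feasible fun c => simStep (N c) (ws c) (x c) := by
  have hb := hx.dataSnd.dataFst.dataToBool
  have hw := hws.sel hb
  have hr := register hN hw hx.dataSnd.dataSnd.dataFst.dataToNat
    hx.dataSnd.dataSnd.dataSnd.dataLength
  exact ite (hx.dataFst.dataToNat.decide_eq (const 0)) (hr.fst.prodMk (hws.setSel hb hr.snd))
    (ite (hx.dataFst.dataToNat.decide_eq (const 1)) ((const (Data.num 0)).prodMk (hws.setSel hb
      (hw.spend hx.dataSnd.dataSnd.dataFst.dataToNat hx.dataSnd.dataSnd.dataSnd.dataFst.dataToNat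
        hx.dataSnd.dataSnd.dataSnd.dataSnd.dataToNat))) ((const (Data.num 0)).prodMk hws))

end worlds

lemma view {l : γ → Unary} {ρ : γ → ℕ} {input answers : γ → Data} (hl : Feasible l)
    (hρ : Feasible ρ) (hi : Feasible input) (ha : Feasible answers) :
    Feasible fun c => view (l c).val (ρ c) (input c) (answers c) :=
  hl.dataUnary.dataPair (hρ.dataNum.dataPair (hi.dataPair ha))

lemma simRun (A : OracleAlg) {N : ℕ → ℕ} (hN : Feasible fun l : Unary => N l.val) {l : γ → Unary}
    {ρ : γ → ℕ} {input : γ → Data} (hl : Feasible l) (hρ : Feasible ρ) (hi : Feasible input) :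
    Feasible fun c => simRun A (N (l c).val) (l c).val (ρ c) (input c) := by
  have hq : Feasible A.query := A.query_poly
  have hv : PolyBounded fun c => (l c).val :=
    hl.polyBounded.mono fun c => by rw [repSize_unary]; omega
  have hR := hv.eval A.rounds
  have hB := hv.eval A.bound
  have hstep : Feasible fun p : γ × Data × SimWorld × SimWorld =>
      _root_.simStep (N (l p.1).val) p.2.2
        (A.query (_root_.view (l p.1).val (ρ p.1) (input p.1) p.2.1)) :=
    simStep (hN.comp (hl.comp id.fst)) id.snd.snd (hq.comp (view (hl.comp id.fst) (hρ.comp id.fst)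
      (hi.comp id.fst) id.snd.fst))
  refine iterate (n := fun c => ⟨A.rounds.eval (l c).val⟩)
    (step := fun c => simRound A (N (l c).val) (l c).val (ρ c) (input c))
    (init := fun _ => (.num 0, (.empty, .empty)))
    ((hstep.fst.dataPair id.snd.fst).prodMk hstep.snd) (hl.unary_eval A.rounds) (const _)
    -- The bound for the list of answers, followed by the bounds for the two worlds.
    (B := fun c => 1 + (1 + A.rounds.eval (l c).val * (A.bound.eval (l c).val *
      (A.rounds.eval (l c).val * A.bound.eval (l c).val + 2) + 2)) +
      (1 + SimWorld.sizeBound (A.rounds.eval (l c).val) (A.bound.eval (l c).val) +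
        SimWorld.sizeBound (A.rounds.eval (l c).val) (A.bound.eval (l c).val))) ?_ ?_
  · have hS : PolyBounded fun c =>
        SimWorld.sizeBound (A.rounds.eval (l c).val) (A.bound.eval (l c).val) :=
      ((PolyBounded.const 10).mul (hR.add (.const 1))).mul
        ((((hR.mul hB).add hR).add hB).add (.const 10))
    exact ((PolyBounded.const 1).add ((PolyBounded.const 1).add (hR.mul
      ((hB.mul ((hR.mul hB).add (.const 2))).add (.const 2))))).add
        (((PolyBounded.const 1).add hS).add hS)
  · intro c k hk
    obtain ⟨h1, h2⟩ := simRound_iterate_bounded A (N (l c).val) (l c).val (ρ c) (input c) k hk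
    have h3 := (h1 false).repSize_le hk
    have h4 := (h1 true).repSize_le hk
    rw [repSize_pair, repSize_pair]
    refine Nat.add_le_add (Nat.add_le_add le_rfl (h2.trans ?_))
      (Nat.add_le_add (Nat.add_le_add le_rfl h3) h4)
    gcongr

end Feasible

/-! ## Sampling -/

section

variable {α β γ : Type}

lemma PMF.bind_congr_support {p : PMF α} {f g : α → PMF β} (h : ∀ a ∈ p.support, f a = g a) :
    p.bind f = p.bind g := by
  ext b
  simp only [PMF.bind_apply]
  refine tsum_congr fun a => ?_
  by_cases ha : p a = 0
  · simp [ha]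
  · rw [h a ((PMF.mem_support_iff _ _).2 ha)]

lemma PMF.uniformOfFintype_map_equiv [Fintype α] [Nonempty α] [Fintype β] [Nonempty β]
    (e : α ≃ β) : (PMF.uniformOfFintype α).map e = PMF.uniformOfFintype β := by
  ext b
  rw [PMF.map_apply, tsum_eq_single (e.symm b)]
  · simp [Fintype.card_congr e]
  · intro a ha
    rw [if_neg]
    rintro rfl
    simp at ha

lemma PMF.uniformOfFintype_prod [Fintype α] [Nonempty α] [Fintype β] [Nonempty β] :
    PMF.uniformOfFintype (α × β) =
      (PMF.uniformOfFintype α).bind fun a => (PMF.uniformOfFintype β).map fun b => (a, b) := by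
  ext ⟨a, b⟩
  rw [PMF.bind_apply, tsum_eq_single a]
  · rw [PMF.map_apply, tsum_eq_single b]
    · simp only [uniformOfFintype_apply, Fintype.card_prod, Nat.cast_mul, if_true]
      rw [ENNReal.mul_inv] <;> simp
    · intro b' hb
      simp [hb.symm]
  · intro a' ha
    rw [PMF.map_apply]
    simp [ha.symm]

lemma uniformBelow_eq (q : ℕ) [NeZero q] :
    uniformBelow q = (PMF.uniformOfFintype (Fin q)).map fun i : Fin q => (i : ℕ) := by
  obtain ⟨n, rfl⟩ := Nat.exists_eq_succ_of_ne_zero (NeZero.ne q)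
  exact PMF.map_id _

lemma uniformBits_eq (k : ℕ) : uniformBits k = uniformBelow (2 ^ k) := by
  rw [uniformBelow_eq]
  exact PMF.map_id _

lemma uniformBelow_apply (q : ℕ) [NeZero q] (n : ℕ) :
    uniformBelow q n = if n < q then (q : ENNReal)⁻¹ else 0 := by
  rw [uniformBelow_eq, PMF.map_apply]
  split
  next h =>
    rw [tsum_eq_single ⟨n, h⟩]
    · simp
    · intro i hi
      rw [if_neg]
      rintro rfl
      simp at hi
  next h =>
    rw [ENNReal.tsum_eq_zero]
    intro i
    rw [if_neg]
    rintro rfl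
    exact h i.2

lemma lt_of_mem_support_uniformBits {k n : ℕ} (h : n ∈ (uniformBits k).support) : n < 2 ^ k := by
  rw [uniformBits_eq, PMF.mem_support_iff, uniformBelow_apply] at h
  by_contra hn
  simp [hn] at h

/-- Division with remainder by `a` is a bijection from the numbers below `a * b` to pairs of a digit
and a quotient, so remainder and quotient are independent and uniform. -/
lemma uniformBelow_mul_bind (a b : ℕ) [NeZero a] [NeZero b] (f : ℕ → ℕ → PMF β) :
    ((uniformBelow (a * b)).bind fun z => f (z % a) (z / a)) =
      (uniformBelow a).bind fun x => (uniformBelow b).bind fun y => f x y := by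
  have : NeZero (b * a) := ⟨mul_ne_zero (NeZero.ne _) (NeZero.ne _)⟩
  rw [mul_comm a b, uniformBelow_eq, ← PMF.uniformOfFintype_map_equiv finProdFinEquiv,
    PMF.uniformOfFintype_prod, uniformBelow_eq, uniformBelow_eq, PMF.bind_comm]
  simp only [PMF.map_bind, PMF.bind_map, PMF.bind_bind, PMF.map_comp, Function.comp_def,
    finProdFinEquiv_apply_val]
  congr! 4 with x y
  rw [Nat.add_mul_mod_self_left, Nat.mod_eq_of_lt y.2]
  congr 1
  rw [Nat.add_mul_div_left _ _ (Nat.pos_of_neZero a), Nat.div_eq_of_lt y.2, zero_add]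

lemma uniformBits_add_bind (a b : ℕ) (f : ℕ → ℕ → PMF β) :
    ((uniformBits (a + b)).bind fun z => f (z % 2 ^ a) (z / 2 ^ a)) =
      (uniformBits a).bind fun x => (uniformBits b).bind fun y => f x y := by
  simp only [uniformBits_eq, pow_add]
  exact uniformBelow_mul_bind _ _ f

lemma uniformBelow_map_add (q : ℕ) [NeZero q] (d : ℕ) :
    (uniformBelow q).map (fun r => (r + d) % q) = uniformBelow q := by
  rw [uniformBelow_eq, PMF.map_comp]
  conv_rhs => rw [← PMF.uniformOfFintype_map_equiv (Equiv.addRight (Fin.ofNat q d)), PMF.map_comp]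
  congr 1
  ext i
  simp [Fin.val_add]

/-- `n` independent samples. -/
noncomputable def PMF.iid (p : PMF α) : ℕ → PMF (List α)
  | 0 => PMF.pure []
  | n + 1 => p.bind fun a => (p.iid n).map fun l => a :: l

lemma PMF.length_of_mem_support_iid {p : PMF α} {n : ℕ} :
    ∀ {l : List α}, l ∈ (p.iid n).support → l.length = n := by
  induction n with
  | zero => intro l h; simp [PMF.iid] at h; simp [h]
  | succ n ih =>
    intro l h
    simp only [PMF.iid, PMF.mem_support_bind_iff, PMF.mem_support_map_iff] at h
    obtain ⟨a, _, l', hl', rfl⟩ := h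
    simp [ih hl']

/-- The `n` least significant digits of `x` to the base `q`. -/
def lowDigits (q : ℕ) : ℕ → ℕ → List ℕ
  | 0, _ => []
  | n + 1, x => x % q :: lowDigits q n (x / q)

/-- The cofactor `c` does not affect the low digits. It is `1` for strings of bits and a rounded-up
quotient in the approximation by random bits. -/
lemma uniformBelow_map_lowDigits (q c : ℕ) [NeZero q] [NeZero c] (n : ℕ) :
    (uniformBelow (q ^ n * c)).map (lowDigits q n) = (uniformBelow q).iid n := by
  induction n with
  | zero => exact PMF.map_const _ _
  | succ n ih =>
    have : NeZero (q ^ n * c) := ⟨mul_ne_zero (pow_ne_zero _ (NeZero.ne _)) (NeZero.ne _)⟩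
    rw [PMF.iid, ← ih, pow_succ', mul_assoc]
    have := uniformBelow_mul_bind q (q ^ n * c) fun x y => PMF.pure (x :: lowDigits q n y)
    simp only [PMF.map_comp]
    exact this

lemma uniformBits_map_lowDigits (k n : ℕ) :
    (uniformBits (k * n)).map (lowDigits (2 ^ k) n) = (uniformBits k).iid n := by
  have := uniformBelow_map_lowDigits (2 ^ k) 1 n
  rw [mul_one, ← pow_mul] at this
  rw [uniformBits_eq, uniformBits_eq, this]

/-- `p` is dominated by `C` times `q`. -/
def PMF.LeMul (C : ENNReal) (p q : PMF α) : Prop := ∀ a, p a ≤ C * q a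

lemma PMF.LeMul.bind {C : ENNReal} {p q : PMF α} (h : p.LeMul C q) (f : α → PMF β) :
    (p.bind f).LeMul C (q.bind f) := fun b => by
  simp only [PMF.bind_apply, ← ENNReal.tsum_mul_left, ← mul_assoc]
  exact ENNReal.tsum_le_tsum fun a => mul_le_mul_left (h a) _

lemma PMF.LeMul.bind_right {C : ENNReal} {p : PMF α} {f g : α → PMF β}
    (h : ∀ a ∈ p.support, (f a).LeMul C (g a)) : (p.bind f).LeMul C (p.bind g) := fun b => by
  simp only [PMF.bind_apply, ← ENNReal.tsum_mul_left]
  refine ENNReal.tsum_le_tsum fun a => ?_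
  by_cases ha : p a = 0
  · simp [ha]
  · rw [mul_left_comm]
    exact mul_le_mul_right (h a ((PMF.mem_support_iff _ _).2 ha) b) _

/-- One-sided domination suffices: at `true` it bounds `prob p true` from above, and at `false`, by
complementation, from below. -/
lemma PMF.LeMul.abs_prob_sub_le {δ : ℝ} (hδ : 0 ≤ δ) {p q : PMF Bool}
    (h : p.LeMul (ENNReal.ofReal (1 + δ)) q) : |prob p true - prob q true| ≤ δ := by
  have h1 : ∀ b, prob p b ≤ (1 + δ) * prob q b := fun b => by
    have := ENNReal.toReal_mono (ENNReal.mul_ne_top ENNReal.ofReal_ne_top (q.apply_ne_top b)) (h b)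
    rwa [ENNReal.toReal_mul, ENNReal.toReal_ofReal (by linarith)] at this
  have h2 : ∀ r : PMF Bool, prob r true + prob r false = 1 := fun r => by
    have := r.tsum_coe
    rw [tsum_fintype, Fintype.sum_bool] at this
    rw [prob, prob, ← ENNReal.toReal_add (r.apply_ne_top _) (r.apply_ne_top _), this]
    rfl
  have h3 : ∀ b, 0 ≤ prob q b := fun b => ENNReal.toReal_nonneg
  have := h1 true
  have := h1 false
  have := h2 p
  have := h2 q
  have := h3 true
  have := h3 false
  rw [abs_le]
  constructor <;> nlinarith

/-- The low digits of a long random bit string are almost uniform. -/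
lemma leMul_uniformBits_map_lowDigits (q n k l : ℕ) [NeZero q] (h : q ^ n * 2 ^ l ≤ 2 ^ k) :
    ((uniformBits k).map (lowDigits q n)).LeMul (ENNReal.ofReal (1 + (1 / 2) ^ l))
      ((uniformBelow q).iid n) := by
  set M := q ^ n with hM
  have hM0 : 0 < M := Nat.pow_pos (Nat.pos_of_neZero q)
  have hle : 2 ^ k ≤ M * (2 ^ k / M + 1) := by
    rw [mul_add, mul_one]
    have h1 := Nat.div_add_mod (2 ^ k) M
    have h2 := Nat.mod_lt (2 ^ k) hM0
    omega
  have hle' : M * (2 ^ k / M + 1) ≤ 2 ^ k + M := by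
    rw [mul_add, mul_one]
    have := Nat.mul_div_le (2 ^ k) M
    omega
  -- The product `M * (2 ^ k / M + 1)` is a multiple of `M` above `2 ^ k`, so the low digits of a
  -- uniform number below it are exactly uniform. It exceeds `2 ^ k` by at most `M`, which is at
  -- most `2 ^ k / 2 ^ l`; the point masses of the two distributions therefore differ by a factor of
  -- at most `1 + 2 ^ (-l)`.
  rw [← uniformBelow_map_lowDigits q (2 ^ k / M + 1) n, ← hM, uniformBits_eq]
  refine PMF.LeMul.bind (fun x => ?_) _
  have : NeZero (M * (2 ^ k / M + 1)) := ⟨(Nat.mul_pos hM0 (Nat.succ_pos _)).ne'⟩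
  rw [uniformBelow_apply, uniformBelow_apply]
  set T := M * (2 ^ k / M + 1)
  have hT : 0 < T := Nat.pos_of_neZero T
  split
  next hx =>
    rw [if_pos (hx.trans_le hle)]
    have hC : ENNReal.ofReal (1 + (1 / 2) ^ l) * (T : ENNReal)⁻¹ =
        ENNReal.ofReal ((1 + (1 / 2) ^ l) * (T : ℝ)⁻¹) := by
      rw [ENNReal.ofReal_mul (by positivity), ENNReal.ofReal_inv_of_pos (by exact_mod_cast hT),
        ENNReal.ofReal_natCast]
    have hK : ((2 ^ k : ℕ) : ENNReal)⁻¹ = ENNReal.ofReal (((2 ^ k : ℕ) : ℝ)⁻¹) := by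
      rw [ENNReal.ofReal_inv_of_pos (by positivity), ENNReal.ofReal_natCast]
    rw [hC, hK]
    refine ENNReal.ofReal_le_ofReal ?_
    have h1 : (T : ℝ) ≤ 2 ^ k + M := by exact_mod_cast hle'
    have h2 : (M : ℝ) * 2 ^ l ≤ 2 ^ k := by exact_mod_cast h
    have hT' : (0 : ℝ) < T := by exact_mod_cast hT
    have h3 : (T : ℝ) ≤ (1 + (1 / 2) ^ l) * 2 ^ k := by
      have : (M : ℝ) ≤ (1 / 2) ^ l * 2 ^ k := by
        rw [one_div, inv_pow, inv_mul_eq_div, le_div_iff₀ (by positivity)]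
        exact h2
      linarith
    push_cast
    rw [← div_eq_mul_inv, le_div_iff₀ hT', inv_mul_le_iff₀ (by positivity)]
    linarith
  next hx => exact zero_le

end

namespace Feasible

variable {γ : Type} [DataRep γ]

lemma lowDigits {q x : γ → ℕ} {n : γ → Unary} (hq : Feasible q) (hn : Feasible n)
    (hx : Feasible x) : Feasible fun c => lowDigits (q c) (n c).val (x c) := by
  have h : ∀ q k x m, ((fun s : ℕ × List ℕ => (s.1 / q, s.1 % q :: s.2))^[k] (x, m)).2 =
      (_root_.lowDigits q k x).reverse ++ m := by
    intro q k
    induction k with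
    | zero => intro x m; rfl
    | succ k ih => intro x m; rw [Function.iterate_succ_apply, ih]; simp [_root_.lowDigits]
  have hle : ∀ q k x, ∀ y ∈ _root_.lowDigits q k x, y ≤ x := by
    intro q k
    induction k with
    | zero => intro x y hy; simp [_root_.lowDigits] at hy
    | succ k ih =>
      intro x y hy
      rcases List.mem_cons.1 hy with rfl | hy
      · exact Nat.mod_le _ _
      · exact (ih _ _ hy).trans (Nat.div_le_self _ _)
  have hlen : ∀ q k x, (_root_.lowDigits q k x).length = k := by
    intro q k
    induction k with
    | zero => intro x; rfl
    | succ k ih => intro x; simp [_root_.lowDigits, ih]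
  have h1 : ∀ q k x m, ((fun s : ℕ × List ℕ => (s.1 / q, s.1 % q :: s.2))^[k] (x, m)).1 ≤ x := by
    intro q k
    induction k with
    | zero => intro x m; rfl
    | succ k ih =>
      intro x m; rw [Function.iterate_succ_apply]; exact (ih _ _).trans (Nat.div_le_self _ _)
  have hsize : ∀ a b : ℕ, a ≤ b → repSize a ≤ repSize b := fun a b hab => by
    have := Nat.size_le_size hab
    rw [repSize_nat, repSize_nat]; omega
  refine (iterate (n := n) (init := fun c => (x c, ([] : List ℕ)))
    (step := fun c s => (s.1 / q c, s.1 % q c :: s.2))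
    ((id.snd.fst.div (hq.comp id.fst)).prodMk
      ((id.snd.fst.mod (hq.comp id.fst)).cons id.snd.snd)) hn (hx.prodMk nil)
    (B := fun c => 1 + repSize (x c) + (repSize (n c) * (repSize (x c) + 1) + 1))
    (((PolyBounded.const 1).add hx.polyBounded).add ((hn.polyBounded.mul
      (hx.polyBounded.add (.const 1))).add (.const 1)))
    fun c k hk => ?_).snd.reverse.of_eq fun c => by simp [h]
  rw [repSize_pair, h, List.append_nil]
  refine Nat.add_le_add (Nat.add_le_add le_rfl (hsize _ _ (h1 _ _ _ _))) ?_
  refine (repSize_list_le (M := repSize (x c)) fun y hy => ?_).trans ?_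
  · exact hsize _ _ (hle _ _ _ _ (List.mem_reverse.1 hy))
  · have : k ≤ repSize (n c) := by rw [repSize_unary]; omega
    rw [List.length_reverse, hlen]
    gcongr

end Feasible

/-! ## The simulation follows the experiment -/

lemma PMF.monad_bind_eq {α β : Type} (p : PMF α) (f : α → PMF β) : (p >>= f) = p.bind f := rfl

lemma PMF.monad_pure_eq {α : Type} (a : α) : (Pure.pure a : PMF α) = PMF.pure a := rfl

lemma PMF.map_eq_pure_of_support {α β : Type} {p : PMF α} {f : α → β} {b : β}
    (h : ∀ a ∈ p.support, f a = b) : p.map f = PMF.pure b := by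
  have := PMF.bind_congr_support (p := p) (f := PMF.pure ∘ f) (g := fun _ => PMF.pure b)
    fun a ha => by rw [Function.comp_apply, h a ha]
  rwa [PMF.bind_const] at this

/-! ### Invariants of the simulated worlds -/

namespace SimWorld

/-- Invariants of the simulation with at most `N` households. -/
structure Valid (N : ℕ) (a : SimWorld) : Prop where
  cards : ∀ c ∈ a.cards, c.id < N ∧ c.id < a.nextId ∧ ∃ m, a.lookupCell c.id = some m
  log : ∀ t ∈ a.log, t.id < a.nextId ∧ ∃ m, a.lookupCell t.id = some m ∧ t.ctr ≤ m.ctr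
  nodup : (a.log.map fun t => (t.id, t.ctr)).Nodup

variable {N : ℕ} {a : SimWorld}

lemma valid_empty (N : ℕ) : empty.Valid N := by
  constructor <;> simp [empty]

lemma lookupCell_cons (n k : ℕ) (cs : List SimCards) (m : SimCell) (ms : List SimCell)
    (ts : List SimTrans) (i : ℕ) :
    (SimWorld.mk n k cs (m :: ms) ts).lookupCell i =
      if m.id = i then some m else (SimWorld.mk n k cs ms ts).lookupCell i := by
  simp only [lookupCell, List.find?_cons]
  by_cases h : m.id = i <;> simp [h]

lemma lookupCard_cons (n k : ℕ) (c : SimCards) (cs : List SimCards) (ms : List SimCell)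
    (ts : List SimTrans) (t : ℕ) :
    (SimWorld.mk n k (c :: cs) ms ts).lookupCard t =
      if c.lo < t ∧ t ≤ c.hi then some c else (SimWorld.mk n k cs ms ts).lookupCard t := by
  simp only [lookupCard, List.find?_cons]
  by_cases h : c.lo < t ∧ t ≤ c.hi <;> simp [h]

lemma Valid.register (h : a.Valid N) (bud tnb : ℕ) : (a.register N bud tnb).2.Valid N := by
  unfold SimWorld.register
  split
  next hN =>
    refine ⟨fun c hc => ?_, fun t ht => ?_, h.nodup⟩
    · rcases List.mem_cons.1 hc with rfl | hc
      · exact ⟨hN, Nat.lt_succ_self _, _, by rw [lookupCell_cons, if_pos rfl]⟩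
      · obtain ⟨h1, h2, m, hm⟩ := h.cards c hc
        exact ⟨h1, h2.trans (Nat.lt_succ_self _), m, by
          rw [lookupCell_cons, if_neg h2.ne']; exact hm⟩
    · obtain ⟨h1, m, hm, h2⟩ := h.log t ht
      exact ⟨h1.trans (Nat.lt_succ_self _), m, by
        rw [lookupCell_cons, if_neg h1.ne']; exact hm, h2⟩
  next => exact h

/-- The new counter is one more than the one in the current cell, which bounds all counters logged
for that household. So the logged pair is new, and the invariant survives because the cell is raised
to the same value. -/
lemma Valid.charge (h : a.Valid N) {i : ℕ} {m : SimCell} (hm : a.lookupCell i = some m)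
    (hi : i < a.nextId) (ε price : ℕ) : (a.charge ε price i m).Valid N := by
  unfold SimWorld.charge
  split
  next hp =>
    refine ⟨fun c hc => ?_, fun t ht => ?_, ?_⟩
    · obtain ⟨h1, h2, m', hm'⟩ := h.cards c hc
      refine ⟨h1, h2, ?_⟩
      rw [lookupCell_cons]
      split
      · exact ⟨_, rfl⟩
      · exact ⟨m', hm'⟩
    · rw [lookupCell_cons]
      rcases List.mem_cons.1 ht with rfl | ht
      · exact ⟨hi, _, if_pos rfl, le_rfl⟩
      · obtain ⟨h1, m', hm', h2⟩ := h.log t ht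
        refine ⟨h1, ?_⟩
        split
        next he =>
          change i = t.id at he
          rw [← he, hm] at hm'
          cases hm'
          exact ⟨_, rfl, h2.trans (Nat.le_succ _)⟩
        next => exact ⟨m', hm', h2⟩
    · rw [List.map_cons, List.nodup_cons]
      refine ⟨fun hmem => ?_, h.nodup⟩
      obtain ⟨t, ht, he⟩ := List.mem_map.1 hmem
      obtain ⟨h1, m', hm', h2⟩ := h.log t ht
      simp only [Prod.mk.injEq] at he
      rw [he.1, hm] at hm'
      cases hm'
      omega
  next => exact h

lemma Valid.spend (h : a.Valid N) (ε tid price : ℕ) : (a.spend ε tid price).Valid N := by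
  unfold SimWorld.spend
  cases hc : a.lookupCard tid with
  | none => exact h
  | some c =>
    cases hm : a.lookupCell c.id with
    | none => simpa [hm] using h
    | some m =>
      simp only [Option.elim_some, hm]
      exact h.charge hm (h.cards c (List.mem_of_find?_eq_some hc)).2.1 _ _

lemma Valid.nodup_transactions (h : a.Valid N) (ε : ℕ) :
    ((a.transactions ε).map fun t => (t.id, t.ctr)).Nodup := by
  rw [transactions, List.map_reverse, List.nodup_reverse]
  exact h.nodup.sublist (List.filter_sublist.map _)

lemma transactions_cons (n k : ℕ) (cs : List SimCards) (ms : List SimCell) (t : SimTrans)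
    (ts : List SimTrans) (ε : ℕ) :
    (SimWorld.mk n k cs ms (t :: ts)).transactions ε =
      (SimWorld.mk n k cs ms ts).transactions ε ++ if t.period = ε then [t] else [] := by
  by_cases h : t.period = ε <;> simp [transactions, h]

end SimWorld

lemma simStep_valid {N : ℕ} {ws : SimWorld × SimWorld} (h : ∀ b, (ws.sel b).Valid N) (x : Data)
    (b : Bool) : ((simStep N ws x).2.sel b).Valid N := by
  unfold simStep
  split
  · rw [Prod.sel_setSel]
    split
    · exact (h _).register _ _
    · exact h b
  · split
    · rw [Prod.sel_setSel]
      split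
      · exact (h _).spend _ _ _
      · exact h b
    · exact h b

lemma simRound_iterate_valid (A : OracleAlg) (N l ρ : ℕ) (input : Data) (k : ℕ) (b : Bool) :
    (((simRound A N l ρ input)^[k] (.num 0, (.empty, .empty))).2.sel b).Valid N := by
  induction k generalizing b with
  | zero => cases b <;> exact SimWorld.valid_empty N
  | succ k ih =>
    rw [Function.iterate_succ_apply']
    exact simStep_valid ih _ b

/-! ### Coupling of the real oracles with the simulation, and deferred sampling -/

namespace WalletSystem

variable (W : WalletSystem) (l : ℕ) (S : W.Setup)

/-- The setup holds a key pair of the signature scheme. -/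
structure ValidSetup : Prop where
  keys : ∃ s ∈ (W.ds.kgen.run l (.num 0)).support, S.skRS = s.fst ∧ S.pkRS = s.snd

/-- The simulated world `a` mirrors the world `w`. -/
structure WorldRel (w : W.World) (a : SimWorld) : Prop where
  db : ∃ m, W.oram.Reachable l (W.maxHouseholds l) S.oramKey w.db m ∧
    ∀ i, m i = (a.lookupCell i).map fun c => (c.bal, c.ctr)
  nextId : w.nextId = a.nextId
  counter : w.counter = a.counter
  cards : ∀ t, w.cards t =
    (a.lookupCard t).map fun c => ⟨W.setupCard S, S.skRS, c.id⟩
  received : ∀ ε, (w.received ε).map (fun t => t.1) = (a.transactions ε).map SimTrans.price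

variable {W l S}

lemma ValidSetup.verif (hS : W.ValidSetup l S) {m σ : Data}
    (hσ : σ ∈ (W.ds.sign l S.skRS m).support) : W.ds.verif l S.pkRS m σ = true := by
  obtain ⟨s, hs, h1, h2⟩ := hS.keys
  rw [h1] at hσ
  rw [h2]
  exact W.ds.correct l s hs m σ hσ

/-- The signature check of the card never fails for honest keys, so registration fails exactly when
the identifiers are exhausted. That is visible to the simulation, whence the answer is
deterministic. -/
lemma regOracle_spec (hS : W.ValidSetup l S) {w : W.World} {a : SimWorld}
    (h : W.WorldRel l S w a) (bud tnb : ℕ) :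
    ∀ e ∈ (W.regOracle l S w bud tnb).support,
      e.1 = (a.register (W.maxHouseholds l) bud tnb).1 ∧
      W.WorldRel l S e.2 (a.register (W.maxHouseholds l) bud tnb).2 ∧
      e.2.received = w.received := by
  intro e he
  simp only [regOracle, register, PMF.monad_bind_eq, PMF.monad_pure_eq,
    PMF.mem_support_bind_iff] at he
  obtain ⟨c, hc, he⟩ := he
  unfold SimWorld.register
  rw [h.nextId] at hc
  split at hc
  next hN =>
    rw [if_pos hN]
    simp only [PMF.mem_support_bind_iff] at hc
    obtain ⟨r, hr, σ, hσ, hc⟩ := hc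
    rw [setupCard, if_pos (hS.verif hσ)] at hc
    simp only [PMF.mem_support_bind_iff, PMF.mem_support_pure_iff] at hc
    obtain ⟨v, hv, rfl⟩ := hc
    simp only [PMF.mem_support_pure_iff] at he
    subst he
    refine ⟨by rw [h.counter], ⟨?_, by simp [h.nextId], by simp [h.counter], fun t => ?_,
      fun ε => h.received ε⟩, rfl⟩
    · obtain ⟨m, hm, hm'⟩ := h.db
      refine ⟨_, hm.write hN hv, fun i => ?_⟩
      rw [SimWorld.lookupCell_cons, Function.update_apply]
      by_cases hi : i = a.nextId
      · simp [hi]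
      · rw [if_neg hi, if_neg (Ne.symm hi), hm' i]; rfl
    · rw [SimWorld.lookupCard_cons, h.counter]
      dsimp only
      split
      · rfl
      · exact h.cards t
  next hN =>
    rw [if_neg hN]
    simp only [PMF.mem_support_pure_iff] at hc
    subst hc
    simp only [PMF.mem_support_pure_iff] at he
    subst he
    exact ⟨rfl, h, rfl⟩

variable (W l S) in
/-- The transaction that is recorded for `t`. -/
noncomputable def sampleTrans (t : SimTrans) : PMF (ℕ × TransProof) :=
  (uniformBelow (W.com.order S.params)).bind fun r =>
    (W.ds.sign l S.skRS (signedMessage (W.prf.eval l S.prfKey (.pair (.num t.id) (.num t.ctr)))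
      t.period (W.com.commit S.params t.price r))).map fun σ =>
        (t.price, ⟨σ, W.prf.eval l S.prfKey (.pair (.num t.id) (.num t.ctr)),
          W.com.commit S.params t.price r, r⟩)

lemma fst_of_mem_support_sampleTrans {t : SimTrans} {x : ℕ × TransProof}
    (h : x ∈ (W.sampleTrans l S t).support) : x.1 = t.price := by
  simp only [sampleTrans, PMF.mem_support_bind_iff, PMF.mem_support_map_iff] at h
  obtain ⟨r, _, σ, _, rfl⟩ := h
  rfl

/-- The ORAM returns the cell of the simulated world, so whether the price is affordable is already
decided. On success, the lists of received transactions gain one entry distributed as `sampleTrans`;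
the randomness of the ORAM does not enter it. -/
lemma spendOracle_spec (hS : W.ValidSetup l S) {w : W.World} {a : SimWorld}
    (h : W.WorldRel l S w a) (ha : a.Valid (W.maxHouseholds l)) (ε tid price : ℕ) :
    (∀ e ∈ (W.spendOracle l S w ε tid price).support,
      e.1 = .num 0 ∧ W.WorldRel l S e.2 (a.spend ε tid price)) ∧
    (((a.spend ε tid price = a) ∧
        ∀ e ∈ (W.spendOracle l S w ε tid price).support, e.2.received = w.received) ∨
      ∃ t : SimTrans, t.period = ε ∧
        (∀ ε', (a.spend ε tid price).transactions ε' =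
          a.transactions ε' ++ if ε = ε' then [t] else []) ∧
        (W.spendOracle l S w ε tid price).map (fun e => e.2.received) =
          (W.sampleTrans l S t).map fun x =>
            Function.update w.received ε (w.received ε ++ [x])) := by
  have hcard := h.cards tid
  unfold SimWorld.spend
  cases hc : a.lookupCard tid with
  | none =>
    rw [hc, Option.map_none] at hcard
    simp only [spendOracle, hcard, PMF.monad_pure_eq, PMF.mem_support_pure_iff, Option.elim_none]
    refine ⟨?_, Or.inl ⟨trivial, ?_⟩⟩
    · rintro e rfl; exact ⟨rfl, h⟩
    · rintro e rfl; rfl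
  | some c =>
    obtain ⟨hcN, -, m, hm⟩ := ha.cards c (List.mem_of_find?_eq_some hc)
    rw [hc, Option.map_some] at hcard
    obtain ⟨mem, hreach, hmem⟩ := h.db
    have hread : ∀ e ∈ (W.oram.read S.oramKey c.id w.db).support, e.1 = some (m.bal, m.ctr) :=
      W.oram.read_correct l _ _ _ _ _ _ hreach hcN (by rw [hmem, hm]; rfl)
    simp only [Option.elim_some, hm]
    unfold SimWorld.charge
    by_cases hp : price ≤ m.bal
    · rw [if_pos hp]
      set t : SimTrans := ⟨ε, price, c.id, m.ctr + 1⟩ with ht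
      -- On the support of the read the cell is known, and on the support of the signature the
      -- verification succeeds; all branches of the protocol collapse.
      have key : W.spendOracle l S w ε tid price =
          (W.oram.read S.oramKey c.id w.db).bind fun e =>
          (W.sampleTrans l S t).bind fun x =>
          (W.oram.write S.oramKey c.id (m.bal - price, m.ctr + 1) e.2).bind fun v =>
            PMF.pure (.num 0, { w with
              db := v.2
              received := Function.update w.received ε (w.received ε ++ [x]) }) := by
        simp only [spendOracle, hcard, spend, setupCard, PMF.monad_bind_eq, PMF.monad_pure_eq,
          PMF.bind_bind, sampleTrans, PMF.bind_map, Function.comp_def]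
        refine PMF.bind_congr_support fun e he => ?_
        rw [hread e he]
        simp only [if_pos hp, PMF.bind_bind]
        refine congrArg _ (funext fun r => PMF.bind_congr_support fun σ hσ => ?_)
        simp only [hS.verif hσ, and_self, if_true, PMF.pure_bind]
        rfl
      refine ⟨?_, Or.inr ⟨t, rfl, fun ε' => SimWorld.transactions_cons .., ?_⟩⟩
      · intro e he
        rw [key] at he
        simp only [PMF.mem_support_bind_iff, PMF.mem_support_pure_iff] at he
        obtain ⟨e', he', x, hx, v, hv, rfl⟩ := he
        refine ⟨rfl, ⟨_, (hreach.read hcN he').write hcN hv, fun i => ?_⟩, h.nextId, h.counter,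
          h.cards, fun ε' => ?_⟩
        · rw [SimWorld.lookupCell_cons, Function.update_apply]
          by_cases hi : i = c.id
          · simp [hi]
          · rw [if_neg hi, if_neg (Ne.symm hi), hmem i]; rfl
        · have h1 := h.received ε'
          have h2 := fst_of_mem_support_sampleTrans hx
          rw [SimWorld.transactions_cons]
          dsimp only
          rw [Function.update_apply]
          by_cases hε : ε' = ε
          · subst hε
            simp only [if_true, List.map_append, h1, List.map_cons, h2, List.map_nil]
            rw [if_pos (show t.period = ε' from rfl)]
            rfl
          · rw [if_neg hε, if_neg (Ne.symm hε), List.append_nil, h1]; rfl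
      · rw [key]
        simp only [PMF.map_bind, PMF.pure_map, PMF.bind_const]
        rfl
    · rw [if_neg hp]
      have key : W.spendOracle l S w ε tid price =
          (W.oram.read S.oramKey c.id w.db).bind fun e =>
            PMF.pure (.num 0, { w with db := e.2 }) := by
        simp only [spendOracle, hcard, spend, setupCard, PMF.monad_bind_eq, PMF.monad_pure_eq,
          PMF.bind_bind]
        refine PMF.bind_congr_support fun e he => ?_
        rw [hread e he]
        simp only [if_neg hp, PMF.pure_bind]
      simp only [key, PMF.mem_support_bind_iff, PMF.mem_support_pure_iff]
      refine ⟨?_, Or.inl ⟨trivial, ?_⟩⟩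
      · rintro e ⟨e', he', rfl⟩
        exact ⟨rfl, ⟨mem, hreach.read hcN he', hmem⟩, h.nextId, h.counter, h.cards, h.received⟩
      · rintro e ⟨e', he', rfl⟩; rfl

variable (W l S) in
-- The deferred counterpart of a list of received transactions: for fixed keys the entries are
-- independent.
noncomputable def sampleList : List SimTrans → PMF (List (ℕ × TransProof))
  | [] => PMF.pure []
  | t :: T => (W.sampleTrans l S t).bind fun x => (sampleList T).map fun xs => x :: xs

lemma sampleList_append (T T' : List SimTrans) :
    W.sampleList l S (T ++ T') = (W.sampleList l S T).bind fun xs =>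
      (W.sampleList l S T').map fun ys => xs ++ ys := by
  induction T with
  | nil =>
    simp only [List.nil_append, sampleList, PMF.pure_bind]
    exact (PMF.map_id _).symm
  | cons t T ih =>
    simp only [List.cons_append, sampleList, ih, PMF.map_bind, PMF.bind_bind, PMF.bind_map,
      PMF.map_comp, Function.comp_def]

/-- Laws are recorded for one world and one period at a time. This is enough, since only one list
enters the proof shown to the adversary; of the other world only prices and length matter, and
`WorldRel` determines them. -/
lemma auditOracle_spec (hS : W.ValidSetup l S) {ws : Bool → W.World} {as : SimWorld × SimWorld}
    (h : ∀ b, W.WorldRel l S (ws b) (as.sel b))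
    (ha : ∀ b, (as.sel b).Valid (W.maxHouseholds l)) (x : Data) :
    (∀ e ∈ (W.auditOracle l S ws x).support,
      e.1 = (simStep (W.maxHouseholds l) as x).1 ∧
      ∀ b, W.WorldRel l S (e.2 b) ((simStep (W.maxHouseholds l) as x).2.sel b)) ∧
    ∀ b ε, ∃ new, ((simStep (W.maxHouseholds l) as x).2.sel b).transactions ε =
        (as.sel b).transactions ε ++ new ∧
      (W.auditOracle l S ws x).map (fun e => (e.2 b).received ε) =
        (W.sampleList l S new).map fun xs => (ws b).received ε ++ xs := by
  have trivial_new : ∀ b ε, (∀ e ∈ (W.auditOracle l S ws x).support,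
      (e.2 b).received ε = (ws b).received ε) →
      (W.auditOracle l S ws x).map (fun e => (e.2 b).received ε) =
        (W.sampleList l S []).map fun xs => (ws b).received ε ++ xs := fun b ε he => by
    rw [PMF.map_eq_pure_of_support he, sampleList, PMF.pure_map, List.append_nil]
  rcases hx : x.fst.toNat with _ | _ | n
  · set b₀ := x.snd.fst.toBool with hb₀
    have hspec := regOracle_spec hS (h b₀) x.snd.snd.fst.toNat x.snd.snd.snd.length
    have key : W.auditOracle l S ws x =
        (W.regOracle l S (ws b₀) x.snd.snd.fst.toNat x.snd.snd.snd.length).bind fun e =>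
          PMF.pure (e.1, Function.update ws b₀ e.2) := by
      simp only [auditOracle, AuditQuery.decode, hx]; rfl
    have hsim : simStep (W.maxHouseholds l) as x = (((as.sel b₀).register (W.maxHouseholds l)
        x.snd.snd.fst.toNat x.snd.snd.snd.length).1, as.setSel b₀ ((as.sel b₀).register
          (W.maxHouseholds l) x.snd.snd.fst.toNat x.snd.snd.snd.length).2) := by
      simp only [simStep, hx, if_true]; rfl
    have hsupp : ∀ e ∈ (W.auditOracle l S ws x).support, ∃ e' ∈ (W.regOracle l S (ws b₀)
        x.snd.snd.fst.toNat x.snd.snd.snd.length).support,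
        e = (e'.1, Function.update ws b₀ e'.2) := fun e he => by
      rw [key] at he
      simpa only [PMF.mem_support_bind_iff, PMF.mem_support_pure_iff] using he
    rw [hsim]
    refine ⟨fun e he => ?_, fun b ε => ⟨[], ?_, trivial_new b ε fun e he => ?_⟩⟩
    · obtain ⟨e', he', rfl⟩ := hsupp e he
      refine ⟨(hspec e' he').1, fun b => ?_⟩
      rw [Prod.sel_setSel]
      by_cases hb : b = b₀
      · subst hb; simpa using (hspec e' he').2.1
      · simpa [hb] using h b
    · rw [Prod.sel_setSel, List.append_nil]
      by_cases hb : b = b₀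
      · rw [if_pos hb, hb, SimWorld.register]
        split <;> rfl
      · rw [if_neg hb]
    · obtain ⟨e', he', rfl⟩ := hsupp e he
      by_cases hb : b = b₀
      · subst hb; simp [(hspec e' he').2.2]
      · simp [hb]
  · set b₀ := x.snd.fst.toBool with hb₀
    obtain ⟨hspec, hdist⟩ := spendOracle_spec hS (h b₀) (ha b₀) x.snd.snd.fst.toNat
      x.snd.snd.snd.fst.toNat x.snd.snd.snd.snd.toNat
    set o := W.spendOracle l S (ws b₀) x.snd.snd.fst.toNat x.snd.snd.snd.fst.toNat
      x.snd.snd.snd.snd.toNat with ho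
    have key : W.auditOracle l S ws x = o.bind fun e =>
        PMF.pure (e.1, Function.update ws b₀ e.2) := by
      simp only [auditOracle, AuditQuery.decode, hx]; rfl
    have hsim : simStep (W.maxHouseholds l) as x = (.num 0, as.setSel b₀ ((as.sel b₀).spend
        x.snd.snd.fst.toNat x.snd.snd.snd.fst.toNat x.snd.snd.snd.snd.toNat)) := by
      simp [simStep, hx, hb₀]
    have hsupp : ∀ e ∈ (W.auditOracle l S ws x).support, ∃ e' ∈ o.support,
        e = (e'.1, Function.update ws b₀ e'.2) := fun e he => by
      rw [key] at he
      simpa only [PMF.mem_support_bind_iff, PMF.mem_support_pure_iff] using he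
    rw [hsim]
    refine ⟨fun e he => ?_, fun b ε => ?_⟩
    · obtain ⟨e', he', rfl⟩ := hsupp e he
      refine ⟨(hspec e' he').1, fun b => ?_⟩
      rw [Prod.sel_setSel]
      by_cases hb : b = b₀
      · subst hb; simpa using (hspec e' he').2
      · simpa [hb] using h b
    · rw [Prod.sel_setSel]
      by_cases hb : b = b₀
      · rw [if_pos hb]
        rcases hdist with ⟨h1, h2⟩ | ⟨t, ht, h1, h2⟩
        · refine ⟨[], by rw [h1, hb, List.append_nil], trivial_new b ε fun e he => ?_⟩
          obtain ⟨e', he', rfl⟩ := hsupp e he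
          subst hb; simp [h2 e' he']
        · rw [h1, hb]
          refine ⟨_, rfl, ?_⟩
          have e1 : (W.auditOracle l S ws x).map (fun e => (e.2 b₀).received ε) =
              (o.map fun e => e.2.received).map fun r => r ε := by
            rw [key, PMF.map_bind, PMF.map_comp]
            simp only [PMF.pure_map, Function.update_self]
            rfl
          rw [e1, h2, PMF.map_comp]
          by_cases hε : x.snd.snd.fst.toNat = ε
          · subst hε
            simp only [if_true, sampleList, PMF.pure_map, PMF.map_bind]
            simp only [PMF.map, Function.comp_def, Function.update_self]
          · rw [if_neg hε, sampleList, PMF.pure_map, List.append_nil]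
            exact PMF.map_eq_pure_of_support fun y _ => by simp [Ne.symm hε]
      · rw [if_neg hb]
        refine ⟨[], by rw [List.append_nil], trivial_new b ε fun e he => ?_⟩
        obtain ⟨e', he', rfl⟩ := hsupp e he
        simp [hb]
  · have key : W.auditOracle l S ws x = PMF.pure (.num 0, ws) := by
      simp only [auditOracle, AuditQuery.decode, hx]; rfl
    have hsim : simStep (W.maxHouseholds l) as x = (.num 0, as) := by
      simp [simStep, hx]
    have hsupp : ∀ e ∈ (W.auditOracle l S ws x).support, e = (.num 0, ws) := fun e he => by
      rw [key] at he
      simpa only [PMF.mem_support_pure_iff] using he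
    rw [hsim]
    refine ⟨fun e he => ?_, fun b ε =>
      ⟨[], by rw [List.append_nil], trivial_new b ε fun e he => ?_⟩⟩
    · rw [hsupp e he]; exact ⟨rfl, h⟩
    · rw [hsupp e he]

/-- Since answers and the relation to the simulated state are certain on the support, the next query
does not depend on earlier samples. The increments of successive rounds are then independent and
join to a single `sampleList`. -/
lemma interact_spec (hS : W.ValidSetup l S) (A : OracleAlg) (ρ : ℕ) (input : Data) (n : ℕ) :
    ∀ (answers : Data) (ws : Bool → W.World) (as : SimWorld × SimWorld),
    (∀ b, W.WorldRel l S (ws b) (as.sel b)) → (∀ b, (as.sel b).Valid (W.maxHouseholds l)) →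
    (∀ e ∈ (A.interact (W.auditOracle l S) l ρ input n answers ws).support,
      e.1 = ((simRound A (W.maxHouseholds l) l ρ input)^[n] (answers, as)).1 ∧
      ∀ b, W.WorldRel l S (e.2 b)
        (((simRound A (W.maxHouseholds l) l ρ input)^[n] (answers, as)).2.sel b)) ∧
    ∀ b ε, ∃ new, (((simRound A (W.maxHouseholds l) l ρ input)^[n]
          (answers, as)).2.sel b).transactions ε = (as.sel b).transactions ε ++ new ∧
      (A.interact (W.auditOracle l S) l ρ input n answers ws).map (fun e => (e.2 b).received ε) =
        (W.sampleList l S new).map fun xs => (ws b).received ε ++ xs := by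
  induction n with
  | zero =>
    intro answers ws as h ha
    simp only [OracleAlg.interact, PMF.monad_pure_eq, PMF.mem_support_pure_iff,
      Function.iterate_zero, id_eq]
    refine ⟨?_, fun b ε => ⟨[], by rw [List.append_nil], ?_⟩⟩
    · rintro e rfl; exact ⟨rfl, h⟩
    · rw [PMF.pure_map, sampleList, PMF.pure_map, List.append_nil]
  | succ n ih =>
    intro answers ws as h ha
    set x := A.query (view l ρ input answers) with hx
    obtain ⟨h1, h2⟩ := auditOracle_spec hS h ha x
    have key : A.interact (W.auditOracle l S) l ρ input (n + 1) answers ws =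
        (W.auditOracle l S ws x).bind fun a =>
          A.interact (W.auditOracle l S) l ρ input n (.pair a.1 answers) a.2 := rfl
    have hround : simRound A (W.maxHouseholds l) l ρ input (answers, as) =
        (.pair (simStep (W.maxHouseholds l) as x).1 answers,
          (simStep (W.maxHouseholds l) as x).2) := rfl
    have hv := simStep_valid ha x
    rw [Function.iterate_succ_apply, hround]
    have hih := fun e he => ih (.pair (simStep (W.maxHouseholds l) as x).1 answers) e.2 _
      (h1 e he).2 hv
    refine ⟨fun e he => ?_, fun b ε => ?_⟩
    · rw [key] at he
      simp only [PMF.mem_support_bind_iff] at he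
      obtain ⟨a, ha', he⟩ := he
      rw [(h1 a ha').1] at he
      exact (hih a ha').1 e he
    · obtain ⟨new, hnew, hdist⟩ := h2 b ε
      -- Any outcome serves to name the later transactions `new'`: they are read off the simulation,
      -- so cancelling the common prefix shows that every other outcome yields the same list.
      obtain ⟨a₀, ha₀⟩ := (W.auditOracle l S ws x).support_nonempty
      obtain ⟨new', hnew', -⟩ := (hih a₀ ha₀).2 b ε
      refine ⟨new ++ new', by rw [hnew', hnew, List.append_assoc], ?_⟩
      rw [key, PMF.map_bind]
      have : ∀ e ∈ (W.auditOracle l S ws x).support,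
          (A.interact (W.auditOracle l S) l ρ input n (.pair e.1 answers) e.2).map
            (fun e => (e.2 b).received ε) =
          (W.sampleList l S new').map fun xs => (e.2 b).received ε ++ xs := fun e he => by
        obtain ⟨new'', hnew'', hd⟩ := (hih e he).2 b ε
        rw [hnew', List.append_cancel_left_eq] at hnew''
        rw [(h1 e he).1, hd, ← hnew'']
      rw [PMF.bind_congr_support this]
      have e2 : ((W.auditOracle l S ws x).bind fun e =>
          (W.sampleList l S new').map fun xs => (e.2 b).received ε ++ xs) =
          ((W.auditOracle l S ws x).map fun e => (e.2 b).received ε).bind fun r =>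
            (W.sampleList l S new').map fun xs => r ++ xs := by
        rw [PMF.bind_map]; rfl
      rw [e2, hdist, sampleList_append, PMF.bind_map, PMF.map_bind]
      simp only [Function.comp_def, PMF.map_comp, List.append_assoc]

end WalletSystem

/-! ## The reduction to the pseudorandom function -/

namespace WalletSystem

variable (W : WalletSystem) (A : AuditAdversary)

lemma feasible_maxHouseholds : Feasible fun l : Unary => W.maxHouseholds l.val := by
  obtain ⟨f, hf, h⟩ := W.maxHouseholds_poly
  have hf' : Feasible f := hf
  have : Feasible fun l : Unary => (⟨W.maxHouseholds l.val⟩ : Unary) :=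
    hf'.of_rep_eq (fun l : Unary => Data.unary l.val) (fun _ => rfl) fun l => (h l.val).symm
  exact this.unaryVal

section definitions

variable (l ρ : ℕ) (P s : Data)

/-- The simulated interaction under the public parameters `P` and the signature keys `s`, with
coins `ρ` of the adversary. -/
def auditSim : Data × SimWorld × SimWorld :=
  simRun A.toOracleAlg (W.maxHouseholds l) l ρ (.pair P s.snd)

def auditView : Data := view l ρ (.pair P s.snd) (W.auditSim A l ρ P s).1

def auditPeriod : ℕ := (A.period (W.auditView A l ρ P s)).toNat

/-- The transactions of world `b` in the challenge period. -/
def challenge (b : Bool) : List SimTrans :=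
  ((W.auditSim A l ρ P s).2.sel b).transactions (W.auditPeriod A l ρ P s)

/-- The two reclaim proofs are incomparable. -/
def Mismatch : Prop :=
  ((W.challenge A l ρ P s false).map SimTrans.price).sum ≠
      ((W.challenge A l ρ P s true).map SimTrans.price).sum ∨
    (W.challenge A l ρ P s false).length ≠ (W.challenge A l ρ P s true).length

instance : Decidable (W.Mismatch A l ρ P s) := inferInstanceAs (Decidable (_ ∨ _))

/-- The commitment, as computed by the commitment algorithm. -/
def commitAlg (m r : ℕ) : Data := W.com.commitFn (.pair (.unary l) (.ofList [P, .num m, .num r]))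

/-- The transaction `t` in period `ε`, with tag, commitment randomness and signing coins `z`. -/
def mkTrans (ε : ℕ) (z : SimTrans × ℕ × ℕ × ℕ) : ℕ × TransProof :=
  (z.1.price, ⟨W.ds.signAlg.fn (.pair (.unary l) (.pair (.num z.2.2.2) (.pair s.fst
      (signedMessage z.2.1 ε (W.commitAlg l P z.1.price z.2.2.1))))),
    z.2.1, W.commitAlg l P z.1.price z.2.2.1, z.2.2.1⟩)

/-- The transactions `T` with tags `τs`, commitment randomness `rs` and signing coins `ρs`. -/
def mkTransList (ε : ℕ) (T : List SimTrans) (τs rs ρs : List ℕ) : List (ℕ × TransProof) :=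
  (T.zip (τs.zip (rs.zip ρs))).map (W.mkTrans l P s ε)

/-- The output of the experiment, as a function of everything that is sampled. -/
def auditOutput (b : Bool) (τs rs ρs : List ℕ) : Bool :=
  if W.Mismatch A l ρ P s then false
  else (A.guess (.pair (W.auditView A l ρ P s) (W.createReclaimProof P
    (W.mkTransList l P s (W.auditPeriod A l ρ P s) (W.challenge A l ρ P s b) τs rs ρs)).2.toData)
    ).toBool

end definitions

/-- A query logs at most one transaction, so `A.rounds` queries of the distinguisher suffice for all
tags. -/
lemma challenge_length_le (l ρ : ℕ) (P s : Data) (b : Bool) :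
    (W.challenge A l ρ P s b).length ≤ A.rounds.eval l := by
  have := (simRun_bounded A.toOracleAlg (W.maxHouseholds l) l ρ (.pair P s.snd) b).log_length
  rw [challenge, SimWorld.transactions, List.length_reverse]
  exact (List.length_filter_le _ _).trans this

lemma challenge_bounded (l ρ : ℕ) (P s : Data) (b : Bool) :
    ∀ t ∈ W.challenge A l ρ P s b, t.id ≤ A.rounds.eval l ∧ t.ctr ≤ A.rounds.eval l := by
  intro t ht
  have := (simRun_bounded A.toOracleAlg (W.maxHouseholds l) l ρ (.pair P s.snd) b).log t
    (List.mem_filter.1 (List.mem_reverse.1 ht)).1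
  exact this.2.2

lemma challenge_period (l ρ : ℕ) (P s : Data) (b : Bool) :
    ∀ t ∈ W.challenge A l ρ P s b, t.period = W.auditPeriod A l ρ P s := by
  intro t ht
  simpa using (List.mem_filter.1 (List.mem_reverse.1 ht)).2

/-- The argument of the pseudorandom function for a transaction. -/
def prfInput (t : SimTrans) : Data := .pair (.num t.id) (.num t.ctr)

/-- Distinctness of the PRF arguments is what turns the answers of a random function into
independent samples. -/
lemma nodup_challenge (l ρ : ℕ) (P s : Data) (b : Bool) :
    ((W.challenge A l ρ P s b).map prfInput).Nodup := by
  have h : (((W.challenge A l ρ P s b).map fun t => (t.id, t.ctr)).map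
      fun p : ℕ × ℕ => Data.pair (.num p.1) (.num p.2)).Nodup := by
    refine List.Nodup.map (fun p q h => ?_)
      ((simRound_iterate_valid A.toOracleAlg (W.maxHouseholds l) l ρ (.pair P s.snd) _
        b).nodup_transactions _)
    simpa [Prod.ext_iff] using h
  rwa [List.map_map] at h

end WalletSystem

namespace Feasible

variable {γ : Type} [DataRep γ] (W : WalletSystem) (A : WalletSystem.AuditAdversary)
  {l : γ → Unary} {ρ : γ → ℕ} {P s : γ → Data} {τs rs ρs : γ → List ℕ}

lemma auditSim (hl : Feasible l) (hρ : Feasible ρ) (hP : Feasible P) (hs : Feasible s) :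
    Feasible fun c => W.auditSim A (l c).val (ρ c) (P c) (s c) :=
  simRun A.toOracleAlg W.feasible_maxHouseholds hl hρ (hP.dataPair hs.dataSnd)

lemma auditView (hl : Feasible l) (hρ : Feasible ρ) (hP : Feasible P) (hs : Feasible s) :
    Feasible fun c => W.auditView A (l c).val (ρ c) (P c) (s c) :=
  view hl hρ (hP.dataPair hs.dataSnd) (auditSim W A hl hρ hP hs).fst

lemma auditPeriod (hl : Feasible l) (hρ : Feasible ρ) (hP : Feasible P) (hs : Feasible s) :
    Feasible fun c => W.auditPeriod A (l c).val (ρ c) (P c) (s c) :=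
  have h : Feasible A.period := A.period_poly
  (h.comp (auditView W A hl hρ hP hs)).dataToNat

lemma challenge (b : Bool) (hl : Feasible l) (hρ : Feasible ρ) (hP : Feasible P)
    (hs : Feasible s) : Feasible fun c => W.challenge A (l c).val (ρ c) (P c) (s c) b :=
  ((auditSim W A hl hρ hP hs).snd.sel (const b)).transactions (auditPeriod W A hl hρ hP hs)

lemma mismatch (hl : Feasible l) (hρ : Feasible ρ) (hP : Feasible P) (hs : Feasible s) :
    Feasible fun c => decide (W.Mismatch A (l c).val (ρ c) (P c) (s c)) := by
  have h := fun b => challenge W A b hl hρ hP hs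
  have hsum := fun b => (map (g := fun _ t => SimTrans.price t) id.snd.trans_price (h b)).sum
  refine (decide_or (decide_not ((hsum false).decide_eq (hsum true)))
    (decide_not ((h false).length.decide_eq (h true).length))).of_eq fun c => ?_
  rw [Bool.eq_iff_iff, decide_eq_true_eq, decide_eq_true_eq]
  exact Iff.rfl

lemma commitAlg {m r : γ → ℕ} (hl : Feasible l) (hP : Feasible P) (hm : Feasible m)
    (hr : Feasible r) : Feasible fun c => W.commitAlg (l c).val (P c) (m c) (r c) :=
  have h : Feasible W.com.commitFn := W.com.commit_poly
  h.comp (hl.dataUnary.dataPair (hP.cons (hm.dataNum.cons (hr.dataNum.cons nil))).dataOfList)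

lemma reclaimProofData (hl : Feasible l) (hP : Feasible P) (hs : Feasible s) {ε : γ → ℕ}
    {T : γ → List SimTrans} (hε : Feasible ε) (hT : Feasible T) (hτ : Feasible τs)
    (hr : Feasible rs) (hρ : Feasible ρs) :
    Feasible fun c => (W.createReclaimProof (P c) (W.mkTransList (l c).val (P c) (s c) (ε c) (T c)
      (τs c) (rs c) (ρs c))).2.toData := by
  have hz : Feasible fun c => (T c).zip ((τs c).zip ((rs c).zip (ρs c))) :=
    hT.zip (hτ.zip (hr.zip hρ))
  have hcom : Feasible fun p : γ × SimTrans × ℕ × ℕ × ℕ =>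
      W.commitAlg (l p.1).val (P p.1) p.2.1.price p.2.2.2.1 :=
    commitAlg W (hl.comp id.fst) (hP.comp id.fst) id.snd.fst.trans_price id.snd.snd.snd.fst
  have hsign : Feasible W.ds.signAlg.fn := W.ds.signAlg.poly
  have hsig : Feasible fun p : γ × SimTrans × ℕ × ℕ × ℕ =>
      W.ds.signAlg.fn (.pair (.unary (l p.1).val) (.pair (.num p.2.2.2.2) (.pair (s p.1).fst
        (WalletSystem.signedMessage p.2.2.1 (ε p.1)
          (W.commitAlg (l p.1).val (P p.1) p.2.1.price p.2.2.2.1))))) :=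
    hsign.comp ((hl.comp id.fst).dataUnary.dataPair (id.snd.snd.snd.snd.dataNum.dataPair
      ((hs.comp id.fst).dataFst.dataPair (id.snd.snd.fst.dataNum.cons
        ((hε.comp id.fst).dataNum.cons (hcom.cons nil))).dataOfList)))
  have hsum : Feasible fun c => (((T c).zip ((τs c).zip ((rs c).zip (ρs c)))).map
      fun z => z.2.2.1).sum % (P c).snd.fst.toNat :=
    (map (g := fun _ (z : SimTrans × ℕ × ℕ × ℕ) => z.2.2.1) id.snd.snd.snd.fst hz).sum.mod
      hP.dataSnd.dataFst.dataToNat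
  refine (hsum.dataNum.dataPair (map (g := fun c (z : SimTrans × ℕ × ℕ × ℕ) => Data.ofList
    [W.ds.signAlg.fn (.pair (.unary (l c).val) (.pair (.num z.2.2.2) (.pair (s c).fst
        (WalletSystem.signedMessage z.2.1 (ε c)
          (W.commitAlg (l c).val (P c) z.1.price z.2.2.1))))), .num z.2.1,
      W.commitAlg (l c).val (P c) z.1.price z.2.2.1]) (hsig.cons (id.snd.snd.fst.dataNum.cons (hcom.cons
    nil))).dataOfList hz).dataOfList).of_eq fun c => ?_
  simp only [WalletSystem.createReclaimProof, WalletSystem.mkTransList,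
    WalletSystem.ReclaimProof.toData, List.map_map]
  rfl

lemma auditOutput (b : Bool) (hl : Feasible l) (hρ : Feasible ρ) (hP : Feasible P)
    (hs : Feasible s) (hτ : Feasible τs) (hr : Feasible rs) (hρs : Feasible ρs) :
    Feasible fun c =>
      W.auditOutput A (l c).val (ρ c) (P c) (s c) b (τs c) (rs c) (ρs c) :=
  have h : Feasible A.guess := A.guess_poly
  ite (mismatch W A hl hρ hP hs) (const false) (h.comp ((auditView W A hl hρ hP hs).dataPair
    (reclaimProofData W hl hP hs (auditPeriod W A hl hρ hP hs) (challenge W A b hl hρ hP hs) hτ hr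
      hρs))).dataToBool

end Feasible

/-! ### Cutting the coins of the distinguisher -/

namespace WalletSystem

variable (W : WalletSystem) (A : AuditAdversary)

section coins

variable (l ρ : ℕ)

/-- The deterministic part of `RandAlg.run`. -/
def _root_.RandAlg.runWith (G : RandAlg) (l : ℕ) (x : Data) (ρ : ℕ) : Data :=
  G.fn (.pair (.unary l) (.pair (.num ρ) x))

/-- The coins `ρ` of the reduction are cut into the coins for the parameters, for the signature
keys, for the adversary, for the signatures, and for the commitments. -/
def redParams : Data := W.com.gen.runWith l (.num 0) (ρ % 2 ^ W.com.gen.coins.eval l)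

def coinsAfterParams : ℕ := ρ / 2 ^ W.com.gen.coins.eval l

def redKeys : Data :=
  W.ds.kgen.runWith l (.num 0) (W.coinsAfterParams l ρ % 2 ^ W.ds.kgen.coins.eval l)

def coinsAfterKeys : ℕ := W.coinsAfterParams l ρ / 2 ^ W.ds.kgen.coins.eval l

def redAdvCoins : ℕ := W.coinsAfterKeys l ρ % 2 ^ A.coins.eval l

def coinsAfterAdv : ℕ := W.coinsAfterKeys l ρ / 2 ^ A.coins.eval l

def redSignCoins : List ℕ :=
  lowDigits (2 ^ W.ds.signAlg.coins.eval l) (A.rounds.eval l)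
    (W.coinsAfterAdv A l ρ % 2 ^ (W.ds.signAlg.coins.eval l * A.rounds.eval l))

def redRandomness : List ℕ :=
  lowDigits (W.com.order (W.redParams l ρ)) (A.rounds.eval l)
    (W.coinsAfterAdv A l ρ / 2 ^ (W.ds.signAlg.coins.eval l * A.rounds.eval l))

def redChallenge (b : Bool) : List SimTrans :=
  W.challenge A l (W.redAdvCoins A l ρ) (W.redParams l ρ) (W.redKeys l ρ) b

end coins

end WalletSystem

namespace Feasible

variable {γ : Type} [DataRep γ] (W : WalletSystem) (A : WalletSystem.AuditAdversary)
  {l : γ → Unary} {ρ : γ → ℕ}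

lemma runWith (G : RandAlg) {x : γ → Data} (hl : Feasible l) (hx : Feasible x)
    (hρ : Feasible ρ) : Feasible fun c => G.runWith (l c).val (x c) (ρ c) :=
  have h : Feasible G.fn := G.poly
  h.comp (hl.dataUnary.dataPair (hρ.dataNum.dataPair hx))

lemma two_pow_eval (p : Polynomial ℕ) (hl : Feasible l) : Feasible fun c => 2 ^ p.eval (l c).val :=
  (hl.unary_eval p).two_pow

lemma redParams (hl : Feasible l) (hρ : Feasible ρ) :
    Feasible fun c => W.redParams (l c).val (ρ c) :=
  runWith _ hl (const _) (hρ.mod (two_pow_eval _ hl))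

lemma coinsAfterParams (hl : Feasible l) (hρ : Feasible ρ) :
    Feasible fun c => W.coinsAfterParams (l c).val (ρ c) := hρ.div (two_pow_eval _ hl)

lemma redKeys (hl : Feasible l) (hρ : Feasible ρ) :
    Feasible fun c => W.redKeys (l c).val (ρ c) :=
  runWith _ hl (const _) ((coinsAfterParams W hl hρ).mod (two_pow_eval _ hl))

lemma coinsAfterKeys (hl : Feasible l) (hρ : Feasible ρ) :
    Feasible fun c => W.coinsAfterKeys (l c).val (ρ c) := (coinsAfterParams W hl hρ).div (two_pow_eval _ hl)

lemma redAdvCoins (hl : Feasible l) (hρ : Feasible ρ) :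
    Feasible fun c => W.redAdvCoins A (l c).val (ρ c) :=
  (coinsAfterKeys W hl hρ).mod (two_pow_eval _ hl)

lemma coinsAfterAdv (hl : Feasible l) (hρ : Feasible ρ) :
    Feasible fun c => W.coinsAfterAdv A (l c).val (ρ c) := (coinsAfterKeys W hl hρ).div (two_pow_eval _ hl)

lemma redSignCoins (hl : Feasible l) (hρ : Feasible ρ) :
    Feasible fun c => W.redSignCoins A (l c).val (ρ c) :=
  lowDigits (two_pow_eval _ hl) (hl.unary_eval A.rounds) ((coinsAfterAdv W A hl hρ).mod
    ((hl.unary_eval _).unary_mul (hl.unary_eval _)).two_pow)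

lemma redRandomness (hl : Feasible l) (hρ : Feasible ρ) :
    Feasible fun c => W.redRandomness A (l c).val (ρ c) :=
  lowDigits (redParams W hl hρ).dataSnd.dataFst.dataToNat (hl.unary_eval A.rounds)
    ((coinsAfterAdv W A hl hρ).div ((hl.unary_eval _).unary_mul (hl.unary_eval _)).two_pow)

lemma redChallenge (b : Bool) (hl : Feasible l) (hρ : Feasible ρ) :
    Feasible fun c => W.redChallenge A (l c).val (ρ c) b :=
  challenge W A b hl (redAdvCoins W A hl hρ) (redParams W hl hρ) (redKeys W hl hρ)

end Feasible

namespace WalletSystem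

/-- The distinguisher simulates the experiment in world `b`, asking its oracle for the tags of the
challenge transactions.  The polynomial `Z` bounds the size of the public parameters. -/
noncomputable def reduction (W : WalletSystem) (A : AuditAdversary) (b : Bool) (Z : Polynomial ℕ) :
    Distinguisher where
  -- The last block serves for the commitments: `Z` bits for each of `A.rounds` digits to a base `q
  -- < 2 ^ Z`, and `l` further bits that bring the deviation from uniformity down to `2 ^ (-l)`.
  coins := W.com.gen.coins + (W.ds.kgen.coins + (A.coins + (W.ds.signAlg.coins * A.rounds +
    (A.rounds * Z + .X))))
  rounds := A.rounds
  bound := 2 * A.rounds + 3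
  -- The simulation is replayed in every round, and the number of answers so far is the index of the
  -- next tag to ask for. Once the tags are exhausted, the dummy query `0` fills the remaining
  -- rounds.
  query x := (((W.redChallenge A x.fst.length x.snd.fst.toNat b).map prfInput).drop
    x.snd.snd.snd.toList.length).headD (.num 0)
  query_poly := by
    refine feasible_iff_polyTime.1 ((Feasible.drop_length (Feasible.map
      (g := fun (_ : Data) t => prfInput t) ?_ (Feasible.redChallenge W A b
      Feasible.id.dataFst.dataLength Feasible.id.dataSnd.dataFst.dataToNat))
      Feasible.id.dataSnd.dataSnd.dataSnd.dataToList).headD (Feasible.const _))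
    exact Feasible.id.snd.trans_id.dataNum.dataPair Feasible.id.snd.trans_ctr.dataNum
  query_size l ρ input answers := by
    simp only [Polynomial.eval_add, Polynomial.eval_mul, Polynomial.eval_ofNat]
    rw [List.headD_eq_head?_getD]
    cases h : (((W.redChallenge A (view l ρ input answers).fst.length
        (view l ρ input answers).snd.fst.toNat b).map prfInput).drop
        (view l ρ input answers).snd.snd.snd.toList.length).head? with
    | none => simp [Data.size]
    | some y =>
      have hl : (view l ρ input answers).fst.length = l := Data.length_unary l
      rw [hl] at h
      obtain ⟨t, ht, rfl⟩ := List.mem_map.1 (List.mem_of_mem_drop (List.mem_of_mem_head? h))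
      have h1 := W.challenge_bounded A _ _ _ _ b t ht
      have h2 := t.id.size_le_self
      have h3 := t.ctr.size_le_self
      simp only [Option.getD_some, prfInput, Data.size]
      omega
  -- Answers are stored most recent first, hence the reversal. Answers to dummy queries then stand
  -- at the end, where `zip` ignores them.
  output x := .ofBool (W.auditOutput A x.fst.length (W.redAdvCoins A x.fst.length x.snd.fst.toNat)
    (W.redParams x.fst.length x.snd.fst.toNat) (W.redKeys x.fst.length x.snd.fst.toNat) b
    (x.snd.snd.snd.toList.reverse.map Data.toNat)
    (W.redRandomness A x.fst.length x.snd.fst.toNat)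
    (W.redSignCoins A x.fst.length x.snd.fst.toNat))
  output_poly := by
    have hl : Feasible fun x : Data => (⟨x.fst.length⟩ : Unary) := Feasible.id.dataFst.dataLength
    have hρ : Feasible fun x : Data => x.snd.fst.toNat := Feasible.id.dataSnd.dataFst.dataToNat
    have h := Feasible.auditOutput W A b hl (Feasible.redAdvCoins W A hl hρ)
      (Feasible.redParams W hl hρ) (Feasible.redKeys W hl hρ)
      (Feasible.map (g := fun (_ : Data) (y : Data) => y.toNat) Feasible.id.snd.dataToNat
        Feasible.id.dataSnd.dataSnd.dataSnd.dataToList.reverse)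
      (Feasible.redRandomness W A hl hρ) (Feasible.redSignCoins W A hl hρ)
    exact feasible_iff_polyTime.1 (h.of_rep_eq (fun x => x) (fun _ => rfl) fun _ => rfl)

end WalletSystem

/-! ### Hybrid experiments -/

namespace WalletSystem

variable (W : WalletSystem) (A : AuditAdversary)

/-- The experiment with deferred sampling: `tags` samples the tags of the challenge transactions,
and `rand q` the commitment randomness for groups of order `q`. -/
noncomputable def game (b : Bool) (l : ℕ) (tags : List SimTrans → PMF (List ℕ))
    (rand : ℕ → PMF (List ℕ)) : PMF Bool :=
  (W.com.gen.run l (.num 0)).bind fun P => (W.ds.kgen.run l (.num 0)).bind fun s =>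
  (uniformBits (A.coins.eval l)).bind fun ρ =>
  ((uniformBits (W.ds.signAlg.coins.eval l)).iid (A.rounds.eval l)).bind fun ρs =>
  (rand (W.com.order P)).bind fun rs =>
  (tags (W.challenge A l ρ P s b)).map fun τs => W.auditOutput A l ρ P s b τs rs ρs

/-- The tags computed with the key `k`. -/
noncomputable def prfTags (l : ℕ) (k : Data) (T : List SimTrans) : PMF (List ℕ) :=
  PMF.pure (T.map fun t => W.prf.eval l k (prfInput t))

/-- Independent uniformly random tags. -/
noncomputable def uniformTags (l : ℕ) (T : List SimTrans) : PMF (List ℕ) :=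
  (uniformBits (W.prf.outLen.eval l)).iid T.length

/-- The exact distribution of the commitment randomness. -/
noncomputable def exactRand (l q : ℕ) : PMF (List ℕ) := (uniformBelow q).iid (A.rounds.eval l)

/-- The commitment randomness sampled by the reduction. -/
noncomputable def redRand (Z : Polynomial ℕ) (l q : ℕ) : PMF (List ℕ) :=
  (uniformBits (A.rounds.eval l * Z.eval l + l)).map (lowDigits q (A.rounds.eval l))

variable {W A}

lemma exists_order {l : ℕ} {P : Data} (hP : P ∈ (W.com.gen.run l (.num 0)).support) :
    (W.com.order P).Prime ∧ Nat.card (W.com.Grp P) = W.com.order P ∧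
    (∀ x : W.com.Grp P, x ∈ Subgroup.zpowers (W.com.h P)) ∧
    ∀ m r, W.commitAlg l P m r = W.com.commit P m r := by
  obtain ⟨descr, q, hPq, hq, hcard, -, hh, -, hcom⟩ := W.com.params l P hP
  have : W.com.order P = q := by rw [Pedersen.order, hPq]; rfl
  rw [this]
  exact ⟨hq, hcard, hh, hcom⟩

/-! ### The real experiment -/

/-- Signing coins and commitment randomness may be drawn in advance, in batches of a fixed length
`R`; surplus entries are cut off by `zip`. A fixed length is needed because the distinguisher cuts
its coins independently of the number of transactions. -/
lemma sampleList_eq {l : ℕ} {S : W.Setup} {s : Data} (hS : S.skRS = s.fst)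
    (hP : S.params ∈ (W.com.gen.run l (.num 0)).support) {ε : ℕ} (T : List SimTrans) :
    ∀ R, T.length ≤ R → (∀ t ∈ T, t.period = ε) → W.sampleList l S T =
      ((uniformBits (W.ds.signAlg.coins.eval l)).iid R).bind fun ρs =>
        ((uniformBelow (W.com.order S.params)).iid R).map fun rs =>
          W.mkTransList l S.params s ε T
            (T.map fun t => W.prf.eval l S.prfKey (prfInput t)) rs ρs := by
  induction T with
  | nil =>
    intro R _ _
    simp only [sampleList, mkTransList, List.zip_nil_left, List.map_nil]
    exact ((congrArg _ (funext fun _ => PMF.map_const _ _)).trans (PMF.bind_const _ _)).symm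
  | cons t T ih =>
    intro R hR hT
    obtain ⟨R, rfl⟩ : ∃ R', R = R' + 1 := ⟨R - 1, by simp at hR; omega⟩
    have hcom := (exists_order hP).2.2.2
    rw [sampleList, ih R (by simpa using hR) fun t ht => hT t (by simp [ht])]
    simp only [PMF.iid, sampleTrans, SignatureScheme.sign, RandAlg.run, PMF.map_bind, PMF.bind_bind,
      PMF.bind_map, PMF.map_comp, Function.comp_def, List.map_cons]
    -- On the left each transaction has its own draws, on the right all signing coins precede all
    -- randomness; independent draws commute.
    have hswap : ∀ ρ₀ : ℕ, (((uniformBits (W.ds.signAlg.coins.eval l)).iid R).bind fun ρs =>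
        (uniformBelow (W.com.order S.params)).bind fun r =>
        ((uniformBelow (W.com.order S.params)).iid R).map fun rs =>
          W.mkTransList l S.params s ε (t :: T) (W.prf.eval l S.prfKey (prfInput t) ::
            T.map fun t => W.prf.eval l S.prfKey (prfInput t)) (r :: rs) (ρ₀ :: ρs)) =
        (uniformBelow (W.com.order S.params)).bind fun r =>
        ((uniformBits (W.ds.signAlg.coins.eval l)).iid R).bind fun ρs =>
        ((uniformBelow (W.com.order S.params)).iid R).map fun rs =>
          W.mkTransList l S.params s ε (t :: T) (W.prf.eval l S.prfKey (prfInput t) ::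
            T.map fun t => W.prf.eval l S.prfKey (prfInput t)) (r :: rs) (ρ₀ :: ρs) :=
      fun ρ₀ => PMF.bind_comm _ _ _
    simp only [hswap]
    rw [PMF.bind_comm]
    simp only [mkTransList, List.zip_cons_cons, List.map_cons, mkTrans, hcom, hS,
      hT t (by simp), prfInput]

/-- The view, the period and the abort test take their simulated values on the whole support, so the
only random quantity left in the continuation is the list of world `b`. -/
lemma interact_received {l : ℕ} {S : W.Setup} {s : Data}
    (hO : (S.oramKey, S.db) ∈ (W.oram.init l (W.maxHouseholds l)).support)
    (hs : s ∈ (W.ds.kgen.run l (.num 0)).support) (hsk : S.skRS = s.fst) (hpk : S.pkRS = s.snd)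
    (ρ : ℕ) (b : Bool) {β : Type} (F : Data → List (ℕ × TransProof) → PMF β) (G : PMF β) :
    ((A.interact (W.auditOracle l S) l ρ (.pair S.params S.pkRS) (A.rounds.eval l) (.num 0)
        (fun _ => ⟨S.db, 0, 0, fun _ => none, fun _ => []⟩)).bind fun e =>
      if ((W.createReclaimProof S.params ((e.2 false).received (A.period (view l ρ
            (.pair S.params S.pkRS) e.1)).toNat)).1 ≠
          (W.createReclaimProof S.params ((e.2 true).received (A.period (view l ρ
            (.pair S.params S.pkRS) e.1)).toNat)).1) ∨
        (W.createReclaimProof S.params ((e.2 false).received (A.period (view l ρ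
            (.pair S.params S.pkRS) e.1)).toNat)).2.entries.length ≠
          (W.createReclaimProof S.params ((e.2 true).received (A.period (view l ρ
            (.pair S.params S.pkRS) e.1)).toNat)).2.entries.length
      then G
      else F (view l ρ (.pair S.params S.pkRS) e.1) ((e.2 b).received (A.period (view l ρ (.pair S.params S.pkRS) e.1)).toNat)) =
    (W.sampleList l S (W.challenge A l ρ S.params s b)).bind fun xs =>
      if W.Mismatch A l ρ S.params s then G else F (W.auditView A l ρ S.params s) xs := by
  have hS : W.ValidSetup l S := ⟨s, hs, hsk, hpk⟩
  obtain ⟨h1, h2⟩ := interact_spec hS A.toOracleAlg ρ (.pair S.params S.pkRS) (A.rounds.eval l)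
    (.num 0) (fun _ => ⟨S.db, 0, 0, fun _ => none, fun _ => []⟩) (.empty, .empty)
    (fun b => by
      cases b <;> exact ⟨⟨_, .init hO, fun _ => rfl⟩, rfl, rfl, fun _ => rfl, fun _ => rfl⟩)
    (fun b => by cases b <;> exact SimWorld.valid_empty _)
  have hsim : (simRound A.toOracleAlg (W.maxHouseholds l) l ρ (.pair S.params S.pkRS))^[
      A.rounds.eval l] (.num 0, (.empty, .empty)) = W.auditSim A l ρ S.params s := by
    rw [hpk]; rfl
  rw [hsim] at h1 h2
  obtain ⟨new, hnew, hdist⟩ := h2 b (W.auditPeriod A l ρ S.params s)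
  have hnew' : new = W.challenge A l ρ S.params s b := by
    rw [challenge, hnew]; cases b <;> rfl
  subst hnew'
  have hdist' : (A.interact (W.auditOracle l S) l ρ (.pair S.params S.pkRS) (A.rounds.eval l)
      (.num 0) (fun _ => ⟨S.db, 0, 0, fun _ => none, fun _ => []⟩)).map
        (fun e => (e.2 b).received (W.auditPeriod A l ρ S.params s)) =
      W.sampleList l S (W.challenge A l ρ S.params s b) := hdist.trans (PMF.map_id _)
  rw [← hdist', PMF.bind_map]
  refine PMF.bind_congr_support fun e he => ?_
  obtain ⟨he1, he2⟩ := h1 e he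
  have hview : view l ρ (.pair S.params S.pkRS) e.1 = W.auditView A l ρ S.params s := by
    rw [he1, hpk]; rfl
  have hper : (A.period (W.auditView A l ρ S.params s)).toNat =
      W.auditPeriod A l ρ S.params s := rfl
  rw [hview, hper]
  have hrec := fun b' => (he2 b').received (W.auditPeriod A l ρ S.params s)
  have hsum : ∀ b', (W.createReclaimProof S.params
      ((e.2 b').received (W.auditPeriod A l ρ S.params s))).1 =
      ((W.challenge A l ρ S.params s b').map SimTrans.price).sum := fun b' =>
    congrArg List.sum (hrec b')
  have hlen : ∀ b', (W.createReclaimProof S.params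
      ((e.2 b').received (W.auditPeriod A l ρ S.params s))).2.entries.length =
      (W.challenge A l ρ S.params s b').length := fun b' => by
    have := congrArg List.length (hrec b')
    simpa [createReclaimProof, challenge] using this
  rw [hsum, hsum, hlen, hlen]
  rfl

/-- Abortion is merged with the guess `false`, which keeps the probability of guessing `true`. -/
lemma expAudit_eq_game (b : Bool) (l : ℕ) :
    (W.expAudit A b l).map (fun o => decide (o = some true)) =
      (W.prf.kgen.run l (.num 0)).bind fun k =>
        W.game A b l (W.prfTags l k) (exactRand A l) := by
  have hite : ∀ (c : Prop) [Decidable c] (x : Bool),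
      (if c then PMF.pure none else PMF.pure (some x)).map (fun o => decide (o = some true)) =
        if c then PMF.pure false else PMF.pure x := by
    intro c _ x
    split <;> simp [PMF.pure_map]
  have key : ∀ P ∈ (W.com.gen.run l (.num 0)).support,
      ∀ o ∈ (W.oram.init l (W.maxHouseholds l)).support, ∀ k,
      ∀ s ∈ (W.ds.kgen.run l (.num 0)).support, ∀ ρ : ℕ,
      (W.sampleList l ⟨P, o.1, k, o.2, s.fst, s.snd⟩ (W.challenge A l ρ P s b)).bind
        (fun xs => if W.Mismatch A l ρ P s then PMF.pure false else
          PMF.pure (A.guess (.pair (W.auditView A l ρ P s)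
            (W.createReclaimProof P xs).2.toData)).toBool) =
      ((uniformBits (W.ds.signAlg.coins.eval l)).iid (A.rounds.eval l)).bind fun ρs =>
        (exactRand A l (W.com.order P)).bind fun rs =>
        (W.prfTags l k (W.challenge A l ρ P s b)).map fun τs =>
          W.auditOutput A l ρ P s b τs rs ρs := by
    intro P hP o ho k s hs ρ
    rw [sampleList_eq (s := s) rfl hP _ _ (W.challenge_length_le A l ρ P s b)
      (W.challenge_period A l ρ P s b)]
    simp only [PMF.bind_bind, PMF.bind_map, prfTags, PMF.pure_map, exactRand, Function.comp_def,
      auditOutput]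
    congr! 5
    split <;> rfl
  simp only [expAudit, setup, OracleAlg.run, PMF.monad_bind_eq, PMF.monad_pure_eq, PMF.bind_bind,
    PMF.pure_bind, PMF.map_bind, hite, game]
  rw [PMF.bind_comm (W.prf.kgen.run l (.num 0))]
  refine PMF.bind_congr_support fun P hP => ?_
  -- The deferred experiment has no ORAM; an idle ORAM initialization is inserted there to match the
  -- setup of the real one.
  rw [← PMF.bind_const (W.oram.init l (W.maxHouseholds l))
    ((W.prf.kgen.run l (.num 0)).bind _)]
  refine PMF.bind_congr_support fun o ho => PMF.bind_congr_support fun k _ =>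
    PMF.bind_congr_support fun s hs => PMF.bind_congr_support fun ρ _ => ?_
  rw [← key P hP o ho k s hs ρ]
  rw [← interact_received (S := ⟨P, o.1, k, o.2, s.fst, s.snd⟩) ho hs rfl rfl ρ b
    (fun v xs => PMF.pure (A.guess (.pair v (W.createReclaimProof P xs).2.toData)).toBool)
    (PMF.pure false)]

/-! ### The runs of the reduction -/

lemma auditOutput_take (l ρ : ℕ) (P s : Data) (b : Bool) (τs rs ρs : List ℕ) :
    W.auditOutput A l ρ P s b (τs.take (W.challenge A l ρ P s b).length) rs ρs =
      W.auditOutput A l ρ P s b τs rs ρs := by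
  have : ∀ (T : List SimTrans) (τs : List ℕ) (z : List (ℕ × ℕ)),
      T.zip ((τs.take T.length).zip z) = T.zip (τs.zip z) := by
    intro T
    induction T with
    | nil => simp
    | cons t T ih =>
      intro τs z
      cases τs with
      | nil => simp
      | cons τ τs =>
        cases z with
        | nil => simp
        | cons z zs => simp [ih]
  simp only [auditOutput, mkTransList, this]

/-- The queries are nonadaptive: the `i`-th is the `i`-th entry of `qs`, whatever the answers were.
Truncation to `qs.length` discards the answers to dummy queries. -/
lemma interact_function (B : OracleAlg) (f : Data → ℕ) {l ρ : ℕ} {input d : Data} {qs : List Data}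
    (hq : ∀ ans, B.query (view l ρ input ans) = (qs.drop ans.toList.length).headD d) (n : ℕ) :
    ∀ ans : Data, qs.length ≤ ans.toList.length + n →
      (B.interact (fun (_ : Unit) x => pure (.num (f x), ())) l ρ input n ans ()).map
        (fun e => (e.1.toList.reverse.map Data.toNat).take qs.length) =
      PMF.pure ((ans.toList.reverse.map Data.toNat ++
        (qs.drop ans.toList.length).map f).take qs.length) := by
  induction n with
  | zero =>
    intro ans hn
    rw [OracleAlg.interact, PMF.monad_pure_eq, PMF.pure_map, List.drop_eq_nil_of_le (by omega)]
    simp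
  | succ n ih =>
    intro ans hn
    simp only [OracleAlg.interact, PMF.monad_pure_eq, PMF.monad_bind_eq, PMF.pure_bind] at ih ⊢
    rw [ih _ (by simp only [Data.toList, List.length_cons]; omega), hq]
    congr 1
    simp only [Data.toList, List.length_cons]
    by_cases hlt : ans.toList.length < qs.length
    · rw [List.drop_eq_getElem_cons hlt, List.headD_cons, List.map_cons, List.reverse_cons,
        List.map_append, List.append_assoc]
      rfl
    · rw [List.drop_eq_nil_of_le (by omega), List.drop_eq_nil_of_le (by omega)]
      simp only [List.reverse_cons, List.map_append, List.map_nil, List.append_nil]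
      rw [List.take_append_of_le_length (by simp; omega)]

/-- Because `qs` has no repetitions, each query still to come is absent from the table and is
answered by a fresh sample. -/
lemma interact_randomFunction (B : OracleAlg) (m : ℕ) {l ρ : ℕ} {input d : Data} {qs : List Data}
    (hq : ∀ ans, B.query (view l ρ input ans) = (qs.drop ans.toList.length).headD d)
    (hqs : qs.Nodup) (n : ℕ) :
    ∀ (ans : Data) (t : Data → Option ℕ), qs.length ≤ ans.toList.length + n →
      (∀ x ∈ qs.drop ans.toList.length, t x = none) →
      (B.interact (randomFunction m) l ρ input n ans t).map
        (fun e => (e.1.toList.reverse.map Data.toNat).take qs.length) =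
      ((uniformBits m).iid (qs.length - ans.toList.length)).map fun ys =>
        (ans.toList.reverse.map Data.toNat ++ ys).take qs.length := by
  induction n with
  | zero =>
    intro ans t hn _
    rw [OracleAlg.interact, PMF.monad_pure_eq, PMF.pure_map,
      Nat.sub_eq_zero_of_le (by omega), PMF.iid, PMF.pure_map, List.append_nil]
  | succ n ih =>
    intro ans t hn ht
    simp only [OracleAlg.interact, PMF.monad_bind_eq, PMF.map_bind] at ih ⊢
    rw [hq]
    by_cases hlt : ans.toList.length < qs.length
    · have hdrop := List.drop_eq_getElem_cons hlt
      rw [hdrop] at ht ⊢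
      have hnone : t qs[ans.toList.length] = none := ht _ List.mem_cons_self
      have hfresh : qs[ans.toList.length] ∉ qs.drop (ans.toList.length + 1) := by
        have := hqs.sublist (List.drop_sublist ans.toList.length qs)
        rw [hdrop] at this
        exact (List.nodup_cons.1 this).1
      simp only [List.headD_cons, randomFunction, hnone, PMF.monad_bind_eq, PMF.monad_pure_eq,
        PMF.bind_bind, PMF.pure_bind]
      obtain ⟨j, hj⟩ : ∃ j, qs.length - ans.toList.length = j + 1 :=
        ⟨qs.length - ans.toList.length - 1, by omega⟩
      rw [hj, PMF.iid, PMF.map_bind]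
      congr 1
      funext y
      rw [ih]
      · have : qs.length - (Data.pair (.num y) ans).toList.length = j := by
          simp only [Data.toList, List.length_cons]; omega
        rw [this, PMF.map_comp]
        congr 1
        funext ys
        simp [Data.toList, Data.toNat]
      · simp only [Data.toList, List.length_cons]; omega
      · intro x hx
        simp only [Data.toList, List.length_cons] at hx
        rw [Function.update_of_ne]
        · exact ht x (List.mem_cons_of_mem _ hx)
        · rintro rfl; exact hfresh hx
    -- Only dummy queries remain. Their answers may be correlated with earlier ones, but truncation
    -- removes them.
    · have h0 : qs.length - ans.toList.length = 0 := by omega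
      have hnil : ∀ x : Data, qs.drop (Data.pair x ans).toList.length = [] := fun x =>
        List.drop_eq_nil_of_le (by simp only [Data.toList, List.length_cons]; omega)
      have hstep : ∀ (a : Data × (Data → Option ℕ)),
          (B.interact (randomFunction m) l ρ input n (.pair a.1 ans) a.2).map
            (fun e => (e.1.toList.reverse.map Data.toNat).take qs.length) =
          PMF.pure ((ans.toList.reverse.map Data.toNat).take qs.length) := fun a => by
        rw [ih _ _ (by simp only [Data.toList, List.length_cons]; omega)
          (by rw [hnil]; simp)]
        have : qs.length - (Data.pair a.1 ans).toList.length = 0 := by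
          simp only [Data.toList, List.length_cons]; omega
        rw [this, PMF.iid, PMF.pure_map]
        simp only [Data.toList, List.reverse_cons, List.map_append, List.append_nil]
        rw [List.take_append_of_le_length (by simp; omega)]
      simp only [hstep, PMF.bind_const]
      rw [h0, PMF.iid, PMF.pure_map, List.append_nil]

end WalletSystem

namespace WalletSystem

variable {W : WalletSystem} {A : AuditAdversary}

/-- Four applications of `uniformBits_add_bind` cut one random number into independent blocks. The
base `q` of the last block depends on the parameters drawn from the first, which independence
allows. -/
lemma uniformBits_bind_reduction (Z : Polynomial ℕ) (l : ℕ) {β : Type}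
    (H : Data → Data → ℕ → List ℕ → List ℕ → PMF β) (b : Bool) :
    ((uniformBits ((W.reduction A b Z).coins.eval l)).bind fun ρ =>
      H (W.redParams l ρ) (W.redKeys l ρ) (W.redAdvCoins A l ρ) (W.redSignCoins A l ρ)
        (W.redRandomness A l ρ)) =
    (W.com.gen.run l (.num 0)).bind fun P => (W.ds.kgen.run l (.num 0)).bind fun s =>
      (uniformBits (A.coins.eval l)).bind fun ρ =>
      ((uniformBits (W.ds.signAlg.coins.eval l)).iid (A.rounds.eval l)).bind fun ρs =>
      (redRand A Z l (W.com.order P)).bind fun rs => H P s ρ ρs rs := by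
  simp only [reduction, Polynomial.eval_add, Polynomial.eval_mul, Polynomial.eval_X, RandAlg.run,
    PMF.bind_map, Function.comp_def, ← uniformBits_map_lowDigits, redRand]
  refine (uniformBits_add_bind _ _ fun x y => H (W.com.gen.runWith l (.num 0) x)
    (W.ds.kgen.runWith l (.num 0) (y % 2 ^ W.ds.kgen.coins.eval l))
    (y / 2 ^ W.ds.kgen.coins.eval l % 2 ^ A.coins.eval l)
    (lowDigits (2 ^ W.ds.signAlg.coins.eval l) (A.rounds.eval l)
      (y / 2 ^ W.ds.kgen.coins.eval l / 2 ^ A.coins.eval l %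
        2 ^ (W.ds.signAlg.coins.eval l * A.rounds.eval l)))
    (lowDigits (W.com.order (W.com.gen.runWith l (.num 0) x)) (A.rounds.eval l)
      (y / 2 ^ W.ds.kgen.coins.eval l / 2 ^ A.coins.eval l /
        2 ^ (W.ds.signAlg.coins.eval l * A.rounds.eval l)))).trans ?_
  refine congrArg _ (funext fun ρP => ?_)
  refine (uniformBits_add_bind _ _ fun x y => H (W.com.gen.runWith l (.num 0) ρP)
    (W.ds.kgen.runWith l (.num 0) x) (y % 2 ^ A.coins.eval l)
    (lowDigits (2 ^ W.ds.signAlg.coins.eval l) (A.rounds.eval l)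
      (y / 2 ^ A.coins.eval l % 2 ^ (W.ds.signAlg.coins.eval l * A.rounds.eval l)))
    (lowDigits (W.com.order (W.com.gen.runWith l (.num 0) ρP)) (A.rounds.eval l)
      (y / 2 ^ A.coins.eval l / 2 ^ (W.ds.signAlg.coins.eval l * A.rounds.eval l)))).trans ?_
  refine congrArg _ (funext fun ρs => ?_)
  refine (uniformBits_add_bind _ _ fun x y => H (W.com.gen.runWith l (.num 0) ρP)
    (W.ds.kgen.runWith l (.num 0) ρs) x
    (lowDigits (2 ^ W.ds.signAlg.coins.eval l) (A.rounds.eval l)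
      (y % 2 ^ (W.ds.signAlg.coins.eval l * A.rounds.eval l)))
    (lowDigits (W.com.order (W.com.gen.runWith l (.num 0) ρP)) (A.rounds.eval l)
      (y / 2 ^ (W.ds.signAlg.coins.eval l * A.rounds.eval l)))).trans ?_
  refine congrArg _ (funext fun ρA => ?_)
  exact uniformBits_add_bind _ _ fun x y => H (W.com.gen.runWith l (.num 0) ρP)
    (W.ds.kgen.runWith l (.num 0) ρs) ρA
    (lowDigits (2 ^ W.ds.signAlg.coins.eval l) (A.rounds.eval l) x)
    (lowDigits (W.com.order (W.com.gen.runWith l (.num 0) ρP)) (A.rounds.eval l) y)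

lemma reduction_query (b : Bool) (Z : Polynomial ℕ) (l ρ : ℕ) (input ans : Data) :
    (W.reduction A b Z).query (view l ρ input ans) =
      (((W.redChallenge A l ρ b).map prfInput).drop ans.toList.length).headD (.num 0) := by
  have hl : (view l ρ input ans).fst.length = l := Data.length_unary l
  simp only [reduction, hl]
  rfl

lemma reduction_output (b : Bool) (Z : Polynomial ℕ) (l ρ : ℕ) (input ans : Data) :
    ((W.reduction A b Z).output (view l ρ input ans)).toBool =
      W.auditOutput A l (W.redAdvCoins A l ρ) (W.redParams l ρ) (W.redKeys l ρ) b
        ((ans.toList.reverse.map Data.toNat).take (W.redChallenge A l ρ b).length)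
        (W.redRandomness A l ρ) (W.redSignCoins A l ρ) := by
  have hl : (view l ρ input ans).fst.length = l := Data.length_unary l
  have hb : ∀ b : Bool, (Data.ofBool b).toBool = b := by decide
  rw [redChallenge, auditOutput_take]
  simp only [reduction, hl, hb]
  rfl

/-- Common to the real and the ideal oracle: only the law of the truncated answers, for each fixed
value of the coins, depends on the oracle. -/
lemma reduction_run (b : Bool) (Z : Polynomial ℕ) (l : ℕ) {σ : Type}
    (oracle : σ → Data → PMF (Data × σ)) (st : σ) (tags : List SimTrans → PMF (List ℕ))
    (h : ∀ ρ, ((W.reduction A b Z).interact oracle l ρ (.num 0) (A.rounds.eval l) (.num 0) st).map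
      (fun e => (e.1.toList.reverse.map Data.toNat).take (W.redChallenge A l ρ b).length) =
      tags (W.redChallenge A l ρ b)) :
    ((W.reduction A b Z).run oracle l (.num 0) st).bind
      (fun e => PMF.pure ((W.reduction A b Z).output e.1).toBool) =
    W.game A b l tags (redRand A Z l) := by
  have hrun : ((W.reduction A b Z).run oracle l (.num 0) st).bind
      (fun e => PMF.pure ((W.reduction A b Z).output e.1).toBool) =
      (uniformBits ((W.reduction A b Z).coins.eval l)).bind fun ρ =>
        (tags (W.redChallenge A l ρ b)).map fun τs =>
          W.auditOutput A l (W.redAdvCoins A l ρ) (W.redParams l ρ) (W.redKeys l ρ) b τs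
            (W.redRandomness A l ρ) (W.redSignCoins A l ρ) := by
    simp only [OracleAlg.run, PMF.monad_bind_eq, PMF.monad_pure_eq, PMF.bind_bind, PMF.pure_bind,
      reduction_output, ← h, PMF.map_comp]
    rfl
  rw [hrun]
  exact uniformBits_bind_reduction Z l (fun P s ρ ρs rs =>
    (tags (W.challenge A l ρ P s b)).map fun τs => W.auditOutput A l ρ P s b τs rs ρs) b

lemma expReal_reduction (b : Bool) (Z : Polynomial ℕ) (l : ℕ) :
    W.prf.expReal (W.reduction A b Z) l = (W.prf.kgen.run l (.num 0)).bind fun k =>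
      W.game A b l (W.prfTags l k) (redRand A Z l) := by
  refine congrArg (W.prf.kgen.run l (.num 0)).bind (funext fun k => ?_)
  refine reduction_run b Z l _ () (W.prfTags l k) fun ρ => ?_
  have := interact_function (W.reduction A b Z).toOracleAlg (W.prf.eval l k)
    (reduction_query (W := W) (A := A) b Z l ρ (.num 0)) (A.rounds.eval l) (.num 0) (by
      simpa [Data.toList, redChallenge] using W.challenge_length_le A l _ _ _ b)
  rw [List.length_map] at this
  rw [this, prfTags]
  simp only [Data.toList, List.length_nil, List.reverse_nil, List.map_nil, List.nil_append,
    List.drop_zero, List.map_map]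
  rw [List.take_of_length_le (by simp)]
  rfl

lemma expIdeal_reduction (b : Bool) (Z : Polynomial ℕ) (l : ℕ) :
    W.prf.expIdeal (W.reduction A b Z) l = W.game A b l (W.uniformTags l) (redRand A Z l) := by
  refine reduction_run b Z l _ _ (W.uniformTags l) fun ρ => ?_
  have := interact_randomFunction (W.reduction A b Z).toOracleAlg (W.prf.outLen.eval l)
    (reduction_query (W := W) (A := A) b Z l ρ (.num 0)) (W.nodup_challenge A l _ _ _ b)
    (A.rounds.eval l) (.num 0) (fun _ => none) (by
      simpa [Data.toList, redChallenge] using W.challenge_length_le A l _ _ _ b) (fun _ _ => rfl)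
  rw [List.length_map] at this
  rw [this, uniformTags]
  simp only [Data.toList, List.length_nil, Nat.sub_zero, List.reverse_nil, List.map_nil,
    List.nil_append]
  refine (PMF.bind_congr_support fun ys hys => ?_).trans (PMF.bind_pure _)
  rw [Function.comp_apply, List.take_of_length_le (PMF.length_of_mem_support_iid hys).le]

/-! ### Statistical distance -/

/-- The two experiments differ only in how the commitment randomness is drawn, and domination passes
through the other sampling steps. Since `q` has at most `Z` bits, `q ^ n * 2 ^ l ≤ 2 ^ (n * Z + l)`.
-/
lemma game_leMul {Z : Polynomial ℕ} {l : ℕ}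
    (hZ : ∀ P ∈ (W.com.gen.run l (.num 0)).support, P.size ≤ Z.eval l) (b : Bool)
    (tags : List SimTrans → PMF (List ℕ)) :
    (W.game A b l tags (redRand A Z l)).LeMul (ENNReal.ofReal (1 + (1 / 2) ^ l))
      (W.game A b l tags (exactRand A l)) := by
  refine PMF.LeMul.bind_right fun P hP => PMF.LeMul.bind_right fun s _ =>
    PMF.LeMul.bind_right fun ρ _ => PMF.LeMul.bind_right fun ρs _ => PMF.LeMul.bind ?_ _
  have : NeZero (W.com.order P) := ⟨(exists_order hP).1.ne_zero⟩
  refine leMul_uniformBits_map_lowDigits _ _ _ _ ?_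
  rw [pow_add, mul_comm (A.rounds.eval l), pow_mul]
  refine Nat.mul_le_mul_right _ (Nat.pow_le_pow_left ?_ _)
  have h1 : (W.com.order P).size ≤ Z.eval l :=
    ((Data.size_toNat_le _).trans ((Data.size_fst_le _).trans (Data.size_snd_le _))).trans (hZ P hP)
  exact (Nat.lt_size_self _).le.trans (Nat.pow_le_pow_right (by norm_num) h1)

/-- Parameter generation is polynomial time, so its output, and with it the bit length of the group
order, is polynomially bounded in `l`. -/
lemma exists_params_size_bound (W : WalletSystem) :
    ∃ Z : Polynomial ℕ, ∀ l, ∀ P ∈ (W.com.gen.run l (.num 0)).support, P.size ≤ Z.eval l := by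
  have hf : Feasible W.com.gen.fn := W.com.gen.poly
  obtain ⟨p, hp⟩ := hf.polyBounded
  refine ⟨p.comp (2 * .X + W.com.gen.coins + 5), fun l P hP => ?_⟩
  rw [RandAlg.run, PMF.mem_support_map_iff] at hP
  obtain ⟨ρ, hρ, rfl⟩ := hP
  refine (hp _).trans ?_
  rw [Polynomial.eval_comp]
  refine p.eval_mono_nat ?_
  have h1 := Nat.size_le.2 (lt_of_mem_support_uniformBits hρ)
  change 1 + (Data.unary l).size + (1 + (1 + ρ.size) + (1 + Nat.size 0)) ≤ _
  rw [Data.size_unary]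
  simp only [Polynomial.eval_add, Polynomial.eval_mul, Polynomial.eval_X, Polynomial.eval_ofNat,
    Nat.size_zero]
  omega

/-! ### Uniform tags hide the world

Pedersen commitments are perfectly hiding, and the sum of the randomness reveals only the total; so
this step is an equality of distributions and does not use the computational hiding assumption. -/

/-- Adds `ds` to the first entries of `rs`, modulo `q`. -/
def addMod (q : ℕ) : List ℕ → List ℕ → List ℕ
  | [], rs => rs
  | _ :: _, [] => []
  | d :: ds, r :: rs => (r + d) % q :: addMod q ds rs

/-- Translation by a constant permutes the residues modulo `q`, in each entry separately. -/
lemma iid_map_addMod (q : ℕ) [NeZero q] (ds : List ℕ) (n : ℕ) :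
    ((uniformBelow q).iid n).map (addMod q ds) = (uniformBelow q).iid n := by
  induction n generalizing ds with
  | zero => cases ds <;> simp [PMF.iid, PMF.pure_map, addMod]
  | succ n ih =>
    cases ds with
    | nil => exact PMF.map_id _
    | cons d ds =>
      rw [PMF.iid, PMF.map_bind]
      simp only [PMF.map_comp, Function.comp_def, addMod]
      have h := congrArg (fun p => p.bind fun r => ((uniformBelow q).iid n).map fun l => r :: l)
        (uniformBelow_map_add q d)
      rw [PMF.bind_map] at h
      refine Eq.trans (congrArg _ (funext fun r => ?_)) h
      conv_rhs => rw [Function.comp_apply, ← ih ds, PMF.map_comp]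
      rfl

/-- The corrections of the commitment randomness that replace the prices of `T` by those of `T'`,
where `g = h ^ t`. -/
def corrections (q t : ℕ) (T T' : List SimTrans) : List ℕ :=
  List.zipWith (fun x x' => t * x.price + (q - 1) * (t * x'.price)) T T'

/-- With `g = h ^ t`, a commitment is `h` to the power `t * p + r`, and the correction keeps this
exponent modulo `q`. The factor `q - 1` stands for `-1`, as everything is a natural number. The
second part records how the sum of the randomness moves. -/
lemma mkTransList_corrections {l : ℕ} {P : Data}
    (hP : P ∈ (W.com.gen.run l (.num 0)).support) {t : ℕ} (ht : W.com.h P ^ t = W.com.g P)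
    (s : Data) (ε : ℕ) (T : List SimTrans) :
    ∀ (T' : List SimTrans) (τs rs ρs : List ℕ), T.length = T'.length → τs.length = T.length →
      T.length ≤ rs.length → T.length ≤ ρs.length →
      ((W.mkTransList l P s ε T' τs (addMod (W.com.order P)
          (corrections (W.com.order P) t T T') rs) ρs).map fun x => (x.2.sig, x.2.tag, x.2.com)) =
        ((W.mkTransList l P s ε T τs rs ρs).map fun x => (x.2.sig, x.2.tag, x.2.com)) ∧
      ((W.mkTransList l P s ε T' τs (addMod (W.com.order P)
          (corrections (W.com.order P) t T T') rs) ρs).map fun x => x.2.r).sum ≡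
        ((W.mkTransList l P s ε T τs rs ρs).map fun x => x.2.r).sum +
          (t * (T.map SimTrans.price).sum +
            (W.com.order P - 1) * (t * (T'.map SimTrans.price).sum)) [MOD W.com.order P] := by
  obtain ⟨hprime, hcard, -, hcom⟩ := exists_order hP
  set q := W.com.order P with hq
  have hhq : W.com.h P ^ q = 1 := by rw [← hcard]; exact pow_card_eq_one'
  have hmod : ∀ n, W.com.h P ^ (n % q) = W.com.h P ^ n := fun n => by
    conv_rhs => rw [← Nat.mod_add_div n q, pow_add, pow_mul, hhq, one_pow, mul_one]
  induction T with
  | nil =>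
    intro T' τs rs ρs h _ _ _
    obtain rfl : T' = [] := List.eq_nil_of_length_eq_zero h.symm
    simp [mkTransList, Nat.ModEq]
  | cons x T ih =>
    intro T' τs rs ρs h1 h2 h3 h4
    match T', τs, rs, ρs, h1, h2, h3, h4 with
    | x' :: T', τ :: τs, r :: rs, ρ :: ρs, h1, h2, h3, h4 =>
    simp only [List.length_cons, Nat.add_right_cancel_iff, Nat.add_le_add_iff_right] at h1 h2 h3 h4
    obtain ⟨ih1, ih2⟩ := ih T' τs rs ρs h1 h2 h3 h4
    have hc : W.commitAlg l P x'.price ((r + (t * x.price + (q - 1) * (t * x'.price))) % q) =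
        W.commitAlg l P x.price r := by
      rw [hcom, hcom, Pedersen.commit, Pedersen.commit, ← ht, ← pow_mul, ← pow_mul,
        hmod, ← pow_add, ← pow_add]
      -- The new exponent is the old one plus a multiple of `q`: the new price occurs `1 + (q - 1)`
      -- times.
      have : t * x'.price + (r + (t * x.price + (q - 1) * (t * x'.price))) =
          (t * x.price + r) + q * (t * x'.price) := by
        obtain ⟨n, hn⟩ := Nat.exists_eq_succ_of_ne_zero hprime.ne_zero
        rw [hn, Nat.succ_sub_one, Nat.succ_mul]
        ring
      rw [this, pow_add _ _ (q * _), pow_mul _ q, hhq, one_pow, mul_one]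
    simp only [mkTransList, corrections, List.zipWith_cons_cons, addMod, List.zip_cons_cons,
      List.map_cons, List.sum_cons] at ih1 ih2 ⊢
    refine ⟨?_, ?_⟩
    · simp only [mkTrans, hc] at ih1 ⊢
      rw [ih1]
    · simp only [mkTrans] at ih2 ⊢
      refine ((Nat.mod_modEq _ _).add ih2).trans ?_
      exact congrArg (· % q) (by ring)

/-- Conditionally on all other samples, shifting the randomness of world `true` turns its reclaim
proof into that of world `false`, and the shift leaves the distribution invariant. The shift depends
on the interaction, but the randomness is drawn after it. -/
lemma game_uniformTags (l : ℕ) :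
    W.game A false l (W.uniformTags l) (exactRand A l) =
      W.game A true l (W.uniformTags l) (exactRand A l) := by
  refine PMF.bind_congr_support fun P hP => PMF.bind_congr_support fun s _ =>
    PMF.bind_congr_support fun ρ _ => PMF.bind_congr_support fun ρs hρs => ?_
  by_cases hm : W.Mismatch A l ρ P s
  · have hconst : ∀ T, (W.uniformTags l T).map (fun _ => false) = PMF.pure false :=
      fun T => PMF.map_const _ _
    simp only [auditOutput, if_pos hm, hconst]
  · obtain ⟨hprime, hcard, hgen, -⟩ := exists_order hP
    have : NeZero (W.com.order P) := ⟨hprime.ne_zero⟩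
    have hfin : Finite (W.com.Grp P) := Nat.finite_of_card_ne_zero (by rw [hcard]; exact hprime.ne_zero)
    -- The discrete logarithm enters only the analysis, so existence suffices. Finiteness of the
    -- group makes its exponent a natural number.
    obtain ⟨t, ht⟩ : ∃ t : ℕ, W.com.h P ^ t = W.com.g P :=
      (mem_powers_iff_mem_zpowers.2 (hgen (W.com.g P)))
    have hm' := not_or.1 hm
    rw [not_not, not_not] at hm'
    obtain ⟨hsum, hlen⟩ := hm'
    set T := W.challenge A l ρ P s false with hT
    set T' := W.challenge A l ρ P s true with hT'
    have hTR : T.length ≤ A.rounds.eval l := W.challenge_length_le A l ρ P s false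
    have hshift := iid_map_addMod (W.com.order P) (corrections (W.com.order P) t T T')
      (A.rounds.eval l)
    simp only [exactRand]
    conv_rhs => rw [← hshift, PMF.bind_map]
    refine PMF.bind_congr_support fun rs hrs => ?_
    -- Equal lengths make the tags of both worlds one and the same sample.
    simp only [Function.comp_apply, uniformTags, ← hlen]
    refine PMF.bind_congr_support fun τs hτs => ?_
    simp only [Function.comp_apply, auditOutput, if_neg hm]
    have hr := PMF.length_of_mem_support_iid hrs
    have hρ := PMF.length_of_mem_support_iid hρs
    obtain ⟨h1, h2⟩ := mkTransList_corrections hP ht s (W.auditPeriod A l ρ P s) T T' τs rs ρs hlen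
      (PMF.length_of_mem_support_iid hτs) (by omega) (by omega)
    rw [← hT, ← hT']
    have hproof : (W.createReclaimProof P (W.mkTransList l P s (W.auditPeriod A l ρ P s) T τs rs
        ρs)).2 = (W.createReclaimProof P (W.mkTransList l P s (W.auditPeriod A l ρ P s) T' τs
          (addMod (W.com.order P) (corrections (W.com.order P) t T T') rs) ρs)).2 := by
      simp only [createReclaimProof, ReclaimProof.mk.injEq]
      refine ⟨?_, h1.symm⟩
      refine (h2.trans ?_).symm
      -- Here equality of the totals enters: the shift of the sum is `1 + (q - 1)` times the same
      -- number, hence `0` modulo `q`, and `rSum` agrees.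
      have hzero : t * (T.map SimTrans.price).sum +
          (W.com.order P - 1) * (t * (T'.map SimTrans.price).sum) =
          W.com.order P * (t * (T.map SimTrans.price).sum) := by
        obtain ⟨n, hn⟩ := Nat.exists_eq_succ_of_ne_zero hprime.ne_zero
        rw [hn, Nat.succ_sub_one, Nat.succ_mul, ← hsum, add_comm]
      rw [hzero]
      exact Nat.add_mul_mod_self_left _ _ _
    rw [hproof]

/-! ### The advantage -/

lemma abs_prob_bind_sub_le {α : Type} {δ : ℝ} (hδ : 0 ≤ δ) (p : PMF α) {f g : α → PMF Bool}
    (h : ∀ a, (f a).LeMul (ENNReal.ofReal (1 + δ)) (g a)) :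
    |prob (p.bind f) true - prob (p.bind g) true| ≤ δ :=
  (PMF.LeMul.bind_right fun a _ => h a).abs_prob_sub_le hδ

/-- The chain runs from world `false` through its PRF exchange to uniform tags, changes the world
there at no cost, and returns through the exchange of world `true`. Each of the four runs of a
distinguisher deviates from its exact experiment by at most `2 ^ (-l)`. -/
lemma auditAdvantage_le {Z : Polynomial ℕ}
    (hZ : ∀ l, ∀ P ∈ (W.com.gen.run l (.num 0)).support, P.size ≤ Z.eval l) (l : ℕ) :
    W.auditAdvantage A l ≤
      |prob (W.prf.expReal (W.reduction A false Z) l) true -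
        prob (W.prf.expIdeal (W.reduction A false Z) l) true| +
      |prob (W.prf.expReal (W.reduction A true Z) l) true -
        prob (W.prf.expIdeal (W.reduction A true Z) l) true| + 4 * (1 / 2) ^ l := by
  have hδ : (0 : ℝ) ≤ (1 / 2) ^ l := by positivity
  have hexp : ∀ b, prob (W.expAudit A b l) (some true) =
      prob ((W.prf.kgen.run l (.num 0)).bind fun k =>
        W.game A b l (W.prfTags l k) (exactRand A l)) true := fun b => by
    rw [← expAudit_eq_game, prob, prob, PMF.map_apply, tsum_eq_single (some true)]
    · simp
    · intro o ho; simp [ho]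
  have hreal : ∀ b, |prob (W.prf.expReal (W.reduction A b Z) l) true -
      prob (W.expAudit A b l) (some true)| ≤ (1 / 2) ^ l := fun b => by
    rw [hexp, expReal_reduction]
    exact abs_prob_bind_sub_le hδ _ fun k => game_leMul (hZ l) b _
  have hideal : ∀ b, |prob (W.prf.expIdeal (W.reduction A b Z) l) true -
      prob (W.game A b l (W.uniformTags l) (exactRand A l)) true| ≤ (1 / 2) ^ l := fun b => by
    rw [expIdeal_reduction]
    exact (game_leMul (hZ l) b _).abs_prob_sub_le hδ
  have h1 := hreal false
  have h2 := hreal true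
  have h3 := hideal false
  have h4 := hideal true
  rw [game_uniformTags] at h3
  unfold auditAdvantage
  rw [abs_le] at h1 h2 h3 h4
  have h5 := le_abs_self (prob (W.prf.expReal (W.reduction A false Z) l) true -
        prob (W.prf.expIdeal (W.reduction A false Z) l) true)
  have h6 := neg_abs_le (prob (W.prf.expReal (W.reduction A false Z) l) true -
        prob (W.prf.expIdeal (W.reduction A false Z) l) true)
  have h7 := le_abs_self (prob (W.prf.expReal (W.reduction A true Z) l) true -
        prob (W.prf.expIdeal (W.reduction A true Z) l) true)
  have h8 := neg_abs_le (prob (W.prf.expReal (W.reduction A true Z) l) true -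
        prob (W.prf.expIdeal (W.reduction A true Z) l) true)
  rw [abs_le]
  constructor <;> linarith

lemma negligible_half_pow : Negligible fun l => (1 / 2) ^ l := fun n =>
  tendsto_pow_const_mul_const_pow_of_abs_lt_one n (by norm_num [abs_of_pos])

end WalletSystem

theorem mainTheorem4 (W : WalletSystem) (hHiding : W.com.Hiding) (hPRF : W.prf.Secure) :
    W.AuditPrivacy := by
  intro A
  obtain ⟨Z, hZ⟩ := W.exists_params_size_bound
  have h := ((hPRF (W.reduction A false Z)).add (hPRF (W.reduction A true Z))).add
    (WalletSystem.negligible_half_pow.const_mul 4)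
  refine h.trans_abs_le fun l => ?_
  rw [abs_of_nonneg (show 0 ≤ W.auditAdvantage A l from abs_nonneg _)]
  exact (WalletSystem.auditAdvantage_le hZ l).trans (le_abs_self _)
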